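/- Let $k_1,k_2,k_3\in\mathbb R$. On $\mathbb R[x_1,x_2,x_3]$ let $r_if(\dots,x_i,\dots)=f(\dots,-x_i,\dots)$ and let $T_if=\partial f/\partial x_i+k_i\,(f-r_if)/x_i$ be the Dunkl operators ($i=1,2,3$). On $\mathbb C^2\otimes_{\mathbb R}\mathbb R[x_1,x_2,x_3]$ let $e_i$ act on $\mathbb C^2$ by the Pauli matrix $\sigma_i$, put $\mathbf D=\sum_i e_i\otimes T_i$, and for $n\ge 0$ let $\mathscr M_n$ be the kernel of $\mathbf D$ on $\mathbb C^2\otimes\mathbb R[x_1,x_2,x_3]_n$ (polynomials homogeneous of degree $n$). The universal Bannai–Ito algebra $\mathfrak{BI}$ is the unital associative $\mathbb C$-algebra generated by $X,Y,Z$ subject to the relations that each of $\kappa=\{X,Y\}-Z$, $\lambda=\{Y,Z\}-X$, $\mu=\{Z,X\}-Y$ commutes with $X,Y,Z$, where $\{\,,\}$ is the anticommutator. It acts on $\mathscr M_n$ by $$X=\sqrt{-1}\,e_1(x_3T_2-x_2T_3)r_2r_3+\tfrac12r_2r_3+k_2r_3+k_3r_2$$ and by the formulas for $Y,Z$ obtained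 from it by the cyclic shift $1\to2\to3\to1$ of the indices. Let $t_i=-2k_i$ if $2k_i$ is an odd negative integer, and $t_i=\infty$ otherwise. Let $\mathscr M_n(x_i)$ be the intersection of $\mathscr M_n$ with $\bigoplus_{m=t_i}^n\mathbb C^2\otimes(x_i^m\cdot R_{n-m})$, where $R$ is the polynomial ring in the two other variables; it is a $\mathfrak{BI}$-submodule of $\mathscr M_n$. For $a,b,c\in\mathbb C$ and $d\ge1$ odd (resp. $d\ge0$ even), $E_d(a,b,c)$ (resp. $O_d(a,b,c)$) denotes the $(d+1)$-dimensional $\mathfrak{BI}$-module with a basis $v_0,\dots,v_d$ such that $Xv_i=\theta_iv_i+v_{i+1}$ and $Yv_i=\theta_i^*v_i+\varphi_iv_{i-1}$ ($v_{-1}=v_{d+1}=0$), with $\theta_i=(-1)^i(2a-d+2i)/2$, $\theta_i^*=(-1)^i(2b-d+2i)/2$, and: for $E_d$: $\varphi_i=i(d-i+1)$ if $i$ is even, $\varphi_i=c^2-(2a+2b-d+2i-1)^2/4$ if $i$ is odd, and $\kappa$ acts as $c^2-a^2-b^2+(d+1)^2/4$; for $O_d$: $\varphi_i=i(d+1-2i-2a-2b-2c)/2$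 if $i$ is even, $\varphi_i=(i-d-1)(d+1-2i-2a-2b+2c)/2$ if $i$ is odd, and $\kappa$ acts as $2ab-c(d+1)$. For an automorphism $\varepsilon$ of $\mathfrak{BI}$ and a $\mathfrak{BI}$-module $V$, $V^{\varepsilon}$ is the space $V$ on which $u\in\mathfrak{BI}$ acts as $\varepsilon(u)$ does on $V$. An element $(\epsilon,\delta)\in\{\pm1\}^2$ stands for the automorphism $X\mapsto\epsilon X,\ Y\mapsto\delta Y,\ Z\mapsto\epsilon\delta Z$; the permutation $(1\,2\,3)$ stands for $X\mapsto Y\mapsto Z\mapsto X$, and $(1\,3\,2)$ for its inverse; a pair $((\epsilon,\delta),\sigma)$ stands for the composite, $\sigma$ first and then $(\epsilon,\delta)$. Write $K=k_1+k_2+k_3$ and $h=\frac{n+1}2$. **Theorem.** Let $n\ge0$ be an even integer. (a) Suppose that $t_2\le n<\min\{t_1,t_3\}$. Then $\mathscr M_n(x_2)$ is isomorphic to a direct sum of two copies of $E_{n-t_2}(k_3+h,-K-h,-k_1-h)^{(-1,1)}$, and $\mathscr M_n/\mathscr M_n(x_2)$ is isomorphic to a direct sum of two copies of $O_{t_2-1}(k_3,-K-n-1,-k_1)^{(1,-1)}$.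 If moreover $k_1,k_3\ge0$, then these two modules $E_{n-t_2}(\cdots)^{(-1,1)}$ and $O_{t_2-1}(\cdots)^{(1,-1)}$ are irreducible, and they are isomorphic to $E_{n-t_2}(k_3+h,K+h,k_1+h)^{(-1,1)}$ and $O_{t_2-1}(k_3,K+n+1,k_1)$, respectively. (b) Suppose that $t_3\le n<\min\{t_1,t_2\}$. Then $\mathscr M_n(x_3)$ is isomorphic to a direct sum of two copies of $E_{n-t_3}(k_1+h,-K-h,-k_2-h)^{((-1,1),(1\,3\,2))}$, and $\mathscr M_n/\mathscr M_n(x_3)$ is isomorphic to a direct sum of two copies of $O_{t_3-1}(k_1,-K-n-1,-k_2)^{((1,-1),(1\,3\,2))}$. If moreover $k_1,k_2\ge0$, then these two modules are irreducible, and they are isomorphic to $E_{n-t_3}(k_2+h,k_1+h,K+h)^{(-1,-1)}$ and $O_{t_3-1}(k_2,k_1,K+n+1)$, respectively. (c) Suppose that $t_1\le n<\min\{t_2,t_3\}$. Then $\mathscr M_n(x_1)$ is isomorphic to a direct sum of two copies of $E_{n-t_1}(k_2+h,-K-h,-k_3-h)^{((-1,1),(1\,2\,3))}$, and $\mathscr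 M_n/\mathscr M_n(x_1)$ is isomorphic to a direct sum of two copies of $O_{t_1-1}(k_2,-K-n-1,-k_3)^{((1,-1),(1\,2\,3))}$. If moreover $k_2,k_3\ge0$, then these two modules are irreducible, and they are isomorphic to $E_{n-t_1}(K+h,k_3+h,k_2+h)^{(1,-1)}$ and $O_{t_1-1}(K+n+1,k_3,k_2)$, respectively. All isomorphisms are isomorphisms of $\mathfrak{BI}$-modules. -/

import Mathlib

set_option linter.all false

namespace DunklBI

open Complex MvPolynomial
open scoped TensorProduct

/-- Auxiliary (for proofs only): the relations between Clifford generators `s`, coordinates `x`,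
Dunkl operators `T` and reflections `r` in an algebra. -/
structure DunklData {A : Type*} [Ring A] [Algebra ℂ A] (k : Fin 3 → ℂ) (s x T r : Fin 3 → A) : Prop where
  s_sq : ∀ i, s i * s i = 1
  s_cyc : ∀ i, s i * s (i + 1) = I • s (i + 2)
  s_cyc' : ∀ i, s (i + 1) * s i = (-I) • s (i + 2)
  x_s : ∀ i j, x i * s j = s j * x i
  T_s : ∀ i j, T i * s j = s j * T i
  r_s : ∀ i j, r i * s j = s j * r i
  x_x : ∀ i j, x i * x j = x j * x i
  T_T : ∀ i j, T i * T j = T j * T i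
  r_r : ∀ i j, r i * r j = r j * r i
  T_x : ∀ i j, i ≠ j → T i * x j = x j * T i
  r_x : ∀ i j, i ≠ j → r i * x j = x j * r i
  r_T : ∀ i j, i ≠ j → r i * T j = T j * r i
  T_x_self : ∀ i, T i * x i = x i * T i + 1 + (2 * k i) • r i
  r_x_self : ∀ i, r i * x i = - (x i * r i)
  r_T_self : ∀ i, r i * T i = - (T i * r i)
  r_sq : ∀ i, r i * r i = 1

namespace DunklData

theorem reassoc {A : Type*} [Ring A] {a b c : A} (h : a * b = c) (z : A) :
    a * (b * z) = c * z := by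
  rw [← mul_assoc, h]

variable {A : Type*} [Ring A] [Algebra ℂ A] {k : Fin 3 → ℂ} {s x T r : Fin 3 → A}

/-- Auxiliary: the Bannai--Ito operators written in such an algebra. -/
noncomputable def J (k : Fin 3 → ℂ) (s x T r : Fin 3 → A) (i : Fin 3) : A :=
  I • (s i * (x (i + 2) * T (i + 1) - x (i + 1) * T (i + 2)) * r (i + 1) * r (i + 2))
    + (1 / 2 : ℂ) • (r (i + 1) * r (i + 2)) + k (i + 1) • r (i + 2) + k (i + 2) • r (i + 1)

/-- Auxiliary: the Casimir element that occurs in the anticommutators of the operators `J`. -/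
noncomputable def cas (s x T r : Fin 3 → A) : A :=
  (1 / 2 : ℂ) • (((∑ i, s i * T i) * (∑ i, s i * x i) - (∑ i, s i * x i) * (∑ i, s i * T i) - 1)
    * (r 0 * r 1 * r 2))

theorem core (H : DunklData k s x T r) (i : Fin 3) :
    ((∑ m, s m * T m) * J k s x T r i = J k s x T r i * ∑ m, s m * T m) ∧
    ((∑ m, s m * x m) * J k s x T r i = J k s x T r i * ∑ m, s m * x m) ∧
    ((r 0 * r 1 * r 2) * J k s x T r i = J k s x T r i * (r 0 * r 1 * r 2)) ∧
    J k s x T r i * J k s x T r (i + 1) + J k s x T r (i + 1) * J k s x T r i - J k s x T r (i + 2)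
      = (2 * k i * k (i + 1)) • (1 : A) + (2 * k (i + 2)) • cas s x T r := by
  have hsum : ∀ f : Fin 3 → A, ∑ m, f m = f i + f (i + 1) + f (i + 2) := by
    intro f; fin_cases i <;> simp [Fin.sum_univ_three] <;> abel
  have hP : r 0 * r 1 * r 2 = r i * r (i + 1) * r (i + 2) := by
    fin_cases i
    · rfl
    · show _ = r 1 * r 2 * r 0
      rw [H.r_r 0 1, mul_assoc, H.r_r 0 2, mul_assoc]
    · show _ = r 2 * r 0 * r 1
      rw [mul_assoc, H.r_r 1 2, ← mul_assoc, H.r_r 0 2]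
  have c1 := H.s_cyc i
  have c2 := H.s_cyc (i + 1)
  have c3 := H.s_cyc (i + 2)
  have d1 := H.s_cyc' i
  have d2 := H.s_cyc' (i + 1)
  have d3 := H.s_cyc' (i + 2)
  have hij : i ≠ i + 1 := by fin_cases i <;> decide
  have hil : i ≠ i + 2 := by fin_cases i <;> decide
  have hjl : i + 1 ≠ i + 2 := by fin_cases i <;> decide
  have q1 : i + 1 + 1 = i + 2 := by fin_cases i <;> rfl
  have q2 : i + 1 + 2 = i := by fin_cases i <;> rfl
  have q3 : i + 2 + 1 = i := by fin_cases i <;> rfl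
  have q4 : i + 2 + 2 = i + 1 := by fin_cases i <;> rfl
  rw [q1, q2] at c2 d2
  rw [q3, q4] at c3 d3
  simp only [cas, hsum, hP, J, q1, q2, q3, q4]
  clear hsum hP q1 q2 q3 q4
  generalize i + 2 = l at *
  generalize i + 1 = j at *
  have e1 := H.x_x j i
  have e2 := H.x_x l i
  have e3 := H.x_x l j
  have f1 := H.T_T j i
  have f2 := H.T_T l i
  have f3 := H.T_T l j
  have g1 := H.r_r j i
  have g2 := H.r_r l i
  have g3 := H.r_r l j
  have T_x' : ∀ m n, m ≠ n → ∀ z, T m * (x n * z) = x n * T m * z :=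
    fun m n h => reassoc (H.T_x m n h)
  have r_x' : ∀ m n, m ≠ n → ∀ z, r m * (x n * z) = x n * r m * z :=
    fun m n h => reassoc (H.r_x m n h)
  have r_T' : ∀ m n, m ≠ n → ∀ z, r m * (T n * z) = T n * r m * z :=
    fun m n h => reassoc (H.r_T m n h)
  have n1 := hij.symm
  have n2 := hil.symm
  have n3 := hjl.symm
  refine ⟨?_, ?_, ?_, ?_⟩ <;>
  · simp only [mul_add, add_mul, mul_sub, sub_mul, smul_mul_assoc, mul_smul_comm, mul_assoc,
      smul_add, smul_sub, smul_neg, mul_neg, neg_mul, neg_neg, mul_one, one_mul, smul_smul,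
      c1, c2, c3, d1, d2, d3, e1, e2, e3, f1, f2, f3, g1, g2, g3, reassoc c1, reassoc c2,
      reassoc c3, reassoc d1, reassoc d2, reassoc d3, reassoc e1, reassoc e2, reassoc e3,
      reassoc f1, reassoc f2, reassoc f3, reassoc g1, reassoc g2, reassoc g3,
      H.s_sq, H.x_s, H.T_s, H.r_s, H.T_x_self, H.r_x_self, H.r_T_self, H.r_sq,
      fun m => reassoc (H.s_sq m), fun m n => reassoc (H.x_s m n), fun m n => reassoc (H.T_s m n),
      fun m n => reassoc (H.r_s m n), fun m => reassoc (H.T_x_self m),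
      fun m => reassoc (H.r_x_self m), fun m => reassoc (H.r_T_self m),
      fun m => reassoc (H.r_sq m), H.T_x, H.r_x, H.r_T, T_x', r_x', r_T', hij, hil, hjl,
      n1, n2, n3, ne_eq, not_false_eq_true]
    all_goals match_scalars <;> ring_nf <;> (try simp [Complex.I_sq]) <;> (try ring_nf)

theorem commute_cas (H : DunklData k s x T r) (i : Fin 3) :
    Commute (cas s x T r) (J k s x T r i) := by
  obtain ⟨h1, h2, h3, -⟩ := H.core i
  have h1 : Commute _ _ := h1
  have h2 : Commute _ _ := h2
  have h3 : Commute _ _ := h3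
  exact (((((h1.mul_left h2).sub_left (h2.mul_left h1)).sub_left
    (Commute.one_left _)).mul_left h3).smul_left _)

theorem relations (H : DunklData k s x T r) (i j : Fin 3) :
    (J k s x T r i * J k s x T r (i + 1) + J k s x T r (i + 1) * J k s x T r i
        - J k s x T r (i + 2)) * J k s x T r j
      = J k s x T r j * (J k s x T r i * J k s x T r (i + 1)
        + J k s x T r (i + 1) * J k s x T r i - J k s x T r (i + 2)) := by
  rw [(H.core i).2.2.2]
  exact ((Commute.one_left (J k s x T r j)).smul_left (2 * k i * k (i + 1))).add_left
    ((H.commute_cas j).smul_left (2 * k (i + 2)))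

end DunklData

/-- The polynomial ring `ℝ[x₁, x₂, x₃]`. The coordinates, and likewise the multiplicities
`k₁, k₂, k₃`, are indexed by `0, 1, 2 : Fin 3`. -/
abbrev Poly3 : Type := MvPolynomial (Fin 3) ℝ

/-- The reflection `f ↦ f(…, -xᵢ, …)`. -/
noncomputable def reflect (i : Fin 3) : Poly3 →ₐ[ℝ] Poly3 :=
  aeval fun j => if j = i then -X j else X j

theorem reflect_monomial (i : Fin 3) (a : Fin 3 →₀ ℕ) (c : ℝ) :
    reflect i (monomial a c) = monomial a ((-1) ^ a i * c) := by
  rw [reflect, aeval_monomial, MvPolynomial.monomial_eq, Finsupp.prod_fintype _ _ (by simp),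
    Finsupp.prod_fintype _ _ (by simp), MvPolynomial.algebraMap_eq]
  fin_cases i <;> simp [Fin.prod_univ_three, neg_pow (X _ : Poly3)] <;> ring

/-- `f - f(…, -xᵢ, …)` is divisible by `xᵢ`, and `divMonomial` is the exact quotient. -/
theorem X_mul_divMonomial_sub_reflect (i : Fin 3) (f : Poly3) :
    X i * ((f - reflect i f).divMonomial (Finsupp.single i 1)) = f - reflect i f := by
  have h : X i ∣ f - reflect i f := by
    induction f using MvPolynomial.induction_on' with
    | monomial a c =>
      rw [reflect_monomial, ← map_sub, X_dvd_monomial]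
      by_cases ha : a i = 0
      · left; simp [ha]
      · exact Or.inr ha
    | add p q hp hq =>
      rw [map_add, add_sub_add_comm]
      exact dvd_add hp hq
  obtain ⟨g, hg⟩ := h
  rw [hg, X_mul_divMonomial]

/-- The Dunkl operator `f ↦ ∂f/∂xᵢ + κ (f - f(…, -xᵢ, …)) / xᵢ` on polynomials. -/
noncomputable def dunkl (κ : ℝ) (i : Fin 3) : Poly3 →ₗ[ℝ] Poly3 where
  toFun f := pderiv i f + κ • (f - reflect i f).divMonomial (Finsupp.single i 1)
  map_add' f g := by
    rw [map_add, map_add, add_sub_add_comm, add_divMonomial, smul_add]; abel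
  map_smul' c f := by
    have h : (c • f - reflect i (c • f)).divMonomial (Finsupp.single i 1)
        = c • (f - reflect i f).divMonomial (Finsupp.single i 1) := by
      ext m
      simp [coeff_divMonomial, mul_sub]
    rw [h, RingHom.id_apply, smul_add, smul_comm κ c]
    simp

theorem dunkl_monomial (κ : ℝ) (i : Fin 3) (a : Fin 3 →₀ ℕ) (c : ℝ) :
    dunkl κ i (monomial a c)
      = monomial (a - Finsupp.single i 1) ((a i + (1 - (-1) ^ a i) * κ) * c) := by
  show pderiv i (monomial a c) + κ • _ = _
  rw [pderiv_monomial, reflect_monomial, ← map_sub]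
  by_cases ha : a i = 0
  · simp [ha]
  · have h : (monomial a (c - (-1) ^ a i * c) : Poly3)
        = X i * monomial (a - Finsupp.single i 1) (c - (-1) ^ a i * c) := by
      have : Finsupp.single i 1 + (a - Finsupp.single i 1) = a := by
        apply add_tsub_cancel_of_le
        rw [Finsupp.single_le_iff]; omega
      rw [X, monomial_mul, this, one_mul]
    rw [h, X_mul_divMonomial, smul_monomial, ← map_add]
    congr 1
    simp only [smul_eq_mul]; ring

/-- The space `ℂ² ⊗ ℝ[x₁, x₂, x₃]`, a complex vector space through the first factor. -/
abbrev SpinorPoly : Type := (Fin 2 → ℂ) ⊗[ℝ] Poly3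

/-- The Pauli matrices `σ₁, σ₂, σ₃`. -/
noncomputable def pauli : Fin 3 → Matrix (Fin 2) (Fin 2) ℂ :=
  ![!![0, 1; 1, 0], !![0, -I; I, 0], !![1, 0; 0, -1]]

/-- The Clifford generator `eᵢ`, acting on `ℂ² ⊗ ℝ[x₁, x₂, x₃]` through the Pauli matrix `σᵢ`. -/
noncomputable def opE (i : Fin 3) : SpinorPoly →ₗ[ℂ] SpinorPoly :=
  TensorProduct.AlgebraTensorModule.map (Matrix.toLin' (pauli i)) LinearMap.id

/-- The operator `1 ⊗ g`. -/
noncomputable def opPoly (g : Poly3 →ₗ[ℝ] Poly3) : SpinorPoly →ₗ[ℂ] SpinorPoly :=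
  TensorProduct.AlgebraTensorModule.map LinearMap.id g

/-- Multiplication by `xᵢ`. -/
noncomputable def opX (i : Fin 3) : Module.End ℂ SpinorPoly := opPoly (LinearMap.mulLeft ℝ (X i))
/-- The Dunkl operator `Tᵢ` with multiplicity `kᵢ`. -/
noncomputable def opT (k : Fin 3 → ℝ) (i : Fin 3) : Module.End ℂ SpinorPoly := opPoly (dunkl (k i) i)
/-- The reflection in the coordinate `xᵢ`. -/
noncomputable def opR (i : Fin 3) : Module.End ℂ SpinorPoly := opPoly (reflect i).toLinearMap

theorem opE_tmul (i : Fin 3) (v : Fin 2 → ℂ) (p : Poly3) :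
    opE i (v ⊗ₜ[ℝ] p) = (pauli i).mulVec v ⊗ₜ[ℝ] p := rfl

theorem opPoly_tmul (g : Poly3 →ₗ[ℝ] Poly3) (v : Fin 2 → ℂ) (p : Poly3) :
    opPoly g (v ⊗ₜ[ℝ] p) = v ⊗ₜ[ℝ] g p := rfl

theorem SpinorPoly.ext_end {f g : Module.End ℂ SpinorPoly}
    (h : ∀ (v : Fin 2 → ℂ) (a : Fin 3 →₀ ℕ),
      f (v ⊗ₜ[ℝ] monomial a 1) = g (v ⊗ₜ[ℝ] monomial a 1)) : f = g := by
  apply TensorProduct.AlgebraTensorModule.ext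
  intro v p
  induction p using MvPolynomial.induction_on' with
  | monomial a c =>
    have : (monomial a c : Poly3) = c • monomial a 1 := by simp [smul_monomial]
    rw [this, ← TensorProduct.smul_tmul, h]
  | add p q hp hq => rw [TensorProduct.tmul_add, map_add, map_add, hp, hq]

theorem opX_mono (i : Fin 3) (v : Fin 2 → ℂ) (a : Fin 3 →₀ ℕ) (c : ℝ) :
    opX i (v ⊗ₜ[ℝ] monomial a c) = v ⊗ₜ[ℝ] monomial (a + Finsupp.single i 1) c := by
  rw [opX, opPoly_tmul, LinearMap.mulLeft_apply, X, monomial_mul, one_mul, add_comm]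

theorem opT_mono (k : Fin 3 → ℝ) (i : Fin 3) (v : Fin 2 → ℂ) (a : Fin 3 →₀ ℕ) (c : ℝ) :
    opT k i (v ⊗ₜ[ℝ] monomial a c) = v ⊗ₜ[ℝ] monomial (a - Finsupp.single i 1)
      ((a i + (1 - (-1) ^ a i) * k i) * c) := by
  rw [opT, opPoly_tmul, dunkl_monomial]

theorem opR_mono (i : Fin 3) (v : Fin 2 → ℂ) (a : Fin 3 →₀ ℕ) (c : ℝ) :
    opR i (v ⊗ₜ[ℝ] monomial a c) = v ⊗ₜ[ℝ] monomial a ((-1) ^ a i * c) := by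
  rw [opR, opPoly_tmul, AlgHom.toLinearMap_apply, reflect_monomial]

theorem pauli_mul (i : Fin 3) :
    pauli i * pauli i = 1 ∧ pauli i * pauli (i + 1) = I • pauli (i + 2) ∧
      pauli (i + 1) * pauli i = (-I) • pauli (i + 2) := by
  fin_cases i <;> refine ⟨?_, ?_, ?_⟩ <;> ext a b <;> fin_cases a <;> fin_cases b <;>
    simp [pauli, Matrix.mul_apply, Fin.sum_univ_two]

theorem aux_sub {a : Fin 3 →₀ ℕ} {i j : Fin 3} (h : i ≠ j) :
    (a - Finsupp.single i 1 : Fin 3 →₀ ℕ) j = a j := by simp [h.symm, Finsupp.single_apply, h]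

theorem aux_add {a : Fin 3 →₀ ℕ} {i j : Fin 3} (h : i ≠ j) :
    (a + Finsupp.single i 1 : Fin 3 →₀ ℕ) j = a j := by simp [Finsupp.single_apply, h]

theorem dunklData (k : Fin 3 → ℝ) :
    DunklData (fun i => (k i : ℂ)) opE opX (opT k) opR where
  s_sq i := SpinorPoly.ext_end fun v a => by
    simp only [Module.End.mul_apply, opE_tmul, Matrix.mulVec_mulVec, (pauli_mul i).1,
      Matrix.one_mulVec, Module.End.one_apply]
  s_cyc i := SpinorPoly.ext_end fun v a => by
    simp only [Module.End.mul_apply, opE_tmul, Matrix.mulVec_mulVec, (pauli_mul i).2.1,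
      LinearMap.smul_apply, Matrix.smul_mulVec, TensorProduct.smul_tmul']
  s_cyc' i := SpinorPoly.ext_end fun v a => by
    simp only [Module.End.mul_apply, opE_tmul, Matrix.mulVec_mulVec, (pauli_mul i).2.2,
      LinearMap.smul_apply, Matrix.smul_mulVec, TensorProduct.smul_tmul']
  x_s i j := SpinorPoly.ext_end fun v a => rfl
  T_s i j := SpinorPoly.ext_end fun v a => rfl
  r_s i j := SpinorPoly.ext_end fun v a => rfl
  x_x i j := SpinorPoly.ext_end fun v a => by
    simp only [Module.End.mul_apply, opX_mono, add_right_comm]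
  T_T i j := SpinorPoly.ext_end fun v a => by
    by_cases h : i = j
    · rw [h]
    · simp only [Module.End.mul_apply, opT_mono, aux_sub h, aux_sub (Ne.symm h)]
      rw [tsub_right_comm]
      congr 2; ring
  r_r i j := SpinorPoly.ext_end fun v a => by
    simp only [Module.End.mul_apply, opR_mono]
    congr 2; ring
  T_x i j h := SpinorPoly.ext_end fun v a => by
    simp only [Module.End.mul_apply, opT_mono, opX_mono, aux_add (Ne.symm h)]
    by_cases ha : a i = 0
    · simp [ha]
    · congr 3
      rw [tsub_add_eq_add_tsub]
      rw [Finsupp.single_le_iff]; omega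
  r_x i j h := SpinorPoly.ext_end fun v a => by
    simp only [Module.End.mul_apply, opR_mono, opX_mono, aux_add (Ne.symm h)]
  r_T i j h := SpinorPoly.ext_end fun v a => by
    simp only [Module.End.mul_apply, opR_mono, opT_mono, aux_sub (Ne.symm h)]
    congr 2; ring
  T_x_self i := SpinorPoly.ext_end fun v a => by
    simp only [Module.End.mul_apply, opT_mono, opX_mono, opR_mono, LinearMap.add_apply,
      LinearMap.smul_apply, Module.End.one_apply]
    have e1 : ((2 * (k i : ℂ)) • (v ⊗ₜ[ℝ] (monomial a ((-1) ^ a i * 1) : Poly3)))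
        = v ⊗ₜ[ℝ] (monomial a (2 * k i * (-1) ^ a i) : Poly3) := by
      have : (2 * (k i : ℂ)) • v = (2 * k i) • v := by
        ext t; simp
      rw [TensorProduct.smul_tmul', this, TensorProduct.smul_tmul, smul_monomial]
      simp
    have e2 : v ⊗ₜ[ℝ] (monomial (a - Finsupp.single i 1 + Finsupp.single i 1)
        ((a i + (1 - (-1) ^ a i) * k i) * 1) : Poly3)
        = v ⊗ₜ[ℝ] (monomial a ((a i + (1 - (-1) ^ a i) * k i) * 1) : Poly3) := by
      by_cases ha : a i = 0
      · simp [ha]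
      · rw [tsub_add_cancel_of_le]
        rw [Finsupp.single_le_iff]; omega
    rw [e1, e2, ← TensorProduct.tmul_add, ← TensorProduct.tmul_add, ← map_add, ← map_add,
      add_tsub_cancel_right]
    congr 2
    simp [pow_succ]; ring
  r_x_self i := SpinorPoly.ext_end fun v a => by
    simp only [Module.End.mul_apply, opR_mono, opX_mono, LinearMap.neg_apply,
      ← TensorProduct.tmul_neg, ← map_neg]
    congr 2
    simp [pow_succ]
  r_T_self i := SpinorPoly.ext_end fun v a => by
    simp only [Module.End.mul_apply, opR_mono, opT_mono, LinearMap.neg_apply,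
      ← TensorProduct.tmul_neg, ← map_neg]
    by_cases ha : a i = 0
    · simp [ha]
    · obtain ⟨m, hm⟩ := Nat.exists_eq_succ_of_ne_zero ha
      congr 2
      simp [hm, pow_succ]
      ring
  r_sq i := SpinorPoly.ext_end fun v a => by
    simp only [Module.End.mul_apply, opR_mono, Module.End.one_apply]
    congr 2
    rw [← mul_assoc, ← mul_pow]; simp

/-- The defining relations of the universal Bannai--Ito algebra, for the generators
`X, Y, Z = ι 0, ι 1, ι 2` (indices are cyclic in `Fin 3`): each of `{X, Y} - Z`, `{Y, Z} - X`,
`{Z, X} - Y` commutes with each of `X, Y, Z`. -/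
inductive BIRel : FreeAlgebra ℂ (Fin 3) → FreeAlgebra ℂ (Fin 3) → Prop
  | comm (i j : Fin 3) : BIRel
      ((FreeAlgebra.ι ℂ i * FreeAlgebra.ι ℂ (i + 1) + FreeAlgebra.ι ℂ (i + 1) * FreeAlgebra.ι ℂ i
        - FreeAlgebra.ι ℂ (i + 2)) * FreeAlgebra.ι ℂ j)
      (FreeAlgebra.ι ℂ j * (FreeAlgebra.ι ℂ i * FreeAlgebra.ι ℂ (i + 1)
        + FreeAlgebra.ι ℂ (i + 1) * FreeAlgebra.ι ℂ i - FreeAlgebra.ι ℂ (i + 2)))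

/-- The universal Bannai--Ito algebra over `ℂ`. -/
def BI : Type := RingQuot BIRel

noncomputable instance : Ring BI := inferInstanceAs (Ring (RingQuot BIRel))

noncomputable instance : Algebra ℂ BI := inferInstanceAs (Algebra ℂ (RingQuot BIRel))

namespace BI

/-- The quotient map. -/
noncomputable def mk : FreeAlgebra ℂ (Fin 3) →ₐ[ℂ] BI := RingQuot.mkAlgHom ℂ BIRel

/-- The generators `X, Y, Z` of the Bannai--Ito algebra are `gen 0, gen 1, gen 2`. -/
noncomputable def gen (i : Fin 3) : BI := mk (FreeAlgebra.ι ℂ i)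

/-- The triple `g 0, g 1, g 2` satisfies the relations of the Bannai--Ito algebra. -/
def IsBITriple {A : Type*} [Ring A] [Algebra ℂ A] (g : Fin 3 → A) : Prop :=
  ∀ i j, (g i * g (i + 1) + g (i + 1) * g i - g (i + 2)) * g j
    = g j * (g i * g (i + 1) + g (i + 1) * g i - g (i + 2))

theorem isBITriple_gen : IsBITriple gen := fun i j => by
  have h : mk _ = mk _ := RingQuot.mkAlgHom_rel ℂ (BIRel.comm i j)
  simp only [map_mul, map_add, map_sub] at h
  exact h

/-- The universal property of the Bannai--Ito algebra. -/
noncomputable def lift {A : Type*} [Ring A] [Algebra ℂ A] (g : Fin 3 → A) (h : IsBITriple g) :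
    BI →ₐ[ℂ] A :=
  RingQuot.liftAlgHom ℂ ⟨FreeAlgebra.lift ℂ g, fun _ _ hr => by
    cases hr with
    | comm i j => simpa using h i j⟩

theorem lift_gen {A : Type*} [Ring A] [Algebra ℂ A] (g : Fin 3 → A) (h : IsBITriple g)
    (i : Fin 3) : lift g h (gen i) = g i := by
  have : lift g h (gen i) = FreeAlgebra.lift ℂ g (FreeAlgebra.ι ℂ i) :=
    RingQuot.liftAlgHom_mkAlgHom_apply ℂ _ _ _
  rw [this, FreeAlgebra.lift_ι_apply]

theorem algHom_ext {A : Type*} [Ring A] [Algebra ℂ A] {f g : BI →ₐ[ℂ] A}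
    (h : ∀ i, f (gen i) = g (gen i)) : f = g := by
  refine RingQuot.ringQuot_ext' ℂ f g ?_
  apply FreeAlgebra.hom_ext
  funext i
  exact h i

theorem induction {C : BI → Prop} (h1 : ∀ c : ℂ, C (algebraMap ℂ BI c)) (h2 : ∀ i, C (gen i))
    (h3 : ∀ a b, C a → C b → C (a + b)) (h4 : ∀ a b, C a → C b → C (a * b)) (a : BI) : C a := by
  have hs : Function.Surjective mk := RingQuot.mkAlgHom_surjective ℂ BIRel
  obtain ⟨a, rfl⟩ := hs a
  induction a using FreeAlgebra.induction with
  | grade0 c => rw [AlgHom.commutes]; exact h1 c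
  | grade1 i => exact h2 i
  | mul a b ha hb => rw [map_mul]; exact h4 _ _ ha hb
  | add a b ha hb => rw [map_add]; exact h3 _ _ ha hb

/-- The signs by which `(ε, δ) ∈ {±1}²` acts on `X, Y, Z`: these are `ε, δ, εδ`. -/
def signs (ε : ℤˣ × ℤˣ) : Fin 3 → ℤˣ := ![ε.1, ε.2, ε.1 * ε.2]

theorem isBITriple_signs (ε : ℤˣ × ℤˣ) :
    IsBITriple fun i => (((signs ε i : ℤ) : ℂ)) • gen i := by
  intro i j
  have h := isBITriple_gen i j
  have hs : ((signs ε i : ℤ) : ℂ) * ((signs ε (i + 1) : ℤ) : ℂ) = ((signs ε (i + 2) : ℤ) : ℂ) := by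
    obtain ⟨e, f⟩ := ε
    rcases Int.units_eq_one_or e with rfl | rfl <;> rcases Int.units_eq_one_or f with rfl | rfl <;>
      fin_cases i <;> simp [signs]
  have key : ∀ z : BI, (((signs ε i : ℤ) : ℂ)) • gen i * (((signs ε (i + 1) : ℤ) : ℂ)) • gen (i + 1)
      + (((signs ε (i + 1) : ℤ) : ℂ)) • gen (i + 1) * (((signs ε i : ℤ) : ℂ)) • gen i
      - (((signs ε (i + 2) : ℤ) : ℂ)) • gen (i + 2)
      = ((signs ε (i + 2) : ℤ) : ℂ) •
        (gen i * gen (i + 1) + gen (i + 1) * gen i - gen (i + 2)) := by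
    intro _
    rw [smul_mul_smul_comm, smul_mul_smul_comm, mul_comm ((signs ε (i + 1) : ℤ) : ℂ), hs,
      smul_sub, smul_add]
  rw [key 0, smul_mul_smul_comm, smul_mul_smul_comm, h, mul_comm]

/-- The automorphism of the Bannai--Ito algebra given by an element of `{±1}²`; for instance
`(1, -1)` sends `X, Y, Z` to `X, -Y, -Z` and `(-1, 1)` sends them to `-X, Y, -Z`. -/
noncomputable def signAut (ε : ℤˣ × ℤˣ) : BI ≃ₐ[ℂ] BI :=
  AlgEquiv.ofAlgHom (lift _ (isBITriple_signs ε)) (lift _ (isBITriple_signs ε))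
    (algHom_ext fun i => by
      rcases Int.units_eq_one_or (signs ε i) with h | h <;> simp [lift_gen, h, smul_smul])
    (algHom_ext fun i => by
      rcases Int.units_eq_one_or (signs ε i) with h | h <;> simp [lift_gen, h, smul_smul])

theorem signAut_gen (ε : ℤˣ × ℤˣ) (i : Fin 3) :
    signAut ε (gen i) = ((signs ε i : ℤ) : ℂ) • gen i := lift_gen _ _ i

theorem isBITriple_perm (σ : Equiv.Perm (Fin 3)) : IsBITriple fun i => gen (σ i) := by
  intro i j
  have key : ∀ i : Fin 3,
      (∃ m, σ i = m ∧ σ (i + 1) = m + 1 ∧ σ (i + 2) = m + 2) ∨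
      (∃ m, σ i = m + 1 ∧ σ (i + 1) = m ∧ σ (i + 2) = m + 2) := by
    revert σ; decide
  rcases key i with ⟨m, h1, h2, h3⟩ | ⟨m, h1, h2, h3⟩
  · simp only [h1, h2, h3]; exact isBITriple_gen m (σ j)
  · simp only [h1, h2, h3]
    rw [add_comm (gen (m + 1) * gen m)]; exact isBITriple_gen m (σ j)

/-- The automorphism of the Bannai--Ito algebra that permutes `X, Y, Z` by `σ`. -/
noncomputable def permAut (σ : Equiv.Perm (Fin 3)) : BI ≃ₐ[ℂ] BI :=
  AlgEquiv.ofAlgHom (lift _ (isBITriple_perm σ)) (lift _ (isBITriple_perm σ⁻¹))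
    (algHom_ext fun i => by simp [lift_gen])
    (algHom_ext fun i => by simp [lift_gen])

theorem permAut_gen (σ : Equiv.Perm (Fin 3)) (i : Fin 3) :
    permAut σ (gen i) = gen (σ i) := lift_gen _ _ i

/-- The automorphism given by the element `(ε, σ)` of the semidirect product of `{±1}²` and the
symmetric group: first permute by `σ`, then apply the signs `ε`. -/
noncomputable def aut (ε : ℤˣ × ℤˣ) (σ : Equiv.Perm (Fin 3)) : BI ≃ₐ[ℂ] BI :=
  (permAut σ).trans (signAut ε)

theorem aut_gen (ε : ℤˣ × ℤˣ) (σ : Equiv.Perm (Fin 3)) (i : Fin 3) :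
    aut ε σ (gen i) = ((signs ε (σ i) : ℤ) : ℂ) • gen (σ i) := by
  rw [aut, AlgEquiv.trans_apply, permAut_gen, signAut_gen]

end BI

/-- The module `V^φ`: the space `V`, on which `x` acts as `φ(x)` acts on `V`. -/
def Twist (_φ : BI ≃ₐ[ℂ] BI) (V : Type*) : Type _ := V

instance (φ : BI ≃ₐ[ℂ] BI) (V : Type*) [AddCommGroup V] : AddCommGroup (Twist φ V) :=
  inferInstanceAs (AddCommGroup V)

noncomputable instance (φ : BI ≃ₐ[ℂ] BI) (V : Type*) [AddCommGroup V] [Module BI V] :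
    Module BI (Twist φ V) :=
  Module.compHom V (φ : BI →+* BI)

set_option maxHeartbeats 2000000 in
theorem bidiag {V : Type*} [AddCommGroup V] [Module ℂ V] (X Y : Module.End ℂ V) (e : ℕ → V)
    (t u p : ℕ → ℂ) (a b c d κ l m : ℂ)
    (hX : ∀ i, X (e i) = t i • e i + e (i + 1)) (hY0 : Y (e 0) = u 0 • e 0)
    (hY : ∀ i, Y (e (i + 1)) = u (i + 1) • e (i + 1) + p (i + 1) • e i)
    (ht : ∀ i : ℕ, t i = (-1) ^ i * (2 * a - d + 2 * i) / 2)
    (hu : ∀ i : ℕ, u i = (-1) ^ i * (2 * b - d + 2 * i) / 2)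
    (h : ((∀ i : ℕ, p i = (1 + (-1) ^ i) / 2 * (i * (d - i + 1))
      + (1 - (-1) ^ i) / 2 * (c ^ 2 - (2 * a + 2 * b - d + 2 * i - 1) ^ 2 / 4)) ∧
      κ = c ^ 2 - a ^ 2 - b ^ 2 + (d + 1) ^ 2 / 4 ∧ l = a ^ 2 - b ^ 2 - c ^ 2 + (d + 1) ^ 2 / 4 ∧
      m = b ^ 2 - c ^ 2 - a ^ 2 + (d + 1) ^ 2 / 4) ∨
      ((∀ i : ℕ, p i = (1 + (-1) ^ i) / 2 * (i * (d + 1 - 2 * i - 2 * a - 2 * b - 2 * c) / 2)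
      + (1 - (-1) ^ i) / 2 * ((i - d - 1) * (d + 1 - 2 * i - 2 * a - 2 * b + 2 * c) / 2)) ∧
      κ = 2 * a * b - c * (d + 1) ∧ l = 2 * b * c - a * (d + 1) ∧ m = 2 * c * a - b * (d + 1)))
    (n : ℕ) :
    (Y * (X * Y + Y * X - κ • 1) + (X * Y + Y * X - κ • 1) * Y - X) (e n)
      = (l • (1 : Module.End ℂ V)) (e n) ∧
    ((X * Y + Y * X - κ • 1) * X + X * (X * Y + Y * X - κ • 1) - Y) (e n)
      = (m • (1 : Module.End ℂ V)) (e n) := by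
  have hY1 := hY 0
  have hY2 := hY 1
  have hY3 := fun n => hY (n + 1)
  simp only [zero_add, Nat.reduceAdd] at hY1 hY2 hY3
  match n with
  | 0 | 1 | n + 2 =>
    constructor <;>
    · simp only [LinearMap.add_apply, LinearMap.sub_apply, Module.End.mul_apply,
        LinearMap.smul_apply, Module.End.one_apply, hX, hY0, hY1, hY2, hY3, hY, map_add, map_sub,
        map_smul, zero_add, Nat.reduceAdd]
      match_scalars <;> rcases h with ⟨hp, rfl, rfl, rfl⟩ | ⟨hp, rfl, rfl, rfl⟩ <;>
      rcases neg_one_pow_eq_or ℂ n with h | h <;>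
      simp only [ht, hu, hp, pow_succ, h, pow_zero] <;> push_cast <;> ring

/-- The numbers `θᵢ` (for the parameter `a`) and `θᵢ*` (for the parameter `b`). -/
noncomputable def biTheta (d : ℕ) (a : ℂ) (i : ℕ) : ℂ := (-1) ^ i * (2 * a - d + 2 * i) / 2

/-- The numbers `φᵢ` of the even-dimensional modules. -/
noncomputable def phiE (d : ℕ) (a b c : ℂ) (i : ℕ) : ℂ :=
  if Even i then i * (d - i + 1) else c ^ 2 - (2 * a + 2 * b - d + 2 * i - 1) ^ 2 / 4

/-- The numbers `φᵢ` of the odd-dimensional modules. -/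
noncomputable def phiO (d : ℕ) (a b c : ℂ) (i : ℕ) : ℂ :=
  if Even i then i * (d + 1 - 2 * i - 2 * a - 2 * b - 2 * c) / 2
  else (i - d - 1) * (d + 1 - 2 * i - 2 * a - 2 * b + 2 * c) / 2

/-- The lower bidiagonal matrix with diagonal `θ₀, …, θ_d` and subdiagonal `1, …, 1`. -/
noncomputable def matX (d : ℕ) (a : ℂ) : Matrix (Fin (d + 1)) (Fin (d + 1)) ℂ :=
  Matrix.of fun i j =>
    if i = j then biTheta d a i else if (i : ℕ) = j + 1 then 1 else 0

/-- The upper bidiagonal matrix with diagonal `θ₀*, …, θ_d*` and superdiagonal `φ₁, …, φ_d`. -/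
noncomputable def matY (d : ℕ) (b : ℂ) (φ : ℕ → ℂ) : Matrix (Fin (d + 1)) (Fin (d + 1)) ℂ :=
  Matrix.of fun i j =>
    if i = j then biTheta d b i else if (j : ℕ) = i + 1 then φ j else 0

/-- The standard basis vectors (zero for `i > d`). -/
def basisVec (d i : ℕ) : Fin (d + 1) → ℂ := fun j => if (j : ℕ) = i then 1 else 0

theorem matX_basis (d : ℕ) (a : ℂ) (i : ℕ) :
    (matX d a).mulVec (basisVec d i) = biTheta d a i • basisVec d i + basisVec d (i + 1) := by
  funext j
  by_cases h : i < d + 1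
  · have : basisVec d i = Pi.single ⟨i, h⟩ 1 := by
      funext t; simp [basisVec, Pi.single_apply, Fin.ext_iff]
    rw [this, Matrix.mulVec_single_one]
    simp [matX, basisVec, Pi.single_apply, Fin.ext_iff]
    split_ifs <;> simp_all
  · have h1 : basisVec d i = 0 := by
      funext t; have := t.2; simp [basisVec]; omega
    have h2 : basisVec d (i + 1) = 0 := by
      funext t; have := t.2; simp [basisVec]; omega
    simp [h1, h2]

theorem matY_basis_zero (d : ℕ) (b : ℂ) (φ : ℕ → ℂ) :
    (matY d b φ).mulVec (basisVec d 0) = biTheta d b 0 • basisVec d 0 := by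
  funext j
  have : basisVec d 0 = Pi.single ⟨0, d.succ_pos⟩ 1 := by
    funext t; simp only [basisVec, Pi.single_apply, Fin.ext_iff]
  rw [this, Matrix.mulVec_single_one]
  simp only [matY, Pi.single_apply, Fin.ext_iff, Matrix.col_apply, Matrix.of_apply, Pi.smul_apply]
  by_cases hj : (j : ℕ) = 0
  · simp [hj]
  · simp [hj]

theorem matY_basis_succ (d : ℕ) (b : ℂ) (φ : ℕ → ℂ) (hφ : φ (d + 1) = 0) (i : ℕ) :
    (matY d b φ).mulVec (basisVec d (i + 1))
      = biTheta d b (i + 1) • basisVec d (i + 1) + φ (i + 1) • basisVec d i := by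
  funext j
  by_cases h : i + 1 < d + 1
  · have : basisVec d (i + 1) = Pi.single ⟨i + 1, h⟩ 1 := by
      funext t; simp [basisVec, Pi.single_apply, Fin.ext_iff]
    rw [this, Matrix.mulVec_single_one, ← this]
    simp only [matY, basisVec, Fin.ext_iff, Matrix.col_apply, Matrix.of_apply, Pi.add_apply,
      Pi.smul_apply, smul_eq_mul]
    by_cases h1 : (j : ℕ) = i + 1
    · simp [h1]
    · by_cases h2 : (j : ℕ) = i
      · simp [h2]
      · have h3 : ¬ i = (j : ℕ) := fun h => h2 h.symm
        simp [h1, h2, h3]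
  · have h1 : basisVec d (i + 1) = 0 := by
      funext t; have := t.2; simp [basisVec]; omega
    have h2 : φ (i + 1) • basisVec d i = 0 := by
      by_cases hi : i = d
      · rw [hi, hφ, zero_smul]
      · have : basisVec d i = 0 := by
          funext t; have := t.2; simp [basisVec]; omega
        rw [this, smul_zero]
    simp [h1, h2]

theorem end_ext_basis {d : ℕ} {f g : Module.End ℂ (Fin (d + 1) → ℂ)}
    (h : ∀ i, f (basisVec d i) = g (basisVec d i)) : f = g := by
  apply LinearMap.pi_ext'
  intro i
  apply LinearMap.ext_ring
  have : basisVec d i = Pi.single i 1 := by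
    funext t; simp [basisVec, Pi.single_apply, Fin.ext_iff]
  simpa [this] using h i

theorem phiE_eq (d : ℕ) (a b c : ℂ) (i : ℕ) :
    phiE d a b c i = (1 + (-1) ^ i) / 2 * (i * (d - i + 1))
      + (1 - (-1) ^ i) / 2 * (c ^ 2 - (2 * a + 2 * b - d + 2 * i - 1) ^ 2 / 4) := by
  unfold phiE
  split_ifs with h
  · simp [h.neg_one_pow]
  · simp [(Nat.not_even_iff_odd.1 h).neg_one_pow]

theorem phiO_eq (d : ℕ) (a b c : ℂ) (i : ℕ) :
    phiO d a b c i = (1 + (-1) ^ i) / 2 * (i * (d + 1 - 2 * i - 2 * a - 2 * b - 2 * c) / 2)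
      + (1 - (-1) ^ i) / 2 * ((i - d - 1) * (d + 1 - 2 * i - 2 * a - 2 * b + 2 * c) / 2) := by
  unfold phiO
  split_ifs with h
  · simp [h.neg_one_pow]
  · simp [(Nat.not_even_iff_odd.1 h).neg_one_pow]


/-- The operator `X` on `E_d(a, b, c)` and on `O_d(a, b, c)`. -/
noncomputable def endX (d : ℕ) (a : ℂ) : Module.End ℂ (Fin (d + 1) → ℂ) := Matrix.toLin' (matX d a)

/-- The operator `Y` on `E_d(a, b, c)` and on `O_d(a, b, c)`. -/
noncomputable def endY (d : ℕ) (b : ℂ) (φ : ℕ → ℂ) : Module.End ℂ (Fin (d + 1) → ℂ) :=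
  Matrix.toLin' (matY d b φ)

/-- The operators `X, Y` and the operator `Z = {X, Y} - κ` that they determine. -/
noncomputable def biTriple {A : Type*} [Ring A] [Algebra ℂ A] (x y : A) (κ : ℂ) : Fin 3 → A :=
  ![x, y, x * y + y * x - κ • 1]

theorem isBITriple_biTriple {A : Type*} [Ring A] [Algebra ℂ A] {x y : A} {κ l m : ℂ}
    (h1 : y * (x * y + y * x - κ • 1) + (x * y + y * x - κ • 1) * y - x = l • 1)
    (h2 : (x * y + y * x - κ • 1) * x + x * (x * y + y * x - κ • 1) - y = m • 1) :
    BI.IsBITriple (biTriple x y κ) := by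
  have h : ∀ i, ∃ s : ℂ, biTriple x y κ i * biTriple x y κ (i + 1)
      + biTriple x y κ (i + 1) * biTriple x y κ i - biTriple x y κ (i + 2) = s • 1 := by
    intro i
    fin_cases i
    · refine ⟨κ, ?_⟩
      show x * y + y * x - (x * y + y * x - κ • 1) = _
      rw [sub_sub_cancel]
    · exact ⟨l, h1⟩
    · exact ⟨m, h2⟩
  intro i j
  obtain ⟨s, hs⟩ := h i
  rw [hs]; simp

theorem isBITriple_E {d : ℕ} (hd : Odd d) (a b c : ℂ) :
    BI.IsBITriple (biTriple (endX d a) (endY d b (phiE d a b c))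
      (c ^ 2 - a ^ 2 - b ^ 2 + ((d : ℂ) + 1) ^ 2 / 4)) := by
  have hφ : phiE d a b c (d + 1) = 0 := by simp [phiE, hd.add_one]
  have main := bidiag (endX d a) (endY d b (phiE d a b c)) (basisVec d) (biTheta d a) (biTheta d b)
    (phiE d a b c) a b c d _ _ _ (matX_basis d a) (matY_basis_zero d b _)
    (matY_basis_succ d b _ hφ) (fun _ => rfl) (fun _ => rfl)
    (Or.inl ⟨phiE_eq d a b c, rfl, rfl, rfl⟩)
  exact isBITriple_biTriple (end_ext_basis fun n => (main n).1) (end_ext_basis fun n => (main n).2)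

theorem isBITriple_O {d : ℕ} (hd : Even d) (a b c : ℂ) :
    BI.IsBITriple (biTriple (endX d a) (endY d b (phiO d a b c)) (2 * a * b - c * ((d : ℂ) + 1))) := by
  have hφ : phiO d a b c (d + 1) = 0 := by simp [phiO, hd.add_one]
  have main := bidiag (endX d a) (endY d b (phiO d a b c)) (basisVec d) (biTheta d a) (biTheta d b)
    (phiO d a b c) a b c d _ _ _ (matX_basis d a) (matY_basis_zero d b _)
    (matY_basis_succ d b _ hφ) (fun _ => rfl) (fun _ => rfl)
    (Or.inr ⟨phiO_eq d a b c, rfl, rfl, rfl⟩)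
  exact isBITriple_biTriple (end_ext_basis fun n => (main n).1) (end_ext_basis fun n => (main n).2)

/-- The `(d+1)`-dimensional module `E_d(a, b, c)` (`d` odd): `X` and `Y` act by the bidiagonal
matrices and `κ` acts as the scalar `c² - a² - b² + (d+1)²/4`. -/
def ModE (d : ℕ) (_hd : Odd d) (_a _b _c : ℂ) : Type := Fin (d + 1) → ℂ

noncomputable instance (d : ℕ) (hd : Odd d) (a b c : ℂ) : AddCommGroup (ModE d hd a b c) :=
  inferInstanceAs (AddCommGroup (Fin (d + 1) → ℂ))

noncomputable instance (d : ℕ) (hd : Odd d) (a b c : ℂ) : Module BI (ModE d hd a b c) :=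
  Module.compHom (Fin (d + 1) → ℂ)
    (BI.lift _ (isBITriple_E hd a b c) : BI →+* Module.End ℂ (Fin (d + 1) → ℂ))

/-- The `(d+1)`-dimensional module `O_d(a, b, c)` (`d` even): `X` and `Y` act by the bidiagonal
matrices and `κ` acts as the scalar `2ab - c(d+1)`. -/
def ModO (d : ℕ) (_hd : Even d) (_a _b _c : ℂ) : Type := Fin (d + 1) → ℂ

noncomputable instance (d : ℕ) (hd : Even d) (a b c : ℂ) : AddCommGroup (ModO d hd a b c) :=
  inferInstanceAs (AddCommGroup (Fin (d + 1) → ℂ))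

noncomputable instance (d : ℕ) (hd : Even d) (a b c : ℂ) : Module BI (ModO d hd a b c) :=
  Module.compHom (Fin (d + 1) → ℂ)
    (BI.lift _ (isBITriple_O hd a b c) : BI →+* Module.End ℂ (Fin (d + 1) → ℂ))

/-- The Dirac--Dunkl operator `e₁ ⊗ T₁ + e₂ ⊗ T₂ + e₃ ⊗ T₃`. -/
noncomputable def dirac (k : Fin 3 → ℝ) : SpinorPoly →ₗ[ℂ] SpinorPoly := ∑ i, opE i * opT k i

/-- The operators by which `X, Y, Z` act (for `i = 0, 1, 2`, indices cyclic). For instance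
`(X f)(x) = (√-1 e₁ ⊗ (x₃ T₂ - x₂ T₃)) f(x₁, -x₂, -x₃) + ½ f(x₁, -x₂, -x₃)
+ k₂ f(x₁, x₂, -x₃) + k₃ f(x₁, -x₂, x₃)`. -/
noncomputable def biOp (k : Fin 3 → ℝ) (i : Fin 3) : Module.End ℂ SpinorPoly :=
  I • (opE i * (opX (i + 2) * opT k (i + 1) - opX (i + 1) * opT k (i + 2))
      * opR (i + 1) * opR (i + 2))
    + (1 / 2 : ℂ) • (opR (i + 1) * opR (i + 2))
    + (k (i + 1) : ℂ) • opR (i + 2) + (k (i + 2) : ℂ) • opR (i + 1)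

theorem isBITriple_biOp (k : Fin 3 → ℝ) : BI.IsBITriple (biOp k) :=
  fun i j => (dunklData k).relations i j

theorem dirac_biOp (k : Fin 3 → ℝ) (i : Fin 3) (f : SpinorPoly) :
    dirac k (biOp k i f) = biOp k i (dirac k f) :=
  LinearMap.congr_fun ((dunklData k).core i).1 f

/-- The space `ℂ² ⊗ ℝ[x₁, x₂, x₃]` with the action of the Bannai--Ito algebra for the
multiplicities `k`; the formulas satisfy its relations on the whole space. -/
def DunklSpace (_k : Fin 3 → ℝ) : Type := SpinorPoly

noncomputable instance (k : Fin 3 → ℝ) : AddCommGroup (DunklSpace k) :=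
  inferInstanceAs (AddCommGroup SpinorPoly)

noncomputable instance (k : Fin 3 → ℝ) : Module BI (DunklSpace k) :=
  Module.compHom SpinorPoly (BI.lift _ (isBITriple_biOp k) : BI →+* Module.End ℂ SpinorPoly)

/-- A complex subspace that is stable under `X, Y, Z` is a submodule for the algebra. -/
def toBISubmodule (k : Fin 3 → ℝ) (N : Submodule ℂ SpinorPoly)
    (hN : ∀ i, ∀ f ∈ N, biOp k i f ∈ N) : Submodule BI (DunklSpace k) where
  carrier := {f : SpinorPoly | f ∈ N}
  add_mem' hf hg := N.add_mem hf hg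
  zero_mem' := N.zero_mem
  smul_mem' b := by
    have h : ∀ f ∈ N, (BI.lift _ (isBITriple_biOp k) b : Module.End ℂ SpinorPoly) f ∈ N := by
      induction b using BI.induction with
      | h1 c =>
        intro f hf
        rw [AlgHom.commutes, Module.algebraMap_end_apply]
        exact N.smul_mem c hf
      | h2 i => intro f hf; rw [BI.lift_gen]; exact hN i f hf
      | h3 a b ha hb =>
        intro f hf; rw [map_add]; exact N.add_mem (ha f hf) (hb f hf)
      | h4 a b ha hb => intro f hf; rw [map_mul]; exact ha _ (hb f hf)
    exact fun {f} hf => h f hf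

/-- The complex subspace `ℂ² ⊗ P` for a real subspace `P` of the polynomial ring. -/
noncomputable def tensorSub (P : Submodule ℝ Poly3) : Submodule ℂ SpinorPoly :=
  Submodule.span ℂ {w | ∃ v : Fin 2 → ℂ, ∃ p ∈ P, w = v ⊗ₜ[ℝ] p}

/-- The number `t` attached to a multiplicity `κ`: it is `-2κ` if `2κ` is an odd negative integer,
and `∞` otherwise. -/
noncomputable def tIndex (κ : ℝ) : ℕ∞ :=
  open Classical in
  if ∃ m : ℕ, Odd m ∧ 2 * κ = -(m : ℝ) then ((⌊-(2 * κ)⌋₊ : ℕ) : ℕ∞) else ⊤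

theorem tIndex_eq_of_odd {κ : ℝ} {m : ℕ} (hm : Odd m) (h : 2 * κ = -(m : ℝ)) :
    tIndex κ = m := by
  rw [tIndex, if_pos ⟨m, hm, h⟩, h, neg_neg, Nat.floor_natCast]

theorem tIndex_cases (κ : ℝ) :
    (∃ m : ℕ, Odd m ∧ 2 * κ = -(m : ℝ) ∧ tIndex κ = m) ∨
      ((¬ ∃ m : ℕ, Odd m ∧ 2 * κ = -(m : ℝ)) ∧ tIndex κ = ⊤) := by
  by_cases h : ∃ m : ℕ, Odd m ∧ 2 * κ = -(m : ℝ)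
  · obtain ⟨m, hm, h⟩ := h
    exact Or.inl ⟨m, hm, h, tIndex_eq_of_odd hm h⟩
  · exact Or.inr ⟨h, if_neg h⟩

theorem odd_toNat_tIndex {κ : ℝ} {n : ℕ} (h : tIndex κ ≤ n) : Odd (tIndex κ).toNat := by
  rcases tIndex_cases κ with ⟨m, hm, -, h'⟩ | ⟨-, h'⟩
  · rw [h']; exact hm
  · rw [h'] at h; simp at h

theorem odd_sub_tIndex {κ : ℝ} {n : ℕ} (hn : Even n) (h : tIndex κ ≤ n) :
    Odd (n - (tIndex κ).toNat) := by
  refine Nat.Even.sub_odd ?_ hn (odd_toNat_tIndex h)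
  exact ENat.toNat_le_of_le_coe h

theorem even_tIndex_sub_one {κ : ℝ} {n : ℕ} (h : tIndex κ ≤ n) :
    Even ((tIndex κ).toNat - 1) :=
  Nat.Odd.sub_odd (odd_toNat_tIndex h) odd_one

/-- The space `ℂ² ⊗ ℝ[x₁, x₂, x₃]ₙ`. -/
noncomputable def degreePart (n : ℕ) : Submodule ℂ SpinorPoly :=
  tensorSub (homogeneousSubmodule (Fin 3) ℝ n)

/-- The space `xᵢ^m · R_d`, with `R` the ring of polynomials in the two other coordinates. -/
noncomputable def powerPart (i : Fin 3) (m d : ℕ) : Submodule ℝ Poly3 :=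
  ((homogeneousSubmodule (Fin 3) ℝ d) ⊓
    Subalgebra.toSubmodule (MvPolynomial.supported ℝ {j : Fin 3 | j ≠ i})).map
      (LinearMap.mulLeft ℝ (X i ^ m))

/-- The sum over `tᵢ ≤ m ≤ n` of `ℂ² ⊗ (xᵢ^m · R_{n-m})`, with `R` the ring of polynomials in the
two other coordinates; it is zero if `n < tᵢ`. -/
noncomputable def divisiblePart (k : Fin 3 → ℝ) (n : ℕ) (i : Fin 3) : Submodule ℂ SpinorPoly :=
  ⨆ (m : ℕ) (_ : tIndex (k i) ≤ m) (_ : m ≤ n), tensorSub (powerPart i m (n - m))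

/-- Auxiliary: the span of the tensors `v ⊗ x^a` with `a ∈ S`. -/
noncomputable def monoSpan (S : Set (Fin 3 →₀ ℕ)) : Submodule ℂ SpinorPoly :=
  Submodule.span ℂ {w | ∃ v : Fin 2 → ℂ, ∃ a ∈ S, w = v ⊗ₜ[ℝ] (monomial a 1 : Poly3)}

theorem tmul_monomial_mem {S : Set (Fin 3 →₀ ℕ)} {a : Fin 3 →₀ ℕ} {c : ℝ} (h : c = 0 ∨ a ∈ S)
    (v : Fin 2 → ℂ) : v ⊗ₜ[ℝ] (monomial a c : Poly3) ∈ monoSpan S := by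
  rcases h with rfl | h
  · simp
  · have : (monomial a c : Poly3) = c • monomial a 1 := by simp [smul_monomial]
    rw [this, ← TensorProduct.smul_tmul]
    exact Submodule.subset_span ⟨_, a, h, rfl⟩

theorem tensorSub_le_monoSpan {P : Submodule ℝ Poly3} {S : Set (Fin 3 →₀ ℕ)}
    (h : ∀ p ∈ P, ∀ a ∈ p.support, a ∈ S) : tensorSub P ≤ monoSpan S := by
  refine Submodule.span_le.2 ?_
  rintro _ ⟨v, p, hp, rfl⟩
  rw [p.as_sum, TensorProduct.tmul_sum]
  exact Submodule.sum_mem _ fun a ha => tmul_monomial_mem (Or.inr (h p hp a ha)) v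

theorem degreePart_eq (n : ℕ) : degreePart n = monoSpan {a | a.degree = n} := by
  refine le_antisymm (tensorSub_le_monoSpan fun p hp a ha => ?_) (Submodule.span_le.2 ?_)
  · rw [mem_homogeneousSubmodule] at hp
    by_contra hne
    exact (mem_support_iff.1 ha) (hp.coeff_eq_zero hne)
  · rintro _ ⟨v, a, ha, rfl⟩
    exact Submodule.subset_span ⟨v, _, isHomogeneous_monomial 1 ha, rfl⟩

theorem divisiblePart_eq (k : Fin 3 → ℝ) (n : ℕ) (i : Fin 3) :
    divisiblePart k n i = monoSpan {a | a.degree = n ∧ tIndex (k i) ≤ (a i : ℕ)} := by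
  apply le_antisymm
  · refine iSup_le fun m => iSup_le fun hm => iSup_le fun hmn => tensorSub_le_monoSpan ?_
    rintro _ ⟨p, ⟨hp, -⟩, rfl⟩ a ha
    have hp : p.IsHomogeneous (n - m) := hp
    rw [LinearMap.mulLeft_apply] at ha
    have hh : (X i ^ m * p : Poly3).IsHomogeneous (m + (n - m)) :=
      (isHomogeneous_X_pow i m).mul hp
    rw [Nat.add_sub_cancel' hmn] at hh
    refine ⟨?_, ?_⟩
    · by_contra hne
      exact (mem_support_iff.1 ha) (hh.coeff_eq_zero hne)
    · rw [mem_support_iff, X_pow_eq_monomial, coeff_monomial_mul'] at ha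
      have : Finsupp.single i m ≤ a := by
        by_contra hne
        rw [if_neg hne] at ha
        exact ha rfl
      rw [Finsupp.single_le_iff] at this
      exact hm.trans (by exact_mod_cast this)
  · refine Submodule.span_le.2 ?_
    rintro _ ⟨v, a, ⟨ha, hai⟩, rfl⟩
    have hle : Finsupp.single i (a i) ≤ a := by simp
    have hdeg : a.degree = a i + (a - Finsupp.single i (a i)).degree := by
      conv_lhs => rw [← add_tsub_cancel_of_le hle, map_add, Finsupp.degree_single]
    have hn : a i ≤ n := by omega
    refine Submodule.mem_iSup_of_mem (a i) (Submodule.mem_iSup_of_mem hai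
      (Submodule.mem_iSup_of_mem hn (Submodule.subset_span ⟨v, _, ⟨monomial (a - Finsupp.single i (a i)) 1, ⟨?_, ?_⟩, rfl⟩, ?_⟩)))
    · exact isHomogeneous_monomial 1 (by omega)
    · show _ ∈ supported ℝ _
      rw [mem_supported, vars_monomial one_ne_zero]
      intro j hj
      rintro rfl
      simp at hj
    · rw [LinearMap.mulLeft_apply, X_pow_eq_monomial, monomial_mul, one_mul,
        add_tsub_cancel_of_le hle]

theorem biOp_mem_monoSpan (k : Fin 3 → ℝ) {S : Set (Fin 3 →₀ ℕ)}
    (hS : ∀ a ∈ S, ∀ m n : Fin 3, m ≠ n → ((a n : ℝ) + (1 - (-1) ^ a n) * k n = 0 ∨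
      a - Finsupp.single n 1 + Finsupp.single m 1 ∈ S))
    (i : Fin 3) (f : SpinorPoly) (hf : f ∈ monoSpan S) : biOp k i f ∈ monoSpan S := by
  have hle : monoSpan S ≤ (monoSpan S).comap (biOp k i) := by
    refine Submodule.span_le.2 ?_
    rintro _ ⟨v, a, ha, rfl⟩
    have hne : i + 1 ≠ i + 2 := by fin_cases i <;> decide
    show biOp k i (v ⊗ₜ[ℝ] monomial a 1) ∈ monoSpan S
    have key : ∀ (m n : Fin 3) (c : ℝ), m ≠ n →
        opE i (opX m (opT k n (v ⊗ₜ[ℝ] monomial a c))) ∈ monoSpan S := by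
      intro m n c h
      rw [opT_mono, opX_mono, opE_tmul]
      refine tmul_monomial_mem ?_ _
      rcases hS a ha m n h with h0 | h0
      · left; rw [h0, zero_mul]
      · exact Or.inr h0
    simp only [biOp, LinearMap.add_apply, LinearMap.smul_apply, mul_sub, sub_mul,
      LinearMap.sub_apply, Module.End.mul_apply, opR_mono, map_sub]
    refine add_mem (add_mem (add_mem (Submodule.smul_mem _ _ (sub_mem ?_ ?_))
      (Submodule.smul_mem _ _ ?_)) (Submodule.smul_mem _ _ ?_)) (Submodule.smul_mem _ _ ?_)
    · exact key _ _ _ hne.symm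
    · exact key _ _ _ hne
    all_goals exact tmul_monomial_mem (Or.inr ha) v
  exact hle hf

theorem degree_step {a : Fin 3 →₀ ℕ} {n m : Fin 3} (h : a n ≠ 0) :
    (a - Finsupp.single n 1 + Finsupp.single m 1).degree = a.degree := by
  have hle : Finsupp.single n 1 ≤ a := by rw [Finsupp.single_le_iff]; omega
  conv_rhs => rw [← tsub_add_cancel_of_le hle]
  simp

theorem biOp_mem_degreePart (k : Fin 3 → ℝ) (n : ℕ) (i : Fin 3) (f : SpinorPoly)
    (hf : f ∈ degreePart n) : biOp k i f ∈ degreePart n := by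
  rw [degreePart_eq] at hf ⊢
  refine biOp_mem_monoSpan k (fun a ha m l _ => ?_) i f hf
  by_cases h : a l = 0
  · left; simp [h]
  · right; exact (degree_step h).trans ha

theorem biOp_mem_divisiblePart (k : Fin 3 → ℝ) (n : ℕ) (j : Fin 3) (i : Fin 3) (f : SpinorPoly)
    (hf : f ∈ divisiblePart k n j) : biOp k i f ∈ divisiblePart k n j := by
  rw [divisiblePart_eq] at hf ⊢
  refine biOp_mem_monoSpan k (fun a ha m l hml => ?_) i f hf
  by_cases h : a l = 0
  · left; simp [h]
  by_cases hlj : l = j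
  · subst hlj
    rcases tIndex_cases (k l) with ⟨t, ht, hk, htI⟩ | ⟨-, htI⟩
    · have hat : t ≤ a l := by have := ha.2; rw [htI] at this; exact_mod_cast this
      by_cases he : a l = t
      · left
        rw [he, ht.neg_one_pow]; linarith
      · right
        refine ⟨(degree_step h).trans ha.1, ?_⟩
        rw [htI]
        have : (a - Finsupp.single l 1 + Finsupp.single m 1 : Fin 3 →₀ ℕ) l = a l - 1 := by
          rw [aux_add hml]; simp
        rw [this]
        exact_mod_cast (by omega : t ≤ a l - 1)
    · have := ha.2; rw [htI] at this; simp at this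
  · right
    refine ⟨(degree_step h).trans ha.1, ha.2.trans ?_⟩
    have : a j ≤ (a - Finsupp.single l 1 + Finsupp.single m 1 : Fin 3 →₀ ℕ) j := by
      rw [Finsupp.add_apply, aux_sub hlj]; omega
    exact_mod_cast this

/-- The space `ℳₙ` of Dunkl monogenics of degree `n`, the kernel of the Dirac--Dunkl operator on
`ℂ² ⊗ ℝ[x₁, x₂, x₃]ₙ`, as a module over the Bannai--Ito algebra. -/
noncomputable def monogenics (k : Fin 3 → ℝ) (n : ℕ) : Submodule BI (DunklSpace k) :=
  toBISubmodule k (degreePart n ⊓ LinearMap.ker (dirac k)) fun i f hf =>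
    ⟨biOp_mem_degreePart k n i f hf.1, LinearMap.mem_ker.2 (by
      rw [dirac_biOp, LinearMap.mem_ker.1 hf.2, map_zero])⟩

/-- The submodule `ℳₙ(xⱼ)` of `ℳₙ`. -/
noncomputable def monogenicsDiv (k : Fin 3 → ℝ) (n : ℕ) (j : Fin 3) : Submodule BI (DunklSpace k) :=
  monogenics k n ⊓ toBISubmodule k (divisiblePart k n j) (biOp_mem_divisiblePart k n j)

/-- The quotient module `ℳₙ / ℳₙ(xⱼ)`. -/
abbrev MonogenicsQuot (k : Fin 3 → ℝ) (n : ℕ) (j : Fin 3) : Type :=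
  monogenics k n ⧸ (monogenicsDiv k n j).submoduleOf (monogenics k n)

theorem gen_smul_dunklSpace (k : Fin 3 → ℝ) (i : Fin 3) (f : DunklSpace k) :
    BI.gen i • f = (biOp k i (f : SpinorPoly) : SpinorPoly) :=
  congrArg (fun g : Module.End ℂ SpinorPoly => g f) (BI.lift_gen _ (isBITriple_biOp k) i)

theorem smul_twist (φ : BI ≃ₐ[ℂ] BI) (V : Type*) [AddCommGroup V] [Module BI V] (b : BI)
    (v : Twist φ V) : b • v = @HSMul.hSMul BI V V _ (φ b) v := rfl

theorem gen_smul_modE (d : ℕ) (hd : Odd d) (a b c : ℂ) (i : Fin 3) (v : ModE d hd a b c) :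
    BI.gen i • v = (biTriple (endX d a) (endY d b (phiE d a b c))
      (c ^ 2 - a ^ 2 - b ^ 2 + ((d : ℂ) + 1) ^ 2 / 4) i (v : Fin (d + 1) → ℂ) :
        Fin (d + 1) → ℂ) :=
  congrArg (fun g : Module.End ℂ (Fin (d + 1) → ℂ) => g v)
    (BI.lift_gen _ (isBITriple_E hd a b c) i)

theorem gen_smul_modO (d : ℕ) (hd : Even d) (a b c : ℂ) (i : Fin 3) (v : ModO d hd a b c) :
    BI.gen i • v = (biTriple (endX d a) (endY d b (phiO d a b c))
      (2 * a * b - c * ((d : ℂ) + 1)) i (v : Fin (d + 1) → ℂ) : Fin (d + 1) → ℂ) :=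
  congrArg (fun g : Module.End ℂ (Fin (d + 1) → ℂ) => g v)
    (BI.lift_gen _ (isBITriple_O hd a b c) i)

/-- The module `M` is isomorphic to `V`. -/
def IsIsomorphic (M V : Type*) [AddCommGroup M] [Module BI M] [AddCommGroup V] [Module BI V] :
    Prop :=
  Nonempty (M ≃ₗ[BI] V)

/-- The module `M` is isomorphic to a direct sum of two copies of `V`. -/
def IsTwoCopies (M V : Type*) [AddCommGroup M] [Module BI M] [AddCommGroup V] [Module BI V] :
    Prop :=
  Nonempty (M ≃ₗ[BI] V × V)

/-- The conclusion about `ℳₙ(xⱼ)` and `ℳₙ / ℳₙ(xⱼ)`: they are direct sums of two copies of `E` and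
of two copies of `O`, respectively; moreover, under the hypothesis `p`, the modules `E` and `O` are
irreducible and isomorphic to `E'` and `O'`, respectively. -/
def HasStructure (k : Fin 3 → ℝ) (n : ℕ) (j : Fin 3) (p : Prop) (E O E' O' : Type)
    [AddCommGroup E] [Module BI E] [AddCommGroup O] [Module BI O]
    [AddCommGroup E'] [Module BI E'] [AddCommGroup O'] [Module BI O'] : Prop :=
  IsTwoCopies (monogenicsDiv k n j) E ∧
  IsTwoCopies (MonogenicsQuot k n j) O ∧
  (p → IsSimpleModule BI E ∧ IsSimpleModule BI O ∧ IsIsomorphic E E' ∧ IsIsomorphic O O')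

end DunklBI

open DunklBI

namespace DunklBI

open Complex MvPolynomial
open scoped TensorProduct

/-! ### Complex scalars compatible with the action of the algebra -/

section ScalarStructure

/-! Choose a coordinate x_l with n < t_l. The Dunkl operator T_l sends x_l^m to [m] x_l^(m-1), where
[m] (`bracket`) is nonzero for 1 ≤ m ≤ n. So the equation D f = 0 can be solved for one power of x_l
after another, and restriction to the plane x_l = 0 identifies ℳₙ with the ℂ²-valued homogeneous
polynomials of degree n in the two other variables (`monogenics_coeff_eq_zero`, `exists_monogenic`).

In the monomials x_{l+1}^(n-b) x_{l+2}^b the generator of index l+1 becomes lower bidiagonal and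
that of index l+2 upper bidiagonal, with off-diagonal entries that are scalars times σ_l
(`restr_biOp_one_succ`, `restr_biOp_two_succ`). The two eigenlines of σ_l give the two copies, and
normalizing the subdiagonal to 1 produces the matrices of E_d or O_d. The third generator needs no
computation of its own: for even n the anticommutator relation takes a scalar value on ℳₙ
(`anticomm_monogenics`), so two generators determine the third.

If t = t_{l+2} ≤ n, then [t] = 0 for the multiplicity k_{l+2}, and this cuts the bidiagonal pattern
between b = t-1 and b = t. The strip b ≥ t carries ℳₙ(x_{l+2}), the strip b < t the quotient
(`div_isTwoCopies_one`, `quot_isTwoCopies_one`).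

Irreducibility follows from a criterion in the style of Leonard pairs: neither the sequence φ_i nor
a second split sequence, attached to the reversed order of the θ_i, may vanish
(`eq_bot_or_top_of_split`). For nonnegative multiplicities all factors of both sequences have a
strict sign.

The second form of the summands has positive parameters. The module E_d(a,-β,c) maps to every module
with the same central values in which ∏(X - θ_i) = 0 and Y has an eigenvector for θ*_d(β) =
θ*_0(-β), under a nondegeneracy condition that holds for β ≥ 0 and the right spectrum of Y
(`exists_linearMap_of_eigenvector`). Both the given irreducible module and E_d(a,β,c) thus receive a
nonzero map from E_d(a,-β,c), and equality of dimensions makes both maps bijective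
(`isIsomorphic_modE`; `isIsomorphic_modO` is the analogue with a sign twist). Two of the spectra are
visible in the bidiagonal matrices. For the third generator ℳₙ is restricted to the plane x_{l+1} =
0 instead (`div_isTwoCopies_two`, `quot_isTwoCopies_two`), and the spectrum is carried over between
the two decompositions (`HasSpec.of_twoCopies`).

The three assertions are the cases l = 2, 0, 1 of the cyclically symmetric `hasStructure_of_tIndex`.
-/

theorem BI.algebraMap_smul_eq {V : Type*} [AddCommGroup V] [Module ℂ V]
    (f : BI →ₐ[ℂ] Module.End ℂ V) (c : ℂ) (b : BI) (v : V) : f (c • b) v = c • f b v := by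
  rw [map_smul, LinearMap.smul_apply]

noncomputable instance (k : Fin 3 → ℝ) : Module ℂ (DunklSpace k) :=
  inferInstanceAs (Module ℂ SpinorPoly)

instance (k : Fin 3 → ℝ) : IsScalarTower ℂ BI (DunklSpace k) :=
  ⟨fun c b v => BI.algebraMap_smul_eq (BI.lift _ (isBITriple_biOp k)) c b v⟩

noncomputable instance (d : ℕ) (hd : Odd d) (a b c : ℂ) : Module ℂ (ModE d hd a b c) :=
  inferInstanceAs (Module ℂ (Fin (d + 1) → ℂ))

instance (d : ℕ) (hd : Odd d) (a b c : ℂ) : IsScalarTower ℂ BI (ModE d hd a b c) :=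
  ⟨fun s t v => BI.algebraMap_smul_eq (BI.lift _ (isBITriple_E hd a b c)) s t v⟩

noncomputable instance (d : ℕ) (hd : Even d) (a b c : ℂ) : Module ℂ (ModO d hd a b c) :=
  inferInstanceAs (Module ℂ (Fin (d + 1) → ℂ))

instance (d : ℕ) (hd : Even d) (a b c : ℂ) : IsScalarTower ℂ BI (ModO d hd a b c) :=
  ⟨fun s t v => BI.algebraMap_smul_eq (BI.lift _ (isBITriple_O hd a b c)) s t v⟩

noncomputable instance (φ : BI ≃ₐ[ℂ] BI) (V : Type*) [AddCommGroup V] [Module ℂ V] :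
    Module ℂ (Twist φ V) :=
  inferInstanceAs (Module ℂ V)

instance (φ : BI ≃ₐ[ℂ] BI) (V : Type*) [AddCommGroup V] [Module BI V] [Module ℂ V]
    [IsScalarTower ℂ BI V] : IsScalarTower ℂ BI (Twist φ V) :=
  ⟨fun c b v => by
    have h : (φ (c • b)) • (show V from v) = c • (φ b • (show V from v)) := by
      rw [map_smul, smul_assoc]
    exact h⟩

end ScalarStructure

/-! ### Homomorphisms, twists and coordinates of modules -/

section Modules

variable {M M' : Type*} [AddCommGroup M] [Module BI M] [Module ℂ M] [IsScalarTower ℂ BI M]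
  [AddCommGroup M'] [Module BI M'] [Module ℂ M'] [IsScalarTower ℂ BI M']

/-- The image of the Bannai--Ito algebra acting on a module. -/
noncomputable abbrev actEnd (M : Type*) [AddCommGroup M] [Module BI M] [Module ℂ M]
    [IsScalarTower ℂ BI M] : BI →ₐ[ℂ] Module.End ℂ M := Algebra.lsmul ℂ ℂ M

theorem linear_of_gen (σ : BI →ₐ[ℂ] BI) (f : M →ₗ[ℂ] M')
    (h : ∀ i m, f (BI.gen i • m) = σ (BI.gen i) • f m) (b : BI) : ∀ m, f (b • m) = σ b • f m := by
  induction b using BI.induction with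
  | h1 c => intro m; rw [AlgHom.commutes, algebraMap_smul, algebraMap_smul, map_smul]
  | h2 i => exact h i
  | h3 a b ha hb => intro m; rw [add_smul, map_add, map_add, add_smul, ha, hb]
  | h4 a b ha hb => intro m; rw [mul_smul, ha, hb, map_mul, mul_smul]

/-- A complex linear map that commutes with the generators is linear over the algebra. -/
def linearMapOfGen (f : M →ₗ[ℂ] M') (h : ∀ i m, f (BI.gen i • m) = BI.gen i • f m) :
    M →ₗ[BI] M' where
  toFun := f
  map_add' := f.map_add
  map_smul' := linear_of_gen (AlgHom.id ℂ BI) f h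

/-- The identity map is semilinear over the surjection φ, so both modules have the same submodules.
-/
theorem isSimpleModule_twist (φ : BI ≃ₐ[ℂ] BI) {V : Type*} [AddCommGroup V] [Module BI V]
    [IsSimpleModule BI V] : IsSimpleModule BI (Twist φ V) := by
  have : RingHomSurjective (φ : BI →+* BI) := ⟨φ.surjective⟩
  let l : Twist φ V →ₛₗ[(φ : BI →+* BI)] V :=
    { toFun := fun v => v
      map_add' := fun _ _ => rfl
      map_smul' := fun _ _ => rfl }
  exact (LinearMap.isSimpleModule_iff_of_bijective l Function.bijective_id).2 inferInstance

/-- A coordinate description of a module on which `X` and `Y` act by bidiagonal matrices and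
`{X, Y} - Z` acts as the scalar `κ`. -/
structure SplitModel (V : Type*) [AddCommGroup V] [Module BI V] [Module ℂ V]
    (d : ℕ) (a b : ℂ) (φ : ℕ → ℂ) (κ : ℂ) where
  equiv : V ≃ₗ[ℂ] (Fin (d + 1) → ℂ)
  gen_smul : ∀ i v, equiv (BI.gen i • v) = biTriple (endX d a) (endY d b φ) κ i (equiv v)

/-- The coordinates of `E_d(a, b, c)`. -/
noncomputable def splitModelE (d : ℕ) (hd : Odd d) (a b c : ℂ) :
    SplitModel (ModE d hd a b c) d a b (phiE d a b c)
      (c ^ 2 - a ^ 2 - b ^ 2 + ((d : ℂ) + 1) ^ 2 / 4) where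
  equiv := LinearEquiv.refl ℂ (Fin (d + 1) → ℂ)
  gen_smul := gen_smul_modE d hd a b c

/-- The coordinates of `O_d(a, b, c)`. -/
noncomputable def splitModelO (d : ℕ) (hd : Even d) (a b c : ℂ) :
    SplitModel (ModO d hd a b c) d a b (phiO d a b c) (2 * a * b - c * ((d : ℂ) + 1)) where
  equiv := LinearEquiv.refl ℂ (Fin (d + 1) → ℂ)
  gen_smul := gen_smul_modO d hd a b c

theorem SplitModel.finrank {d : ℕ} {a b κ : ℂ} {φ : ℕ → ℂ} (S : SplitModel M d a b φ κ) :
    Module.finrank ℂ M = d + 1 := by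
  rw [S.equiv.finrank_eq]; simp

theorem SplitModel.finite {d : ℕ} {a b κ : ℂ} {φ : ℕ → ℂ} (S : SplitModel M d a b φ κ) :
    Module.Finite ℂ M :=
  Module.Finite.equiv S.equiv.symm

end Modules

/-! ### Coefficients of spinor-valued polynomials -/

/-- The coefficient of `x^m`, a vector in `ℂ²`. -/
noncomputable def spinorCoeff (m : Fin 3 →₀ ℕ) : SpinorPoly →ₗ[ℂ] (Fin 2 → ℂ) :=
  (TensorProduct.AlgebraTensorModule.rid ℝ ℂ (Fin 2 → ℂ)).toLinearMap ∘ₗ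
    TensorProduct.AlgebraTensorModule.map LinearMap.id (lcoeff ℝ m)

theorem spinorCoeff_tmul (m : Fin 3 →₀ ℕ) (v : Fin 2 → ℂ) (p : Poly3) :
    spinorCoeff m (v ⊗ₜ[ℝ] p) = p.coeff m • v := by
  simp [spinorCoeff]

theorem spinorCoeff_monomial (m a : Fin 3 →₀ ℕ) (v : Fin 2 → ℂ) (c : ℝ) :
    spinorCoeff m (v ⊗ₜ[ℝ] monomial a c) = if a = m then c • v else 0 := by
  rw [spinorCoeff_tmul, coeff_monomial]; split_ifs <;> simp

theorem exists_eq_sum_spinorCoeff (f : SpinorPoly) :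
    ∃ S : Finset (Fin 3 →₀ ℕ), f = ∑ m ∈ S, spinorCoeff m f ⊗ₜ[ℝ] (monomial m 1 : Poly3) := by
  classical
  -- Allowing every larger finite set lets sums be treated by the union of two sets.
  suffices h : ∃ S : Finset (Fin 3 →₀ ℕ), ∀ S', S ⊆ S' →
      f = ∑ m ∈ S', spinorCoeff m f ⊗ₜ[ℝ] (monomial m 1 : Poly3) by
    obtain ⟨S, hS⟩ := h
    exact ⟨S, hS S subset_rfl⟩
  induction f using TensorProduct.induction_on with
  | zero => exact ⟨∅, fun S' _ => by simp⟩
  | tmul v p =>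
    refine ⟨p.support, fun S' hS => ?_⟩
    conv_lhs => rw [p.as_sum, TensorProduct.tmul_sum]
    rw [Finset.sum_subset hS (fun m _ hm => by rw [notMem_support_iff.1 hm]; simp)]
    refine Finset.sum_congr rfl fun m _ => ?_
    rw [spinorCoeff_tmul, TensorProduct.smul_tmul, smul_monomial, smul_eq_mul, mul_one]
  | add f g hf hg =>
    obtain ⟨S, hS⟩ := hf
    obtain ⟨T, hT⟩ := hg
    refine ⟨S ∪ T, fun S' h => ?_⟩
    simp only [map_add, TensorProduct.add_tmul, Finset.sum_add_distrib]
    rw [← hS S' (Finset.union_subset_left h), ← hT S' (Finset.union_subset_right h)]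

theorem spinor_eq_zero {f : SpinorPoly} (h : ∀ m, spinorCoeff m f = 0) : f = 0 := by
  obtain ⟨S, hS⟩ := exists_eq_sum_spinorCoeff f
  rw [hS]
  simp [h]

theorem mem_monoSpan_iff {S : Set (Fin 3 →₀ ℕ)} {f : SpinorPoly} :
    f ∈ monoSpan S ↔ ∀ m, m ∉ S → spinorCoeff m f = 0 := by
  constructor
  · intro hf m hm
    have : monoSpan S ≤ LinearMap.ker (spinorCoeff m) := by
      refine Submodule.span_le.2 ?_
      rintro _ ⟨v, a, ha, rfl⟩
      show spinorCoeff m _ = 0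
      rw [spinorCoeff_monomial, if_neg (fun h : a = m => hm (h ▸ ha))]
    exact this hf
  · intro h
    obtain ⟨T, hT⟩ := exists_eq_sum_spinorCoeff f
    rw [hT]
    refine Submodule.sum_mem _ fun m _ => ?_
    by_cases hm : m ∈ S
    · exact tmul_monomial_mem (Or.inr hm) _
    · rw [h m hm]; simp

/-- The number `[m]_κ` with `T x^m = [m]_κ x^(m-1)`. -/
def bracket (κ : ℝ) (m : ℕ) : ℝ := m + (1 - (-1) ^ m) * κ

theorem bracket_zero (κ : ℝ) : bracket κ 0 = 0 := by simp [bracket]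

/-- For even m the bracket is m; for odd m it is m + 2κ, whose only possible zero m = -2κ is the
number t. -/
theorem bracket_ne_zero {κ : ℝ} {m : ℕ} (hm : m ≠ 0) (h : tIndex κ ≠ m) : bracket κ m ≠ 0 := by
  rcases Nat.even_or_odd m with he | ho
  · simp [bracket, he.neg_one_pow, hm]
  · intro h0
    rw [bracket, ho.neg_one_pow] at h0
    exact h (tIndex_eq_of_odd ho (by linarith))

theorem bracket_eq_zero {κ : ℝ} {m : ℕ} (hm : Odd m) (h : 2 * κ = -(m : ℝ)) :
    bracket κ m = 0 := by
  rw [bracket, hm.neg_one_pow]; linarith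

theorem spinor_ext_left {W : Type*} [AddCommGroup W] [Module ℂ W] {f g : SpinorPoly →ₗ[ℂ] W}
    (h : ∀ (v : Fin 2 → ℂ) (a : Fin 3 →₀ ℕ),
      f (v ⊗ₜ[ℝ] monomial a 1) = g (v ⊗ₜ[ℝ] monomial a 1)) : f = g := by
  refine LinearMap.ext fun x => ?_
  obtain ⟨S, hS⟩ := exists_eq_sum_spinorCoeff x
  rw [hS, map_sum, map_sum]
  exact Finset.sum_congr rfl fun m _ => h _ _

theorem spinorCoeff_opE (i : Fin 3) (m : Fin 3 →₀ ℕ) (f : SpinorPoly) :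
    spinorCoeff m (opE i f) = (pauli i).mulVec (spinorCoeff m f) := by
  have : spinorCoeff m ∘ₗ opE i = Matrix.toLin' (pauli i) ∘ₗ spinorCoeff m :=
    spinor_ext_left fun v a => by
      simp only [LinearMap.comp_apply, opE_tmul, spinorCoeff_monomial, Matrix.toLin'_apply]
      split_ifs <;> simp
  exact LinearMap.congr_fun this f

theorem spinorCoeff_opR (i : Fin 3) (m : Fin 3 →₀ ℕ) (f : SpinorPoly) :
    spinorCoeff m (opR i f) = ((-1) ^ m i : ℂ) • spinorCoeff m f := by
  have : spinorCoeff m ∘ₗ opR i = ((-1) ^ m i : ℂ) • spinorCoeff m :=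
    spinor_ext_left fun v a => by
      simp only [LinearMap.comp_apply, opR_mono, spinorCoeff_monomial, LinearMap.smul_apply]
      split_ifs with h
      · subst h; rcases neg_one_pow_eq_or ℝ (a i) with h | h <;>
        rcases Nat.even_or_odd (a i) with h' | h' <;> simp [h'.neg_one_pow]
      · simp
  exact LinearMap.congr_fun this f

theorem spinorCoeff_opT (k : Fin 3 → ℝ) (i : Fin 3) (m : Fin 3 →₀ ℕ) (f : SpinorPoly) :
    spinorCoeff m (opT k i f)
      = (bracket (k i) (m i + 1) : ℂ) • spinorCoeff (m + Finsupp.single i 1) f := by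
  have : spinorCoeff m ∘ₗ opT k i
      = (bracket (k i) (m i + 1) : ℂ) • spinorCoeff (m + Finsupp.single i 1) :=
    spinor_ext_left fun v a => by
      simp only [LinearMap.comp_apply, opT_mono, spinorCoeff_monomial, LinearMap.smul_apply]
      by_cases ha : a i = 0
      · have h : a ≠ m + Finsupp.single i 1 := by
          rintro rfl; simp at ha
        rw [if_neg h]; simp [ha]
      · have hiff : a - Finsupp.single i 1 = m ↔ a = m + Finsupp.single i 1 := by
          have hle : Finsupp.single i 1 ≤ a := by rw [Finsupp.single_le_iff]; omega
          constructor
          · rintro rfl; rw [tsub_add_cancel_of_le hle]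
          · rintro rfl; rw [add_tsub_cancel_right]
        by_cases h : a = m + Finsupp.single i 1
        · rw [if_pos h, if_pos (hiff.2 h)]
          subst h
          ext t
          simp [bracket]
        · rw [if_neg h, if_neg (fun h' => h (hiff.1 h'))]; simp
  exact LinearMap.congr_fun this f

theorem spinorCoeff_opX_add (i : Fin 3) (m : Fin 3 →₀ ℕ) (f : SpinorPoly) :
    spinorCoeff (m + Finsupp.single i 1) (opX i f) = spinorCoeff m f := by
  have : spinorCoeff (m + Finsupp.single i 1) ∘ₗ opX i = spinorCoeff m :=
    spinor_ext_left fun v a => by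
      simp only [LinearMap.comp_apply, opX_mono, spinorCoeff_monomial, add_left_inj]
  exact LinearMap.congr_fun this f

theorem spinorCoeff_opX_zero (i : Fin 3) (m : Fin 3 →₀ ℕ) (hm : m i = 0) (f : SpinorPoly) :
    spinorCoeff m (opX i f) = 0 := by
  have : spinorCoeff m ∘ₗ opX i = 0 :=
    spinor_ext_left fun v a => by
      simp only [LinearMap.comp_apply, opX_mono, spinorCoeff_monomial]
      rw [if_neg]; · rfl
      rintro rfl; simp at hm
  exact LinearMap.congr_fun this f

theorem spinorCoeff_dirac (k : Fin 3 → ℝ) (m : Fin 3 →₀ ℕ) (f : SpinorPoly) :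
    spinorCoeff m (dirac k f) = ∑ i, (bracket (k i) (m i + 1) : ℂ) •
      (pauli i).mulVec (spinorCoeff (m + Finsupp.single i 1) f) := by
  simp only [dirac, LinearMap.sum_apply, map_sum, Module.End.mul_apply, spinorCoeff_opE,
    spinorCoeff_opT, Matrix.mulVec_smul]

theorem mem_monogenics_iff {k : Fin 3 → ℝ} {n : ℕ} {f : SpinorPoly} :
    (show DunklSpace k from f) ∈ monogenics k n ↔
      (∀ m : Fin 3 →₀ ℕ, m.degree ≠ n → spinorCoeff m f = 0) ∧
      ∀ m : Fin 3 →₀ ℕ, ∑ i, (bracket (k i) (m i + 1) : ℂ) •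
        (pauli i).mulVec (spinorCoeff (m + Finsupp.single i 1) f) = 0 := by
  have h1 : (show DunklSpace k from f) ∈ monogenics k n ↔
      f ∈ degreePart n ∧ dirac k f = 0 := Iff.rfl
  rw [h1, degreePart_eq, mem_monoSpan_iff]
  refine and_congr Iff.rfl ⟨fun h m => ?_, fun h => spinor_eq_zero fun m => ?_⟩
  · rw [← spinorCoeff_dirac, h, map_zero]
  · rw [spinorCoeff_dirac, h]

theorem mem_monogenicsDiv_iff {k : Fin 3 → ℝ} {n : ℕ} {j : Fin 3} {f : SpinorPoly} :
    (show DunklSpace k from f) ∈ monogenicsDiv k n j ↔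
      (show DunklSpace k from f) ∈ monogenics k n ∧
      ∀ m : Fin 3 →₀ ℕ, (m j : ℕ∞) < tIndex (k j) → spinorCoeff m f = 0 := by
  have h1 : (show DunklSpace k from f) ∈ monogenicsDiv k n j ↔
      (show DunklSpace k from f) ∈ monogenics k n ∧ f ∈ divisiblePart k n j := Iff.rfl
  rw [h1, divisiblePart_eq, mem_monoSpan_iff]
  refine and_congr_right fun hf => ⟨fun h m hm => h m fun hm' => not_le.2 hm hm'.2,
    fun h m hm => ?_⟩
  by_cases hd : m.degree = n
  · exact h m (not_le.1 fun hm' => hm ⟨hd, hm'⟩)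
  · exact (mem_monogenics_iff.1 hf).1 m hd

/-! ### Restriction of monogenic polynomials to the plane x_l = 0 -/

section

theorem fin3_add (l : Fin 3) :
    l + 1 + 1 = l + 2 ∧ l + 1 + 2 = l ∧ l + 2 + 1 = l ∧ l + 2 + 2 = l + 1 := by
  fin_cases l <;> refine ⟨?_, ?_, ?_, ?_⟩ <;> rfl

theorem fin3_ne (l : Fin 3) : l + 1 ≠ l ∧ l + 2 ≠ l ∧ l + 2 ≠ l + 1 := by
  fin_cases l <;> decide

theorem fin3_sum {α : Type*} [AddCommMonoid α] (l : Fin 3) (f : Fin 3 → α) :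
    ∑ i, f i = f l + f (l + 1) + f (l + 2) := by
  rw [Fin.sum_univ_three]
  fin_cases l
  · rfl
  · show _ = f 1 + f 2 + f 0
    rw [add_comm, ← add_assoc, add_right_comm, add_comm (f 2)] <;> abel
  · show _ = f 2 + f 0 + f 1
    abel

/-- The action of a Pauli matrix on `ℂ²`. -/
noncomputable def sigma (i : Fin 3) : Module.End ℂ (Fin 2 → ℂ) := Matrix.toLin' (pauli i)

theorem sigma_apply (i : Fin 3) (v : Fin 2 → ℂ) : sigma i v = (pauli i).mulVec v := rfl

theorem sigma_sigma (i : Fin 3) (v : Fin 2 → ℂ) :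
    sigma i (sigma i v) = v ∧ sigma i (sigma (i + 1) v) = I • sigma (i + 2) v ∧
      sigma (i + 1) (sigma i v) = (-I) • sigma (i + 2) v := by
  obtain ⟨h1, h2, h3⟩ := pauli_mul i
  simp only [sigma_apply, Matrix.mulVec_mulVec, h1, h2, h3, Matrix.one_mulVec, Matrix.smul_mulVec,
    and_self]

/-- The exponent with entries `s, a, b` in the positions `l, l + 1, l + 2`. -/
noncomputable def expo (l : Fin 3) (s a b : ℕ) : Fin 3 →₀ ℕ :=
  Finsupp.single l s + Finsupp.single (l + 1) a + Finsupp.single (l + 2) b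

theorem expo_apply (l : Fin 3) (s a b : ℕ) :
    expo l s a b l = s ∧ expo l s a b (l + 1) = a ∧ expo l s a b (l + 2) = b := by
  obtain ⟨h1, h2, h3⟩ := fin3_ne l
  simp [expo, Finsupp.single_apply, h1, h2, h3, h1.symm, h2.symm, h3.symm]

theorem expo_add (l : Fin 3) (s a b : ℕ) :
    expo l s a b + Finsupp.single l 1 = expo l (s + 1) a b ∧
    expo l s a b + Finsupp.single (l + 1) 1 = expo l s (a + 1) b ∧
    expo l s a b + Finsupp.single (l + 2) 1 = expo l s a (b + 1) := by
  simp only [expo, Finsupp.single_add]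
  refine ⟨?_, ?_, ?_⟩ <;> abel

theorem expo_degree (l : Fin 3) (s a b : ℕ) : (expo l s a b).degree = s + a + b := by
  simp [expo]

theorem eq_expo (l : Fin 3) (m : Fin 3 →₀ ℕ) : m = expo l (m l) (m (l + 1)) (m (l + 2)) := by
  obtain ⟨h1, h2, h3⟩ := expo_apply l (m l) (m (l + 1)) (m (l + 2))
  have h : ∀ i, i = l ∨ i = l + 1 ∨ i = l + 2 := by fin_cases l <;> decide
  ext i
  rcases h i with rfl | rfl | rfl
  · exact h1.symm
  · exact h2.symm
  · exact h3.symm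

variable {k : Fin 3 → ℝ} {n : ℕ}

/-- One coefficient of D f = 0, arranged so that only the first term contains x_l^(s+1). Where [s+1]
≠ 0 it expresses that coefficient through coefficients with x_l^s. -/
theorem monogenics_recurrence {f : SpinorPoly} (hf : (show DunklSpace k from f) ∈ monogenics k n)
    (l : Fin 3) (s a b : ℕ) :
    (bracket (k l) (s + 1) : ℂ) • sigma l (spinorCoeff (expo l (s + 1) a b) f)
      + (bracket (k (l + 1)) (a + 1) : ℂ) • sigma (l + 1) (spinorCoeff (expo l s (a + 1) b) f)
      + (bracket (k (l + 2)) (b + 1) : ℂ) • sigma (l + 2) (spinorCoeff (expo l s a (b + 1)) f)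
      = 0 := by
  have h := (mem_monogenics_iff.1 hf).2 (expo l s a b)
  obtain ⟨h1, h2, h3⟩ := expo_apply l s a b
  obtain ⟨g1, g2, g3⟩ := expo_add l s a b
  rw [fin3_sum l, h1, h2, h3, g1, g2, g3] at h
  exact h

theorem bracket_ne_zero_of_lt {κ : ℝ} (h : (n : ℕ∞) < tIndex κ) {s : ℕ} (h0 : s ≠ 0)
    (hs : s ≤ n) : bracket κ s ≠ 0 :=
  bracket_ne_zero h0 fun h' => by
    rw [h'] at h
    have : n < s := by exact_mod_cast h
    omega

/-- A monogenic polynomial is determined, on a set of exponents stable under raising, by its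
restriction to a coordinate plane. -/
theorem monogenics_coeff_eq_zero {f : SpinorPoly}
    (hf : (show DunklSpace k from f) ∈ monogenics k n) {l : Fin 3} (hl : (n : ℕ∞) < tIndex (k l))
    {U : ℕ → ℕ → Prop}
    (hU1 : ∀ a b, U a b → bracket (k (l + 1)) (a + 1) = 0 ∨ U (a + 1) b)
    (hU2 : ∀ a b, U a b → bracket (k (l + 2)) (b + 1) = 0 ∨ U a (b + 1))
    (h0 : ∀ a b, U a b → spinorCoeff (expo l 0 a b) f = 0) (s : ℕ) :
    ∀ a b, U a b → spinorCoeff (expo l s a b) f = 0 := by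
  induction s with
  | zero => exact h0
  | succ s ih =>
    intro a b hab
    by_cases hs : s + 1 ≤ n
    · have h := monogenics_recurrence hf l s a b
      -- Raising an exponent either stays inside U or comes with the factor zero, so both terms with
      -- x_l^s drop out of the recurrence.
      have e1 : (bracket (k (l + 1)) (a + 1) : ℂ) •
          sigma (l + 1) (spinorCoeff (expo l s (a + 1) b) f) = 0 := by
        rcases hU1 a b hab with h | h
        · rw [h]; simp
        · rw [ih _ _ h]; simp
      have e2 : (bracket (k (l + 2)) (b + 1) : ℂ) •
          sigma (l + 2) (spinorCoeff (expo l s a (b + 1)) f) = 0 := by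
        rcases hU2 a b hab with h | h
        · rw [h]; simp
        · rw [ih _ _ h]; simp
      rw [e1, e2, add_zero, add_zero] at h
      have hne : (bracket (k l) (s + 1) : ℂ) ≠ 0 :=
        Complex.ofReal_ne_zero.2 (bracket_ne_zero_of_lt hl (by omega) hs)
      have h' := (smul_eq_zero.1 h).resolve_left hne
      rw [← (sigma_sigma l (spinorCoeff (expo l (s + 1) a b) f)).1, h', map_zero]
    · refine (mem_monogenics_iff.1 hf).1 _ ?_
      rw [expo_degree]; omega

/-- The coefficients of the monogenic polynomial with a prescribed restriction. -/
noncomputable def extCoeff (k : Fin 3 → ℝ) (n : ℕ) (l : Fin 3) (g : ℕ → Fin 2 → ℂ) :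
    ℕ → ℕ → ℕ → Fin 2 → ℂ
  | 0, a, b => if a + b = n then g b else 0
  | s + 1, a, b => (-(bracket (k l) (s + 1) : ℂ)⁻¹) • sigma l
      ((bracket (k (l + 1)) (a + 1) : ℂ) • sigma (l + 1) (extCoeff k n l g s (a + 1) b)
      + (bracket (k (l + 2)) (b + 1) : ℂ) • sigma (l + 2) (extCoeff k n l g s a (b + 1)))

theorem extCoeff_eq_zero (l : Fin 3) (g : ℕ → Fin 2 → ℂ) (s : ℕ) :
    ∀ a b, s + a + b ≠ n → extCoeff k n l g s a b = 0 := by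
  induction s with
  | zero => intro a b h; rw [extCoeff, if_neg (by omega)]
  | succ s ih =>
    intro a b h
    rw [extCoeff, ih (a + 1) b (by omega), ih a (b + 1) (by omega)]; simp

/-- The Cauchy–Kovalevskaya extension: the recurrence is solved for the highest power of x_l,
starting from arbitrary values on the plane. -/
theorem exists_monogenic {l : Fin 3} (hl : (n : ℕ∞) < tIndex (k l)) (g : ℕ → Fin 2 → ℂ) :
    ∃ f : SpinorPoly, (show DunklSpace k from f) ∈ monogenics k n ∧
      ∀ a b, a + b = n → spinorCoeff (expo l 0 a b) f = g b := by
  classical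
  let S : Finset (Fin 3 →₀ ℕ) := Finset.finsuppAntidiag Finset.univ n
  have hS : ∀ m : Fin 3 →₀ ℕ, m ∈ S ↔ m.degree = n := by
    intro m
    rw [Finset.mem_finsuppAntidiag, Finsupp.degree_eq_sum]
    simp
  let f : SpinorPoly := ∑ m ∈ S, extCoeff k n l g (m l) (m (l + 1)) (m (l + 2)) ⊗ₜ[ℝ]
    (monomial m 1 : Poly3)
  have hc : ∀ s a b, spinorCoeff (expo l s a b) f = extCoeff k n l g s a b := by
    intro s a b
    obtain ⟨h1, h2, h3⟩ := expo_apply l s a b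
    simp only [f, map_sum, spinorCoeff_monomial, Finset.sum_ite_eq', hS, expo_degree, h1, h2, h3,
      one_smul]
    split_ifs with h
    · rfl
    · exact (extCoeff_eq_zero l g s a b h).symm
  refine ⟨f, mem_monogenics_iff.2 ⟨fun m hm => ?_, fun m => ?_⟩, fun a b hab => ?_⟩
  · rw [eq_expo l m, hc]
    refine extCoeff_eq_zero l g _ _ _ ?_
    rwa [← expo_degree l, ← eq_expo]
  · obtain ⟨s, a, b, rfl⟩ : ∃ s a b, m = expo l s a b := ⟨_, _, _, eq_expo l m⟩
    obtain ⟨h1, h2, h3⟩ := expo_apply l s a b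
    obtain ⟨g1, g2, g3⟩ := expo_add l s a b
    rw [fin3_sum l, h1, h2, h3, g1, g2, g3, hc, hc, hc]
    simp only [← sigma_apply]
    -- If s + 1 > n, all three exponents in the recurrence have degree above n and their
    -- coefficients are zero.
    by_cases hs : s + 1 ≤ n
    · have hne : (bracket (k l) (s + 1) : ℂ) ≠ 0 :=
        Complex.ofReal_ne_zero.2 (bracket_ne_zero_of_lt hl (by omega) hs)
      rw [extCoeff, map_smul, (sigma_sigma l _).1, smul_smul, mul_neg, mul_inv_cancel₀ hne]
      module
    · rw [extCoeff_eq_zero l g (s + 1) a b (by omega), extCoeff_eq_zero l g s (a + 1) b (by omega),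
        extCoeff_eq_zero l g s a (b + 1) (by omega)]
      simp
  · rw [hc, extCoeff, if_pos hab]

/-- On x_l = 0 only the part x_{l+2} T_l of the rotation term survives. It involves the coefficients
of x_l^1, which D f = 0 rewrites through coefficients on the plane; hence the action closes up on
restrictions, and b + 1 receives a contribution only from b. -/
theorem restr_biOp_one_succ {f : SpinorPoly} (hf : (show DunklSpace k from f) ∈ monogenics k n)
    (l : Fin 3) (a b : ℕ) :
    spinorCoeff (expo l 0 a (b + 1)) (biOp k (l + 1) f)
      = ((-1) ^ (b + 1) * ((b + 1 : ℕ) + 1 / 2 + k l + k (l + 2)) : ℂ) •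
          spinorCoeff (expo l 0 a (b + 1)) f
        + ((-1) ^ b * I * bracket (k (l + 1)) (a + 1) : ℂ) •
          sigma l (spinorCoeff (expo l 0 (a + 1) b) f) := by
  have h := monogenics_recurrence hf l 0 a b
  obtain ⟨q1, q2, q3, q4⟩ := fin3_add l
  obtain ⟨h1, h2, h3⟩ := expo_apply l 0 a (b + 1)
  obtain ⟨i1, i2, i3⟩ := expo_apply l 1 a b
  obtain ⟨j1, j2, j3⟩ := expo_apply l 0 a b
  have e1 := spinorCoeff_opX_add (l + 2) (expo l 0 a b)
  rw [(expo_add l 0 a b).2.2] at e1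
  have e2 := fun g => spinorCoeff_opX_zero l (expo l 0 a (b + 1)) h1 g
  have e3 := spinorCoeff_opT k l (expo l 0 a b)
  rw [(expo_add l 0 a b).1, j1] at e3
  simp only [biOp, q1, q2, LinearMap.add_apply, LinearMap.smul_apply, mul_sub, sub_mul,
    LinearMap.sub_apply, Module.End.mul_apply, map_add, map_sub, map_smul, spinorCoeff_opE,
    spinorCoeff_opR, e1, e2, e3, h1, h2, h3, i1, i2, i3, ← sigma_apply]
  generalize spinorCoeff (expo l 0 a (b + 1)) f = u at *
  generalize spinorCoeff (expo l 0 (a + 1) b) f = v at *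
  -- Multiplying the recurrence by σ_{l+2} turns σ_l into iσ_{l+1}, σ_{l+1} into -iσ_l and σ_{l+2}
  -- into 1.
  have hw : (bracket (k l) (0 + 1) : ℂ) • sigma (l + 1) (spinorCoeff (expo l (0 + 1) a b) f)
      = (bracket (k (l + 1)) (a + 1) : ℂ) • sigma l v + (I * bracket (k (l + 2)) (b + 1) : ℂ) • u := by
    have h' := congrArg (sigma (l + 2)) h
    have r1 := (sigma_sigma (l + 2) (spinorCoeff (expo l (0 + 1) a b) f)).2.1
    have r2 := (sigma_sigma (l + 1) v).2.2
    have r3 := (sigma_sigma (l + 2) u).1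
    rw [q1, q2] at r2
    rw [q3, q4] at r1
    simp only [map_add, map_smul, r1, r2, r3, map_zero] at h'
    have h'' := congrArg (fun z => (-I) • z) h'
    simp only [smul_add, smul_smul, smul_zero] at h''
    rw [← sub_eq_zero, ← h'']
    match_scalars <;> ring_nf <;> simp [Complex.I_sq]

  have key : I • (bracket (k l) (0 + 1) : ℂ) • ((-1) ^ b : ℂ) • ((-1) ^ 1 : ℂ) •
      sigma (l + 1) (spinorCoeff (expo l (0 + 1) a b) f)
      = (-(-1) ^ b * I : ℂ) • ((bracket (k (l + 1)) (a + 1) : ℂ) • sigma l v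
        + (I * bracket (k (l + 2)) (b + 1) : ℂ) • u) := by
    rw [← hw]; module
  simp only [zero_add] at key
  simp only [map_zero, zero_add, pow_zero, one_smul, smul_sub, smul_zero, zero_sub, sub_zero, smul_neg, key]
  have hb : (bracket (k (l + 2)) (b + 1) : ℂ) = (b + 1 : ℕ) + (1 - (-1) ^ (b + 1)) * k (l + 2) := by
    simp [bracket]
  rw [hb]
  match_scalars
  · ring
  · rcases neg_one_pow_eq_or ℂ b with h | h <;> simp only [pow_succ, h] <;> ring_nf <;>
      simp only [Complex.I_sq] <;> push_cast <;> ring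

/-- With no factor x_{l+2} present the rotation term contributes nothing, so the polynomial need not
be monogenic. -/
theorem restr_biOp_one_zero (f : SpinorPoly) (l : Fin 3) (a : ℕ) :
    spinorCoeff (expo l 0 a 0) (biOp k (l + 1) f)
      = (1 / 2 + k l + k (l + 2) : ℂ) • spinorCoeff (expo l 0 a 0) f := by
  obtain ⟨q1, q2, q3, q4⟩ := fin3_add l
  obtain ⟨h1, h2, h3⟩ := expo_apply l 0 a 0
  have e1 := fun g => spinorCoeff_opX_zero (l + 2) (expo l 0 a 0) h3 g
  have e2 := fun g => spinorCoeff_opX_zero l (expo l 0 a 0) h1 g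
  simp only [biOp, q1, q2, LinearMap.add_apply, LinearMap.smul_apply, mul_sub, sub_mul,
    LinearMap.sub_apply, Module.End.mul_apply, map_add, map_sub, map_smul, spinorCoeff_opE,
    spinorCoeff_opR, e1, e2, h1, h2, h3, ← sigma_apply, map_zero]
  match_scalars
  ring

/-- The mirror image: now x_{l+1} T_l survives, and the coefficient at b receives a contribution
from b + 1. -/
theorem restr_biOp_two_succ {f : SpinorPoly} (hf : (show DunklSpace k from f) ∈ monogenics k n)
    (l : Fin 3) (a b : ℕ) :
    spinorCoeff (expo l 0 (a + 1) b) (biOp k (l + 2) f)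
      = ((-1) ^ (a + 1) * ((a + 1 : ℕ) + 1 / 2 + k l + k (l + 1)) : ℂ) •
          spinorCoeff (expo l 0 (a + 1) b) f
        - ((-1) ^ a * I * bracket (k (l + 2)) (b + 1) : ℂ) •
          sigma l (spinorCoeff (expo l 0 a (b + 1)) f) := by
  have h := monogenics_recurrence hf l 0 a b
  obtain ⟨q1, q2, q3, q4⟩ := fin3_add l
  obtain ⟨h1, h2, h3⟩ := expo_apply l 0 (a + 1) b
  obtain ⟨i1, i2, i3⟩ := expo_apply l 1 a b
  obtain ⟨j1, j2, j3⟩ := expo_apply l 0 a b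
  have e1 := spinorCoeff_opX_add (l + 1) (expo l 0 a b)
  rw [(expo_add l 0 a b).2.1] at e1
  have e2 := fun g => spinorCoeff_opX_zero l (expo l 0 (a + 1) b) h1 g
  have e3 := spinorCoeff_opT k l (expo l 0 a b)
  rw [(expo_add l 0 a b).1, j1] at e3
  simp only [biOp, q3, q4, LinearMap.add_apply, LinearMap.smul_apply, mul_sub, sub_mul,
    LinearMap.sub_apply, Module.End.mul_apply, map_add, map_sub, map_smul, spinorCoeff_opE,
    spinorCoeff_opR, e1, e2, e3, h1, h2, h3, i1, i2, i3, ← sigma_apply]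
  generalize spinorCoeff (expo l 0 (a + 1) b) f = u at *
  generalize spinorCoeff (expo l 0 a (b + 1)) f = v at *
  have hw : (bracket (k l) (0 + 1) : ℂ) • sigma (l + 2) (spinorCoeff (expo l (0 + 1) a b) f)
      = (bracket (k (l + 2)) (b + 1) : ℂ) • sigma l v - (I * bracket (k (l + 1)) (a + 1) : ℂ) • u := by
    have h' := congrArg (sigma (l + 1)) h
    have r1 := (sigma_sigma l (spinorCoeff (expo l (0 + 1) a b) f)).2.2
    have r2 := (sigma_sigma (l + 1) v).2.1
    have r3 := (sigma_sigma (l + 1) u).1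
    rw [q1, q2] at r2
    simp only [map_add, map_smul, r1, r2, r3, map_zero] at h'
    have h'' := congrArg (fun z => I • z) h'
    simp only [smul_add, smul_smul, smul_zero] at h''
    rw [← sub_eq_zero, ← h'']
    match_scalars <;> ring_nf <;> simp [Complex.I_sq]
  have key : I • (bracket (k l) (0 + 1) : ℂ) • ((-1) ^ 1 : ℂ) • ((-1) ^ a : ℂ) •
      sigma (l + 2) (spinorCoeff (expo l (0 + 1) a b) f)
      = (-(-1) ^ a * I : ℂ) • ((bracket (k (l + 2)) (b + 1) : ℂ) • sigma l v
        - (I * bracket (k (l + 1)) (a + 1) : ℂ) • u) := by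
    rw [← hw]; module
  simp only [zero_add] at key
  simp only [map_zero, zero_add, pow_zero, one_smul, smul_sub, smul_zero, zero_sub, sub_zero, smul_neg, key]
  have hb : (bracket (k (l + 1)) (a + 1) : ℂ) = (a + 1 : ℕ) + (1 - (-1) ^ (a + 1)) * k (l + 1) := by
    simp [bracket]
  rw [hb]
  match_scalars
  · ring
  · rcases neg_one_pow_eq_or ℂ a with h | h <;> simp only [pow_succ, h] <;> ring_nf <;>
      simp only [Complex.I_sq] <;> push_cast <;> ring

theorem restr_biOp_two_zero (f : SpinorPoly) (l : Fin 3) (b : ℕ) :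
    spinorCoeff (expo l 0 0 b) (biOp k (l + 2) f)
      = (1 / 2 + k l + k (l + 1) : ℂ) • spinorCoeff (expo l 0 0 b) f := by
  obtain ⟨q1, q2, q3, q4⟩ := fin3_add l
  obtain ⟨h1, h2, h3⟩ := expo_apply l 0 0 b
  have e1 := fun g => spinorCoeff_opX_zero (l + 1) (expo l 0 0 b) h2 g
  have e2 := fun g => spinorCoeff_opX_zero l (expo l 0 0 b) h1 g
  simp only [biOp, q3, q4, LinearMap.add_apply, LinearMap.smul_apply, mul_sub, sub_mul,
    LinearMap.sub_apply, Module.End.mul_apply, map_add, map_sub, map_smul, spinorCoeff_opE,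
    spinorCoeff_opR, e1, e2, h1, h2, h3, ← sigma_apply, map_zero]
  match_scalars
  ring

theorem opX_opT (k : Fin 3 → ℝ) (i : Fin 3) (m : Fin 3 →₀ ℕ) (f : SpinorPoly) :
    spinorCoeff m (opX i (opT k i f)) = (bracket (k i) (m i) : ℂ) • spinorCoeff m f := by
  by_cases hm : m i = 0
  · rw [spinorCoeff_opX_zero i m hm, hm, bracket_zero]; simp
  · obtain ⟨m', rfl⟩ : ∃ m', m = m' + Finsupp.single i 1 := by
      refine ⟨m - Finsupp.single i 1, (tsub_add_cancel_of_le ?_).symm⟩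
      rw [Finsupp.single_le_iff]; omega
    rw [spinorCoeff_opX_add, spinorCoeff_opT]
    simp

/-- The anticommutator of the Dirac--Dunkl operator with multiplication by the vector variable. -/
theorem dirac_vector (k : Fin 3 → ℝ) :
    (∑ i, opE i * opT k i) * (∑ i, opE i * opX i) + (∑ i, opE i * opX i) * (∑ i, opE i * opT k i)
      = ∑ i, ((2 : ℂ) • (opX i * opT k i) + 1 + (2 * k i : ℂ) • opR i) := by
  have H := dunklData k
  have c1 := H.s_cyc 0
  have c2 := H.s_cyc 1
  have c3 := H.s_cyc 2
  have d1 := H.s_cyc' 0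
  have d2 := H.s_cyc' 1
  have d3 := H.s_cyc' 2
  simp only [Fin.isValue, zero_add, Fin.reduceAdd] at c1 c2 c3 d1 d2 d3
  have e1 := H.T_x 0 1 (by decide)
  have e2 := H.T_x 0 2 (by decide)
  have e3 := H.T_x 1 0 (by decide)
  have e4 := H.T_x 1 2 (by decide)
  have e5 := H.T_x 2 0 (by decide)
  have e6 := H.T_x 2 1 (by decide)
  have T_s : ∀ i j (z : Module.End ℂ SpinorPoly), opT k i * (opE j * z) = opE j * opT k i * z :=
    fun i j => DunklData.reassoc (H.T_s i j)
  have x_s : ∀ i j (z : Module.End ℂ SpinorPoly), opX i * (opE j * z) = opE j * opX i * z :=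
    fun i j => DunklData.reassoc (H.x_s i j)
  have s_s : ∀ i (z : Module.End ℂ SpinorPoly), opE i * (opE i * z) = 1 * z :=
    fun i => DunklData.reassoc (H.s_sq i)
  simp only [Fin.sum_univ_three, mul_add, add_mul, mul_assoc, T_s, x_s, s_s, one_mul,
    DunklData.reassoc c1, DunklData.reassoc c2, DunklData.reassoc c3, DunklData.reassoc d1,
    DunklData.reassoc d2, DunklData.reassoc d3, e1, e2, e3, e4, e5, e6, H.T_x_self,
    smul_mul_assoc]
  match_scalars <;> ring

/-- By `DunklData.core` the left side is a combination of 1 and the Casimir element ½(D x - x D - 1)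
r₁r₂r₃, where x is the vector variable. On ℳₙ the term x D vanishes, D x equals the anticommutator D
x + x D, and r₁r₂r₃ = (-1)^n = 1 as n is even. -/
theorem anticomm_monogenics {f : SpinorPoly}
    (hf : (show DunklSpace k from f) ∈ monogenics k n) (hn : Even n) (i : Fin 3) :
    biOp k i (biOp k (i + 1) f) + biOp k (i + 1) (biOp k i f) - biOp k (i + 2) f
      = (2 * k i * k (i + 1) + 2 * k (i + 2) * (k 0 + k 1 + k 2 + n + 1) : ℂ) • f := by
  have hd : dirac k f = 0 := hf.2
  have hD : (∑ i, opE i * opT k i : Module.End ℂ SpinorPoly) f = 0 := hd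
  have hcore : (biOp k i * biOp k (i + 1) + biOp k (i + 1) * biOp k i - biOp k (i + 2)) f
      = ((2 * k i * k (i + 1) : ℂ) • (1 : Module.End ℂ SpinorPoly)
        + (2 * k (i + 2) : ℂ) • DunklData.cas opE opX (opT k) opR) f :=
    LinearMap.congr_fun ((dunklData k).core i).2.2.2 f
  have hR : (opR 0 * opR 1 * opR 2) f = f := by
    rw [← sub_eq_zero]
    refine spinor_eq_zero fun m => ?_
    simp only [map_sub, Module.End.mul_apply, spinorCoeff_opR, smul_smul]
    by_cases hm : m.degree = n
    · rw [← pow_add, ← pow_add]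
      have : m 0 + (m 1 + m 2) = n := by
        rw [← hm, Finsupp.degree_eq_sum, Fin.sum_univ_three, add_assoc]
      rw [this, hn.neg_one_pow, one_smul, sub_self]
    · rw [(mem_monogenics_iff.1 hf).1 m hm]; simp
  -- On x^m the operator 2x_iT_i + 1 + 2k_ir_i has eigenvalue 2m_i + 1 + 2k_i for either parity of
  -- m_i; the sum over i is 2n + 3 + 2K.
  have hX : (∑ i, opE i * opT k i) ((∑ i, opE i * opX i) f)
      = (2 * (n + 1 + (k 0 + k 1 + k 2)) + 1 : ℂ) • f := by
    have h := LinearMap.congr_fun (dirac_vector k) f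
    rw [LinearMap.add_apply, Module.End.mul_apply, Module.End.mul_apply, hD, map_zero, add_zero] at h
    rw [h, ← sub_eq_zero]
    refine spinor_eq_zero fun m => ?_
    simp only [Fin.sum_univ_three, LinearMap.add_apply, LinearMap.smul_apply, Module.End.mul_apply,
      Module.End.one_apply, map_add, map_sub, map_smul, opX_opT, spinorCoeff_opR]
    by_cases hm : m.degree = n
    · have : (n : ℂ) = m 0 + m 1 + m 2 := by
        rw [← hm, Finsupp.degree_eq_sum, Fin.sum_univ_three]; push_cast; rfl
      rw [this]
      simp only [bracket]
      match_scalars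
      push_cast
      ring
    · rw [(mem_monogenics_iff.1 hf).1 m hm]; simp
  rw [LinearMap.sub_apply, LinearMap.add_apply, Module.End.mul_apply, Module.End.mul_apply] at hcore
  rw [hcore]
  simp only [DunklData.cas, LinearMap.add_apply, LinearMap.smul_apply, Module.End.one_apply]
  rw [Module.End.mul_apply, hR]
  simp only [LinearMap.sub_apply, Module.End.one_apply]
  rw [Module.End.mul_apply, Module.End.mul_apply, hX, hD, map_zero]
  module

end

/-! ### Eigenlines of σ_l and bidiagonal coordinates -/

section

section Bidiagonal

variable (d : ℕ) (a b : ℂ) (φ : ℕ → ℂ) (y : Fin (d + 1) → ℂ)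

theorem endX_apply (i : Fin (d + 1)) : endX d a y i
    = biTheta d a i * y i + ∑ j : Fin (d + 1), if (i : ℕ) = j + 1 then y j else 0 := by
  have h : ∀ j : Fin (d + 1), matX d a i j * y j
      = (if i = j then biTheta d a i * y j else 0) + if (i : ℕ) = j + 1 then y j else 0 := by
    intro j
    by_cases h1 : i = j
    · subst h1; simp [matX]
    · simp only [matX, Matrix.of_apply, if_neg h1, zero_add]
      split_ifs <;> simp
  show (matX d a).mulVec y i = _
  rw [Matrix.mulVec, dotProduct, Finset.sum_congr rfl fun j _ => h j, Finset.sum_add_distrib]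
  simp

theorem endX_zero (h : 0 < d + 1) : endX d a y ⟨0, h⟩ = biTheta d a 0 * y ⟨0, h⟩ := by
  rw [endX_apply]; simp

theorem endX_succ (i : ℕ) (h : i + 1 < d + 1) : endX d a y ⟨i + 1, h⟩
    = biTheta d a (i + 1) * y ⟨i + 1, h⟩ + y ⟨i, by omega⟩ := by
  rw [endX_apply]
  congr 1
  rw [Finset.sum_eq_single ⟨i, by omega⟩]
  · simp
  · intro j _ hj
    rw [if_neg]
    intro h'
    have h'' : i + 1 = (j : ℕ) + 1 := h'
    exact hj (Fin.ext (show (j : ℕ) = i by omega))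
  · simp

theorem endY_apply (i : Fin (d + 1)) : endY d b φ y i
    = biTheta d b i * y i + ∑ j : Fin (d + 1), if (j : ℕ) = i + 1 then φ j * y j else 0 := by
  have h : ∀ j : Fin (d + 1), matY d b φ i j * y j
      = (if i = j then biTheta d b i * y j else 0)
        + if (j : ℕ) = i + 1 then φ j * y j else 0 := by
    intro j
    by_cases h1 : i = j
    · subst h1; simp [matY]
    · simp only [matY, Matrix.of_apply, if_neg h1, zero_add]
      split_ifs <;> simp
  show (matY d b φ).mulVec y i = _
  rw [Matrix.mulVec, dotProduct, Finset.sum_congr rfl fun j _ => h j, Finset.sum_add_distrib]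
  simp

theorem endY_last (i : ℕ) (h : i < d + 1) (hi : i = d) : endY d b φ y ⟨i, h⟩
    = biTheta d b i * y ⟨i, h⟩ := by
  rw [endY_apply, Finset.sum_eq_zero, add_zero]
  intro j _
  rw [if_neg]
  have := j.2
  simp only
  omega

theorem endY_lt (i : ℕ) (h : i + 1 < d + 1) : endY d b φ y ⟨i, by omega⟩
    = biTheta d b i * y ⟨i, by omega⟩ + φ (i + 1) * y ⟨i + 1, h⟩ := by
  rw [endY_apply]
  congr 1
  rw [Finset.sum_eq_single ⟨i + 1, h⟩]
  · simp
  · intro j _ hj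
    rw [if_neg]
    intro h'
    exact hj (Fin.ext h')
  · simp

end Bidiagonal

/-- A Pauli matrix is diagonalizable with eigenvalues `1` and `-1`. -/
theorem exists_sigma_eigen (l : Fin 3) : ∃ μ : ℂ → ((Fin 2 → ℂ) →ₗ[ℂ] ℂ),
    (∀ ε v, ε ^ 2 = 1 → μ ε (sigma l v) = ε * μ ε v) ∧
    (∀ v, μ 1 v = 0 → μ (-1) v = 0 → v = 0) ∧
    ∀ x y, ∃ v, μ 1 v = x ∧ μ (-1) v = y := by
  let p : Fin 2 → ((Fin 2 → ℂ) →ₗ[ℂ] ℂ) := fun i => LinearMap.proj i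
  fin_cases l
  -- The functional for ε is a left eigenvector of the Pauli matrix: (1, ε), then (1, -iε), then the
  -- coordinate projections, written so that one formula in ε covers both signs.
  · refine ⟨fun ε => p 0 + ε • p 1, fun ε v hε => ?_, fun v h1 h2 => ?_, fun x y =>
      ⟨![(x + y) / 2, (x - y) / 2], ?_, ?_⟩⟩
    · simp [p, sigma_apply, pauli, Matrix.mulVec, dotProduct, Fin.sum_univ_two]
      linear_combination -(v 1) * hε
    · simp only [p, LinearMap.add_apply, LinearMap.smul_apply, LinearMap.proj_apply,
        smul_eq_mul] at h1 h2
      ext i; fin_cases i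
      · show v 0 = 0; linear_combination (h1 + h2) / 2
      · show v 1 = 0; linear_combination (h1 - h2) / 2
    · simp [p]; ring
    · simp [p]; ring
  · refine ⟨fun ε => p 0 - (ε * I) • p 1, fun ε v hε => ?_, fun v h1 h2 => ?_, fun x y =>
      ⟨![(x + y) / 2, I * (x - y) / 2], ?_, ?_⟩⟩
    · simp [p, sigma_apply, pauli, Matrix.mulVec, dotProduct, Fin.sum_univ_two]
      linear_combination (v 1 * I) * hε - ε * v 0 * Complex.I_mul_I
    · simp only [p, LinearMap.sub_apply, LinearMap.smul_apply, LinearMap.proj_apply,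
        smul_eq_mul] at h1 h2
      ext i; fin_cases i
      · show v 0 = 0; linear_combination (h1 + h2) / 2
      · show v 1 = 0; linear_combination I * (h1 - h2) / 2 + v 1 * Complex.I_mul_I
    · simp [p]; linear_combination -(x - y) / 2 * Complex.I_mul_I
    · simp [p]; linear_combination (x - y) / 2 * Complex.I_mul_I
  · refine ⟨fun ε => ((1 + ε) / 2) • p 0 + ((1 - ε) / 2) • p 1, fun ε v hε => ?_, fun v h1 h2 => ?_,
      fun x y => ⟨![x, y], ?_, ?_⟩⟩
    · simp [p, sigma_apply, pauli, Matrix.mulVec, dotProduct, Fin.sum_univ_two]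
      linear_combination (-(v 0) / 2 + v 1 / 2) * hε
    · simp [p] at h1 h2
      ext i; fin_cases i
      · show v 0 = 0; linear_combination h1
      · show v 1 = 0; linear_combination h2
    · simp [p]
    · simp [p]

variable {k : Fin 3 → ℝ} {n : ℕ}

/-- The scalars that normalize the subdiagonal entries to `1`. -/
noncomputable def normScalar (k : Fin 3 → ℝ) (n : ℕ) (l : Fin 3) (b₀ : ℕ) (c : ℂ) : ℕ → ℂ
  | 0 => 1
  | i + 1 => normScalar k n l b₀ c i / (c * (-1) ^ (b₀ + i) * I * bracket (k (l + 1)) (n - b₀ - i))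

theorem normScalar_ne_zero {l : Fin 3} {b₀ d : ℕ} {c : ℂ} (hc : c ≠ 0)
    (hne : ∀ i < d, bracket (k (l + 1)) (n - b₀ - i) ≠ 0) (i : ℕ) (hi : i ≤ d) :
    normScalar k n l b₀ c i ≠ 0 := by
  induction i with
  | zero => exact one_ne_zero
  | succ i ih =>
    refine div_ne_zero (ih (by omega)) ?_
    have := Complex.ofReal_ne_zero.2 (hne i (by omega))
    have h2 : ((-1 : ℂ)) ^ (b₀ + i) ≠ 0 := pow_ne_zero _ (by norm_num)
    exact mul_ne_zero (mul_ne_zero (mul_ne_zero hc h2) I_ne_zero) this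

/-- The coordinates of a monogenic polynomial along `b₀, …, b₀ + d`. -/
noncomputable def coords (k : Fin 3 → ℝ) (n : ℕ) (l : Fin 3) (b₀ d : ℕ) (c : ℂ)
    (μ : (Fin 2 → ℂ) →ₗ[ℂ] ℂ) : SpinorPoly →ₗ[ℂ] (Fin (d + 1) → ℂ) :=
  LinearMap.pi fun i => normScalar k n l b₀ c i •
    (μ ∘ₗ spinorCoeff (expo l 0 (n - (b₀ + i)) (b₀ + i)))

theorem coords_apply (l : Fin 3) (b₀ d : ℕ) (c : ℂ) (μ : (Fin 2 → ℂ) →ₗ[ℂ] ℂ) (f : SpinorPoly)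
    (i : ℕ) (h : i < d + 1) : coords k n l b₀ d c μ f ⟨i, h⟩
      = normScalar k n l b₀ c i * μ (spinorCoeff (expo l 0 (n - (b₀ + i)) (b₀ + i)) f) := rfl

/-- The hypothesis `hlow` lists the ways in which the entry from b₀ - 1 into the strip can
disappear: no such index, a zero bracket, or a zero coefficient. The constant s ε in the
normalization absorbs the twisting sign and the eigenvalue of σ_l, so that the subdiagonal becomes
1. -/
theorem coords_biOp_one {f : SpinorPoly} (hf : (show DunklSpace k from f) ∈ monogenics k n)
    {l : Fin 3} {b₀ d : ℕ} (hbd : b₀ + d ≤ n)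
    (hlow : b₀ = 0 ∨ bracket (k (l + 1)) (n - b₀ + 1) = 0 ∨
      spinorCoeff (expo l 0 (n - b₀ + 1) (b₀ - 1)) f = 0)
    (hne : ∀ i < d, bracket (k (l + 1)) (n - b₀ - i) ≠ 0) {s ε : ℂ} (hs : s ^ 2 = 1)
    (hε : ε ^ 2 = 1) {a : ℂ}
    (hθ : ∀ i ≤ d, biTheta d a i
      = s * ((-1) ^ (b₀ + i) * ((b₀ + i : ℕ) + 1 / 2 + k l + k (l + 2))))
    {μ : (Fin 2 → ℂ) →ₗ[ℂ] ℂ} (hμ : ∀ v, μ (sigma l v) = ε * μ v) :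
    coords k n l b₀ d (s * ε) μ (biOp k (l + 1) f)
      = s • endX d a (coords k n l b₀ d (s * ε) μ f) := by
  funext ⟨i, hi⟩
  rw [Pi.smul_apply, smul_eq_mul, coords_apply]
  rcases i with _ | i
  · rw [endX_zero, coords_apply, hθ 0 (by omega)]
    have key : spinorCoeff (expo l 0 (n - (b₀ + 0)) (b₀ + 0)) (biOp k (l + 1) f)
        = ((-1) ^ (b₀ + 0) * ((b₀ + 0 : ℕ) + 1 / 2 + k l + k (l + 2)) : ℂ) •
          spinorCoeff (expo l 0 (n - (b₀ + 0)) (b₀ + 0)) f := by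
      rcases Nat.eq_zero_or_pos b₀ with rfl | hpos
      · simp [restr_biOp_one_zero]
      · obtain ⟨b, rfl⟩ : ∃ b, b₀ = b + 1 := ⟨b₀ - 1, by omega⟩
        rw [add_zero, restr_biOp_one_succ hf]
        rcases hlow with h | h | h
        · omega
        · rw [h]; simp
        · rw [Nat.add_sub_cancel] at h; rw [h]; simp
    rw [key, map_smul, smul_eq_mul]
    linear_combination (-(normScalar k n l b₀ (s * ε) 0) * ((-1) ^ (b₀ + 0) *
      ((b₀ + 0 : ℕ) + 1 / 2 + k l + k (l + 2))) *
        μ (spinorCoeff (expo l 0 (n - (b₀ + 0)) (b₀ + 0)) f)) * hs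
  · rw [endX_succ, coords_apply, coords_apply, hθ (i + 1) (by omega)]
    have e : n - (b₀ + (i + 1)) + 1 = n - b₀ - i := by omega
    have e' : n - (b₀ + i) = n - b₀ - i := by omega
    have key := restr_biOp_one_succ hf l (n - (b₀ + (i + 1))) (b₀ + i)
    rw [e] at key
    rw [show b₀ + (i + 1) = b₀ + i + 1 by ring] at key ⊢
    rw [e', key, map_add, map_smul, map_smul, hμ, smul_eq_mul, smul_eq_mul]
    have hb : (bracket (k (l + 1)) (n - b₀ - i) : ℂ) ≠ 0 :=
      Complex.ofReal_ne_zero.2 (hne i (by omega))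
    have hs0 : s ≠ 0 := by rintro rfl; simp at hs
    have hε0 : ε ≠ 0 := by rintro rfl; simp at hε
    have h2 : ((-1 : ℂ)) ^ (b₀ + i) ≠ 0 := pow_ne_zero _ (by norm_num)
    have hN : normScalar k n l b₀ (s * ε) i = normScalar k n l b₀ (s * ε) (i + 1) *
        (s * ε * (-1) ^ (b₀ + i) * I * bracket (k (l + 1)) (n - b₀ - i)) := by
      rw [normScalar, div_mul_cancel₀]
      exact mul_ne_zero (mul_ne_zero (mul_ne_zero (mul_ne_zero hs0 hε0) h2) I_ne_zero) hb
    rw [hN]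
    linear_combination (-(normScalar k n l b₀ (s * ε) (i + 1)) * (((-1) ^ (b₀ + i + 1) *
      ((b₀ + i + 1 : ℕ) + 1 / 2 + k l + k (l + 2))) *
        μ (spinorCoeff (expo l 0 (n - (b₀ + i + 1)) (b₀ + i + 1)) f)
        + (-1) ^ (b₀ + i) * I * bracket (k (l + 1)) (n - b₀ - i) * ε *
          μ (spinorCoeff (expo l 0 (n - b₀ - i) (b₀ + i)) f))) * hs

/-- Only the product of a subdiagonal and the corresponding superdiagonal entry is independent of
the normalization. For even n the sign powers in the two entries agree, so the product is
i²[n-b][b+1]; the condition s s' = -1 cancels i² and leaves φ. `hhigh` describes how the entry from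
above the strip disappears. -/
theorem coords_biOp_two {f : SpinorPoly} (hf : (show DunklSpace k from f) ∈ monogenics k n)
    (hn : Even n) {l : Fin 3} {b₀ d : ℕ} (hbd : b₀ + d ≤ n)
    (hhigh : b₀ + d = n ∨ bracket (k (l + 2)) (b₀ + d + 1) = 0 ∨
      spinorCoeff (expo l 0 (n - (b₀ + d + 1)) (b₀ + d + 1)) f = 0)
    (hne : ∀ i < d, bracket (k (l + 1)) (n - b₀ - i) ≠ 0) {s s' ε : ℂ} (hs : s' ^ 2 = 1)
    (hss : s * s' = -1)
    (hε : ε ^ 2 = 1) {b : ℂ} {φ : ℕ → ℂ}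
    (hθ : ∀ i ≤ d, biTheta d b i
      = s' * ((-1) ^ (b₀ + i) * (n - (b₀ + i : ℕ) + 1 / 2 + k l + k (l + 1))))
    (hφ : ∀ i < d, φ (i + 1)
      = bracket (k (l + 1)) (n - b₀ - i) * bracket (k (l + 2)) (b₀ + i + 1))
    {μ : (Fin 2 → ℂ) →ₗ[ℂ] ℂ} (hμ : ∀ v, μ (sigma l v) = ε * μ v) :
    coords k n l b₀ d (s * ε) μ (biOp k (l + 2) f)
      = s' • endY d b φ (coords k n l b₀ d (s * ε) μ f) := by
  funext ⟨i, hi⟩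
  rw [Pi.smul_apply, smul_eq_mul, coords_apply]
  have hpar : ∀ a b : ℕ, a + b = n → (-1 : ℂ) ^ a = (-1) ^ b := by
    intro a b hab
    have h : (-1 : ℂ) ^ a * (-1) ^ b = 1 := by rw [← pow_add, hab, hn.neg_one_pow]
    have h' : (-1 : ℂ) ^ b * (-1) ^ b = 1 := by rw [← mul_pow]; simp
    have hb : (-1 : ℂ) ^ b ≠ 0 := pow_ne_zero _ (by norm_num)
    exact mul_right_cancel₀ hb (h.trans h'.symm)
  have hcast : ∀ a b : ℕ, a + b = n → (a : ℂ) = n - b := by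
    intro a b hab
    rw [← hab]; push_cast; ring
  by_cases hid : i = d
  · subst hid
    rw [endY_last _ _ _ _ _ _ rfl, coords_apply, hθ _ le_rfl]
    have key : spinorCoeff (expo l 0 (n - (b₀ + i)) (b₀ + i)) (biOp k (l + 2) f)
        = ((-1) ^ (b₀ + i) * (n - (b₀ + i : ℕ) + 1 / 2 + k l + k (l + 1)) : ℂ) •
          spinorCoeff (expo l 0 (n - (b₀ + i)) (b₀ + i)) f := by
      rcases Nat.eq_zero_or_pos (n - (b₀ + i)) with h0 | hpos
      · have hi' : b₀ + i = n := by omega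
        rw [h0, restr_biOp_two_zero, hi', hn.neg_one_pow]
        simp
      · obtain ⟨a, ha⟩ : ∃ a, n - (b₀ + i) = a + 1 := ⟨n - (b₀ + i) - 1, by omega⟩
        rw [ha, restr_biOp_two_succ hf, hpar (a + 1) (b₀ + i) (by omega),
          hcast (a + 1) (b₀ + i) (by omega)]
        rcases hhigh with h | h | h
        · omega
        · rw [h]; simp
        · rw [show n - (b₀ + i + 1) = a by omega] at h; rw [h]; simp
    rw [key, map_smul, smul_eq_mul]
    linear_combination (-(normScalar k n l b₀ (s * ε) i) * ((-1) ^ (b₀ + i) *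
      (n - (b₀ + i : ℕ) + 1 / 2 + k l + k (l + 1))) *
        μ (spinorCoeff (expo l 0 (n - (b₀ + i)) (b₀ + i)) f)) * hs
  · have hi' : i + 1 < d + 1 := by omega
    rw [endY_lt _ _ _ _ _ hi', coords_apply, coords_apply, hθ i (by omega), hφ i (by omega)]
    obtain ⟨a, ha⟩ : ∃ a, n - (b₀ + i) = a + 1 := ⟨n - (b₀ + i) - 1, by omega⟩
    have ha' : n - (b₀ + (i + 1)) = a := by omega
    have hab : n - b₀ - i = a + 1 := by omega
    have hb := Complex.ofReal_ne_zero.2 (hne i (by omega))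
    rw [hab] at hb
    rw [ha, ha', hab, restr_biOp_two_succ hf, map_sub, map_smul, map_smul, hμ, smul_eq_mul,
      smul_eq_mul, hpar (a + 1) (b₀ + i) (by omega), hcast (a + 1) (b₀ + i) (by omega),
      ← add_assoc b₀ i 1, hpar a (b₀ + i + 1) (by omega)]
    have hs0 : s ≠ 0 := by rintro rfl; simp at hss
    have hε0 : ε ≠ 0 := by rintro rfl; simp at hε
    have h2 : ((-1 : ℂ)) ^ (b₀ + i) ≠ 0 := pow_ne_zero _ (by norm_num)
    have h3 : ((-1 : ℂ)) ^ (b₀ + i) * (-1) ^ (b₀ + i) = 1 := by rw [← mul_pow]; simp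
    have hN : normScalar k n l b₀ (s * ε) i = normScalar k n l b₀ (s * ε) (i + 1) *
        (s * ε * (-1) ^ (b₀ + i) * I * bracket (k (l + 1)) (a + 1)) := by
      rw [normScalar, hab, div_mul_cancel₀]
      exact mul_ne_zero (mul_ne_zero (mul_ne_zero (mul_ne_zero hs0 hε0) h2) I_ne_zero) hb
    -- All signs cancel here, by s s' = -1, ε² = 1 and i² = -1.
    have hprod : s' * (s * ε * (-1) ^ (b₀ + i) * I * bracket (k (l + 1)) (a + 1)) * I * ε
        * (-1) ^ (b₀ + i) = bracket (k (l + 1)) (a + 1) := by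
      have : s' * (s * ε * (-1) ^ (b₀ + i) * I * bracket (k (l + 1)) (a + 1)) * I * ε
        * (-1) ^ (b₀ + i) = (s * s') * ε ^ 2 * ((-1) ^ (b₀ + i) * (-1) ^ (b₀ + i)) * (I * I) *
          bracket (k (l + 1)) (a + 1) := by ring
      rw [this, hss, hε, h3, Complex.I_mul_I]; ring
    rw [pow_succ]
    generalize hW : s * ε * (-1) ^ (b₀ + i) * I * (bracket (k (l + 1)) (a + 1) : ℂ) = W at *
    generalize normScalar k n l b₀ (s * ε) i = N₀ at *
    generalize normScalar k n l b₀ (s * ε) (i + 1) = N₁ at *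
    generalize μ (spinorCoeff (expo l 0 a (b₀ + i + 1)) f) = v
    generalize μ (spinorCoeff (expo l 0 (a + 1) (b₀ + i)) f) = u
    generalize (bracket (k (l + 2)) (b₀ + i + 1) : ℂ) = B
    linear_combination (-((-1) ^ (b₀ + i) * (n - (b₀ + i : ℕ) + 1 / 2 + k l + k (l + 1))) * N₀ * u
      - N₁ * B * v * W * (-1) ^ (b₀ + i) * I * ε) * hs + ((-1) ^ (b₀ + i) * I * B * ε * v) * hN
      + N₁ * B * v * s' * hprod

end

/-! ### Homomorphisms into twisted bidiagonal modules -/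

section

section Twisted

/-- The automorphism `ψ` maps the three generators starting at `m` to `X, Y, Z` with the signs
`s, s', s s'`. -/
structure SignedShift (ψ : BI ≃ₐ[ℂ] BI) (l : Fin 3) (s s' : ℂ) : Prop where
  one : ψ (BI.gen (l + 1)) = s • BI.gen 0
  two : ψ (BI.gen (l + 2)) = s' • BI.gen 1
  zero : ψ (BI.gen l) = (s * s') • BI.gen 2

variable {N V : Type*} [AddCommGroup N] [Module BI N] [Module ℂ N] [IsScalarTower ℂ BI N]
  [AddCommGroup V] [Module BI V] [Module ℂ V] [IsScalarTower ℂ BI V]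

/-- A map into the coordinate space that is compatible with two of the generators is a
homomorphism, provided that the third one is determined by the same scalar. -/
theorem exists_hom_twist {d : ℕ} {a b κ κ' : ℂ} {φ : ℕ → ℂ} (S : SplitModel V d a b φ κ)
    {ψ : BI ≃ₐ[ℂ] BI} {l : Fin 3} {s s' : ℂ} (hψ : SignedShift ψ l s s')
    (hκ' : κ' = s * s' * κ)
    (hN : ∀ f : N, BI.gen (l + 1) • BI.gen (l + 2) • f + BI.gen (l + 2) • BI.gen (l + 1) • f
      - BI.gen l • f = κ' • f)
    (r : N →ₗ[ℂ] (Fin (d + 1) → ℂ))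
    (h1 : ∀ f, r (BI.gen (l + 1) • f) = s • endX d a (r f))
    (h2 : ∀ f, r (BI.gen (l + 2) • f) = s' • endY d b φ (r f)) :
    ∃ F : N →ₗ[BI] Twist ψ V, ∀ f, S.equiv (F f) = r f := by
  -- The anticommutator relation determines the third generator on both sides; the twist multiplies
  -- its scalar by s s'.
  have h0 : ∀ f, r (BI.gen l • f) = (s * s') • biTriple (endX d a) (endY d b φ) κ 2 (r f) := by
    intro f
    have h := congrArg r (hN f)
    simp only [map_sub, map_add, h1, h2, map_smul] at h
    have h' : r (BI.gen l • f) = s • s' • endX d a (endY d b φ (r f))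
        + s' • s • endY d b φ (endX d a (r f)) - κ' • r f := by rw [← h]; abel
    rw [h', hκ']
    show _ = (s * s') • ((endX d a * endY d b φ + endY d b φ * endX d a - κ • 1) (r f))
    simp only [LinearMap.add_apply, LinearMap.sub_apply, Module.End.mul_apply,
      LinearMap.smul_apply, Module.End.one_apply]
    module
  have hg : ∀ (i : Fin 3) (t : ℂ) (i' : Fin 3) (f : N), ψ (BI.gen i) = t • BI.gen i' →
      r (BI.gen i • f) = t • biTriple (endX d a) (endY d b φ) κ i' (r f) →
      S.equiv.symm (r (BI.gen i • f)) = (ψ (BI.gen i)) • S.equiv.symm (r f) := by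
    intro i t i' f hi hr
    rw [hi, smul_assoc, hr, LinearEquiv.symm_apply_eq, map_smul, S.gen_smul,
      LinearEquiv.apply_symm_apply]
  let F : N →ₗ[ℂ] Twist ψ V := S.equiv.symm.toLinearMap ∘ₗ r
  have hF : ∀ i m, F (BI.gen i • m) = BI.gen i • F m := by
    intro i m
    have h : ∀ i, i = l ∨ i = l + 1 ∨ i = l + 2 := by fin_cases l <;> decide
    rcases h i with rfl | rfl | rfl
    · exact hg _ _ 2 m hψ.zero (h0 m)
    · exact hg _ _ 0 m hψ.one (h1 m)
    · exact hg _ _ 1 m hψ.two (h2 m)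
  exact ⟨linearMapOfGen F hF, fun f => S.equiv.apply_symm_apply (r f)⟩

end Twisted

variable {k : Fin 3 → ℝ} {n : ℕ}

/-- The two components are the coordinates along the eigenlines ε = 1 and ε = -1 of σ_l on the strip
b₀ ≤ b ≤ b₀ + d. The two eigenfunctionals together are bijective on ℂ², which turns vanishing and
prescription of coefficients into statements about kernel and image. -/
theorem exists_hom_of_coords {V : Type*} [AddCommGroup V] [Module BI V] [Module ℂ V]
    [IsScalarTower ℂ BI V] (hn : Even n) (N : Submodule BI (DunklSpace k))
    (hN : N ≤ monogenics k n) {l : Fin 3} {b₀ d : ℕ} (hbd : b₀ + d ≤ n)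
    (hlow : ∀ f ∈ N, b₀ = 0 ∨ bracket (k (l + 1)) (n - b₀ + 1) = 0 ∨
      spinorCoeff (expo l 0 (n - b₀ + 1) (b₀ - 1)) f = 0)
    (hhigh : ∀ f ∈ N, b₀ + d = n ∨ bracket (k (l + 2)) (b₀ + d + 1) = 0 ∨
      spinorCoeff (expo l 0 (n - (b₀ + d + 1)) (b₀ + d + 1)) f = 0)
    (hne : ∀ i < d, bracket (k (l + 1)) (n - b₀ - i) ≠ 0)
    {s s' a b κ : ℂ} {φ : ℕ → ℂ} (hs : s ^ 2 = 1) (hss : s * s' = -1)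
    (S : SplitModel V d a b φ κ) {ψ : BI ≃ₐ[ℂ] BI} (hψ : SignedShift ψ l s s')
    (ha : ∀ i ≤ d, biTheta d a i
      = s * ((-1) ^ (b₀ + i) * ((b₀ + i : ℕ) + 1 / 2 + k l + k (l + 2))))
    (hb : ∀ i ≤ d, biTheta d b i
      = s' * ((-1) ^ (b₀ + i) * (n - (b₀ + i : ℕ) + 1 / 2 + k l + k (l + 1))))
    (hφ : ∀ i < d, φ (i + 1)
      = bracket (k (l + 1)) (n - b₀ - i) * bracket (k (l + 2)) (b₀ + i + 1))
    (hκ : κ = -(2 * k (l + 1) * k (l + 2) + 2 * k l * (k 0 + k 1 + k 2 + n + 1))) :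
    ∃ F : N →ₗ[BI] Twist ψ V × Twist ψ V,
      (∀ f : N, F f = 0 ↔
        ∀ i ≤ d, spinorCoeff (expo l 0 (n - (b₀ + i)) (b₀ + i)) (f : DunklSpace k) = 0) ∧
      ((∀ g : ℕ → Fin 2 → ℂ, ∃ f ∈ N, ∀ i ≤ d,
        spinorCoeff (expo l 0 (n - (b₀ + i)) (b₀ + i)) f = g i) → Function.Surjective F) := by
  obtain ⟨μ, hμ, hμ0, hμs⟩ := exists_sigma_eigen l
  have hs' : s' ^ 2 = 1 := by
    have : (s * s') ^ 2 = 1 := by rw [hss]; norm_num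
    rwa [mul_pow, hs, one_mul] at this
  have hs0 : s ≠ 0 := by rintro rfl; simp at hs
  let ι : N →ₗ[ℂ] SpinorPoly := N.subtype.restrictScalars ℂ
  have hgen : ∀ (i : Fin 3) (f : N), ι (BI.gen i • f) = biOp k i (ι f) := fun i f =>
    gen_smul_dunklSpace k i _
  obtain ⟨q1, q2, q3, q4⟩ := fin3_add l
  have hcomm : ∀ f : N, BI.gen (l + 1) • BI.gen (l + 2) • f
      + BI.gen (l + 2) • BI.gen (l + 1) • f - BI.gen l • f
      = (2 * k (l + 1) * k (l + 2) + 2 * k l * (k 0 + k 1 + k 2 + n + 1) : ℂ) • f := by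
    intro f
    have hι : Function.Injective ι := Subtype.val_injective
    apply hι
    have h := anticomm_monogenics (hN f.2) hn (l + 1)
    rw [q1, q2] at h
    simp only [map_sub, map_add, map_smul, hgen]
    exact h
  have main : ∀ ε : ℂ, ε ^ 2 = 1 → ∃ F : N →ₗ[BI] Twist ψ V, ∀ f,
      S.equiv (F f) = coords k n l b₀ d (s * ε) (μ ε) (ι f) := by
    intro ε hε
    refine exists_hom_twist S hψ (κ' := _) ?_ hcomm (coords k n l b₀ d (s * ε) (μ ε) ∘ₗ ι)
      (fun f => ?_) (fun f => ?_)
    · rw [hss, hκ]; ring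
    · rw [LinearMap.comp_apply, hgen]
      exact coords_biOp_one (hN f.2) hbd (hlow f f.2) hne hs hε ha fun v => hμ ε v hε
    · rw [LinearMap.comp_apply, hgen]
      exact coords_biOp_two (hN f.2) hn hbd (hhigh f f.2) hne hs' hss hε hb hφ fun v => hμ ε v hε
  obtain ⟨F, hF⟩ := main 1 (by norm_num)
  obtain ⟨G, hG⟩ := main (-1) (by norm_num)
  have hnorm : ∀ ε : ℂ, ε ^ 2 = 1 → ∀ i ≤ d, normScalar k n l b₀ (s * ε) i ≠ 0 := by
    intro ε hε i hi
    have hε0 : ε ≠ 0 := by rintro rfl; simp at hε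
    exact normScalar_ne_zero (mul_ne_zero hs0 hε0) hne i hi
  refine ⟨F.prod G, fun f => ?_, fun h => ?_⟩
  · have e1 : F f = 0 ↔ coords k n l b₀ d (s * 1) (μ 1) (ι f) = 0 := by
      rw [← hF]; exact (S.equiv.map_eq_zero_iff (x := (F f))).symm
    have e2 : G f = 0 ↔ coords k n l b₀ d (s * (-1)) (μ (-1)) (ι f) = 0 := by
      rw [← hG]; exact (S.equiv.map_eq_zero_iff (x := (G f))).symm
    rw [LinearMap.prod_apply, Function.prod_apply, Prod.mk_eq_zero, e1, e2]
    constructor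
    · rintro ⟨h1, h2⟩ i hi
      have h1 := congrFun h1 ⟨i, by omega⟩
      have h2 := congrFun h2 ⟨i, by omega⟩
      rw [coords_apply] at h1 h2
      exact hμ0 _ ((mul_eq_zero.1 h1).resolve_left (hnorm 1 (by norm_num) i hi))
        ((mul_eq_zero.1 h2).resolve_left (hnorm (-1) (by norm_num) i hi))
    · intro h
      constructor <;>
      · funext ⟨i, hi⟩
        rw [coords_apply]
        have := h i (by omega)
        erw [this]
        simp
  · rintro ⟨y, z⟩
    -- The coefficient vectors whose two components, after normalization, are the given coordinates.
    choose g hg1 hg2 using fun i : ℕ =>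
      hμs ((if h : i < d + 1 then S.equiv y ⟨i, h⟩ else 0) / normScalar k n l b₀ (s * 1) i)
        ((if h : i < d + 1 then S.equiv z ⟨i, h⟩ else 0) / normScalar k n l b₀ (s * (-1)) i)
    obtain ⟨f, hf, hfg⟩ := h g
    refine ⟨⟨f, hf⟩, Prod.ext (S.equiv.injective ?_) (S.equiv.injective ?_)⟩
    · refine (hF ⟨f, hf⟩).trans ?_
      funext ⟨i, hi⟩
      rw [coords_apply]
      have h1 : spinorCoeff (expo l 0 (n - (b₀ + i)) (b₀ + i)) (ι ⟨f, hf⟩) = g i := hfg i (by omega)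
      rw [h1, hg1, dif_pos hi, mul_div_cancel₀]
      exact hnorm 1 (by norm_num) i (by omega)
    · refine (hG ⟨f, hf⟩).trans ?_
      funext ⟨i, hi⟩
      rw [coords_apply]
      have h1 : spinorCoeff (expo l 0 (n - (b₀ + i)) (b₀ + i)) (ι ⟨f, hf⟩) = g i := hfg i (by omega)
      rw [h1, hg2, dif_pos hi, mul_div_cancel₀]
      exact hnorm (-1) (by norm_num) i (by omega)

end

/-! ### The submodule ℳₙ(x_j) and the quotient seen on the plane -/

section

variable {k : Fin 3 → ℝ} {n : ℕ}

theorem monogenics_eq_zero {f : SpinorPoly} (hf : (show DunklSpace k from f) ∈ monogenics k n)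
    {l : Fin 3} (hl : (n : ℕ∞) < tIndex (k l))
    (h : ∀ b ≤ n, spinorCoeff (expo l 0 (n - b) b) f = 0) : f = 0 := by
  refine spinor_eq_zero fun m => ?_
  rw [eq_expo l m]
  refine monogenics_coeff_eq_zero hf hl (U := fun _ _ => True) (fun _ _ _ => Or.inr trivial)
    (fun _ _ _ => Or.inr trivial) (fun a b _ => ?_) _ _ _ trivial
  by_cases hab : a + b = n
  · have := h b (by omega)
    rwa [show n - b = a by omega] at this
  · exact (mem_monogenics_iff.1 hf).1 _ (by rw [expo_degree]; omega)

/-- Divisibility by x_{l+2}^t can be tested on the plane: b < t is preserved by raising exponents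
except from t - 1 to t, where the factor [t] is zero. -/
theorem mem_monogenicsDiv_two_iff {f : SpinorPoly} {l : Fin 3} {t : ℕ}
    (ht : Odd t) (htn : t ≤ n) (hk : 2 * k (l + 2) = -(t : ℝ))
    (hl : (n : ℕ∞) < tIndex (k l)) :
    (show DunklSpace k from f) ∈ monogenicsDiv k n (l + 2) ↔
      (show DunklSpace k from f) ∈ monogenics k n ∧
        ∀ b < t, spinorCoeff (expo l 0 (n - b) b) f = 0 := by
  rw [mem_monogenicsDiv_iff, tIndex_eq_of_odd ht hk]
  refine and_congr_right fun hf => ⟨fun h b hb => h _ ?_, fun h m hm => ?_⟩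
  · rw [(expo_apply l 0 (n - b) b).2.2]; exact_mod_cast hb
  · rw [eq_expo l m]
    refine monogenics_coeff_eq_zero hf hl (U := fun _ b => b < t) (fun _ _ hb => Or.inr hb)
      (fun _ b hb => ?_) (fun a b hb => ?_) _ _ _ (by exact_mod_cast hm)
    · by_cases hb' : b + 1 < t
      · exact Or.inr hb'
      · left
        rw [show b + 1 = t by omega]
        exact bracket_eq_zero ht hk
    · by_cases hab : a + b = n
      · have := h b hb
        rwa [show n - b = a by omega] at this
      · exact (mem_monogenics_iff.1 hf).1 _ (by rw [expo_degree]; omega)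

/-- The same for x_{l+1}. On the plane a = n - b, so a < t reads b > n - t. -/
theorem mem_monogenicsDiv_one_iff {f : SpinorPoly} {l : Fin 3} {t : ℕ}
    (ht : Odd t) (htn : t ≤ n) (hk : 2 * k (l + 1) = -(t : ℝ))
    (hl : (n : ℕ∞) < tIndex (k l)) :
    (show DunklSpace k from f) ∈ monogenicsDiv k n (l + 1) ↔
      (show DunklSpace k from f) ∈ monogenics k n ∧
        ∀ b ≤ n, n - t < b → spinorCoeff (expo l 0 (n - b) b) f = 0 := by
  rw [mem_monogenicsDiv_iff, tIndex_eq_of_odd ht hk]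
  refine and_congr_right fun hf => ⟨fun h b hb hb' => h _ ?_, fun h m hm => ?_⟩
  · rw [(expo_apply l 0 (n - b) b).2.1]
    exact_mod_cast (show n - b < t by omega)
  · rw [eq_expo l m]
    refine monogenics_coeff_eq_zero hf hl (U := fun a _ => a < t) (fun a _ ha => ?_)
      (fun _ _ ha => Or.inr ha) (fun a b ha => ?_) _ _ _ (by exact_mod_cast hm)
    · by_cases ha' : a + 1 < t
      · exact Or.inr ha'
      · left
        rw [show a + 1 = t by omega]
        exact bracket_eq_zero ht hk
    · by_cases hab : a + b = n
      · have := h b (by omega) (by omega)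
        rwa [show n - b = a by omega] at this
      · exact (mem_monogenics_iff.1 hf).1 _ (by rw [expo_degree]; omega)

theorem multiplicity_eq {κ : ℝ} {t : ℕ} (hk : 2 * κ = -(t : ℝ)) : (κ : ℂ) = -(t : ℂ) / 2 := by
  have : κ = -(t : ℝ) / 2 := by linarith
  rw [this]; push_cast; ring

theorem bracket_even_cast {κ : ℝ} {m : ℕ} (h : Even m) : (bracket κ m : ℂ) = m := by
  simp [bracket, h.neg_one_pow]

theorem bracket_odd_cast {κ : ℝ} {m : ℕ} (h : Odd m) : (bracket κ m : ℂ) = m + 2 * κ := by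
  rw [bracket, h.neg_one_pow]; push_cast; ring

theorem isTwoCopies_of_bijective {N V : Type*} [AddCommGroup N] [Module BI N] [AddCommGroup V]
    [Module BI V] (F : N →ₗ[BI] V × V) (h0 : ∀ f, F f = 0 → f = 0)
    (hs : Function.Surjective F) : IsTwoCopies N V :=
  ⟨LinearEquiv.ofBijective F ⟨(injective_iff_map_eq_zero F).2 h0, hs⟩⟩

theorem isTwoCopies_quot {M V : Type*} [AddCommGroup M] [Module BI M] [AddCommGroup V]
    [Module BI V] (P Q : Submodule BI M) (F : P →ₗ[BI] V × V)
    (h0 : ∀ f : P, F f = 0 ↔ (f : M) ∈ Q)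
    (hs : Function.Surjective F) : IsTwoCopies (P ⧸ Q.submoduleOf P) V := by
  have hk : Q.submoduleOf P = LinearMap.ker F := by
    ext f
    rw [LinearMap.mem_ker, h0]
    exact Iff.rfl
  exact ⟨(Submodule.quotEquivOfEq _ _ hk).trans (F.quotKerEquivOfSurjective hs)⟩

/-! ### Two copies, for the coordinate x_{l+2} -/

section FormOne

variable {l : Fin 3} {t : ℕ} (hn : Even n) (ht : Odd t) (htn : t ≤ n)
  (hk : 2 * k (l + 2) = -(t : ℝ)) (hl : (n : ℕ∞) < tIndex (k l))
  (hl1 : (n : ℕ∞) < tIndex (k (l + 1)))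
include hn ht htn hk hl hl1

/-- The strip is t ≤ b ≤ n; the coefficients below it vanish on the submodule. In φ_{i+1} =
[n-t-i][t+i+1] the two arguments have the odd sum n + 1, so exactly one bracket involves a
multiplicity, which accounts for the two cases in `phiE`. -/
theorem div_isTwoCopies_one {ψ : BI ≃ₐ[ℂ] BI} (hψ : SignedShift ψ l (-1) 1) {a b c : ℂ}
    (ha : a = k l + (n + 1) / 2) (hb : b = -(k 0 + k 1 + k 2) - (n + 1) / 2)
    (hc : c = -k (l + 1) - (n + 1) / 2) (hd : Odd (n - t)) :
    IsTwoCopies (monogenicsDiv k n (l + 2)) (Twist ψ (ModE (n - t) hd a b c)) := by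
  have hK : (k 0 + k 1 + k 2 : ℂ) = k l + k (l + 1) + k (l + 2) := by
    rw [← fin3_sum l (fun i => (k i : ℂ)), Fin.sum_univ_three]
  have hk' := multiplicity_eq hk
  have hdc : ((n - t : ℕ) : ℂ) = n - t := Nat.cast_sub htn
  obtain ⟨F, hF, hFs⟩ := exists_hom_of_coords (l := l) (b₀ := t) (d := n - t) (s := -1) (s' := 1) hn
    (monogenicsDiv k n (l + 2)) inf_le_left (by omega)
    (fun f hf => Or.inr (Or.inr (by
      have h := ((mem_monogenicsDiv_two_iff ht htn hk hl).1 hf).2 (t - 1) (by have := ht.pos; omega)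
      rwa [show n - (t - 1) = n - t + 1 by have := ht.pos; omega] at h)))
    (fun f hf => Or.inl (by omega))
    -- The subdiagonal uses brackets of k_{l+1}; this is where n < t_{l+1} enters.
    (fun i hi => bracket_ne_zero_of_lt hl1 (by omega) (by omega))
    (by norm_num) (by norm_num) (splitModelE (n - t) hd a b c) hψ
    (fun i hi => by
      rw [biTheta, pow_add, ht.neg_one_pow, hdc, ha, hk']; push_cast; ring)
    (fun i hi => by
      rw [biTheta, pow_add, ht.neg_one_pow, hdc, hb, hK, hk']; push_cast; ring)
    (fun i hi => by
      have hcast : ((n - t - i : ℕ) : ℂ) = n - t - i := by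
        rw [Nat.cast_sub (by omega), hdc]
      have hKb : b = -(k l + k (l + 1) + k (l + 2)) - (n + 1) / 2 := by rw [hb, hK]
      rcases Nat.even_or_odd i with he | ho
      · have h1 : Odd (n - t - i) := Nat.Odd.sub_even (by omega) hd he
        have h2 : Even (t + i + 1) := (ht.add_even he).add_one
        rw [bracket_odd_cast h1, bracket_even_cast h2, phiE,
          if_neg (Nat.not_even_iff_odd.2 he.add_one), hcast, hdc, ha, hKb, hc, hk']
        push_cast; ring
      · have h1 : Even (n - t - i) := Nat.Odd.sub_odd hd ho
        have h2 : Odd (t + i + 1) := (ht.add_odd ho).add_one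
        rw [bracket_even_cast h1, bracket_odd_cast h2, phiE,
          if_pos ho.add_one, hcast, hdc, hk']
        push_cast; ring)
    (by rw [ha, hb, hc, hdc, hK, hk']; ring)
  refine isTwoCopies_of_bijective F (fun f hf => ?_) (hFs fun g => ?_)
  · have h := (hF f).1 hf
    have h' := (mem_monogenicsDiv_two_iff ht htn hk hl).1 f.2
    refine Subtype.ext (monogenics_eq_zero h'.1 hl fun b hb => ?_)
    by_cases hbt : b < t
    · exact h'.2 b hbt
    · have := h (b - t) (by omega)
      rwa [show t + (b - t) = b by omega] at this
  -- Extending the values by zero below the strip puts the monogenic extension into the submodule.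
  · obtain ⟨f, hf, hfg⟩ := exists_monogenic hl (fun b => if b < t then 0 else g (b - t))
    refine ⟨f, (mem_monogenicsDiv_two_iff ht htn hk hl).2 ⟨hf, fun b hb => ?_⟩, fun i hi => ?_⟩
    · rw [hfg _ _ (by omega), if_pos hb]
    · refine (hfg _ _ (by omega)).trans ?_
      rw [if_neg (by omega), Nat.add_sub_cancel_left]

/-- The strip is 0 ≤ b < t on all of ℳₙ. It is closed because [t] = 0 cuts the entry from b = t, and
the kernel of its coordinates is ℳₙ(x_{l+2}). -/
theorem quot_isTwoCopies_one {ψ : BI ≃ₐ[ℂ] BI} (hψ : SignedShift ψ l 1 (-1)) {a b c : ℂ}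
    (ha : a = k l) (hb : b = -(k 0 + k 1 + k 2) - n - 1)
    (hc : c = -k (l + 1)) (hd : Even (t - 1)) :
    IsTwoCopies (MonogenicsQuot k n (l + 2)) (Twist ψ (ModO (t - 1) hd a b c)) := by
  have hK : (k 0 + k 1 + k 2 : ℂ) = k l + k (l + 1) + k (l + 2) := by
    rw [← fin3_sum l (fun i => (k i : ℂ)), Fin.sum_univ_three]
  have hk' := multiplicity_eq hk
  have hpos := ht.pos
  have hdc : ((t - 1 : ℕ) : ℂ) = t - 1 := by rw [Nat.cast_sub (by omega)]; simp
  obtain ⟨F, hF, hFs⟩ := exists_hom_of_coords (l := l) (b₀ := 0) (d := t - 1) (s := 1) (s' := -1) hn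
    (monogenics k n) le_rfl (by omega)
    (fun f hf => Or.inl rfl)
    (fun f hf => Or.inr (Or.inl (by
      rw [show 0 + (t - 1) + 1 = t by omega]; exact bracket_eq_zero ht hk)))
    (fun i hi => bracket_ne_zero_of_lt hl1 (by omega) (by omega))
    (by norm_num) (by norm_num) (splitModelO (t - 1) hd a b c) hψ
    (fun i hi => by
      rw [biTheta, hdc, ha, hk']; push_cast; ring)
    (fun i hi => by
      rw [biTheta, hdc, hb, hK, hk']; push_cast; ring)
    (fun i hi => by
      have hcast : ((n - 0 - i : ℕ) : ℂ) = n - i := by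
        rw [Nat.cast_sub (by omega)]; simp
      have hKb : b = -(k l + k (l + 1) + k (l + 2)) - n - 1 := by rw [hb, hK]
      rcases Nat.even_or_odd i with he | ho
      · have h1 : Even (n - 0 - i) := (Nat.even_sub (by omega)).2 (iff_of_true hn he)
        have h2 : Odd (0 + i + 1) := by rw [zero_add]; exact he.add_one
        rw [bracket_even_cast h1, bracket_odd_cast h2, phiO,
          if_neg (Nat.not_even_iff_odd.2 he.add_one), hcast, hdc, ha, hKb, hc, hk']
        push_cast; ring
      · have h1 : Odd (n - 0 - i) := Nat.Even.sub_odd (by omega) hn ho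
        have h2 : Even (0 + i + 1) := by rw [zero_add]; exact ho.add_one
        rw [bracket_odd_cast h1, bracket_even_cast h2, phiO,
          if_pos ho.add_one, hcast, hdc, ha, hKb, hc, hk']
        push_cast; ring)
    (by rw [ha, hb, hc, hdc, hK, hk']; ring)
  refine isTwoCopies_quot _ _ F (fun f => ?_) (hFs fun g => ?_)
  · rw [hF]
    refine Iff.trans ?_ (mem_monogenicsDiv_two_iff ht htn hk hl).symm
    refine ⟨fun h => ⟨f.2, fun b hb => ?_⟩, fun h i hi => ?_⟩
    · have := h b (by omega)
      rwa [zero_add] at this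
    · rw [zero_add]; exact h.2 i (by omega)
  · obtain ⟨f, hf, hfg⟩ := exists_monogenic hl g
    exact ⟨f, hf, fun i hi => (hfg _ _ (by omega)).trans (by rw [zero_add])⟩

end FormOne

/-! ### Two copies, for the coordinate x_{l+1} -/

section FormTwo

variable {l : Fin 3} {t : ℕ} (hn : Even n) (ht : Odd t) (htn : t ≤ n)
  (hk : 2 * k (l + 1) = -(t : ℝ)) (hl : (n : ℕ∞) < tIndex (k l))
include hn ht htn hk hl

/-- The strip is 0 ≤ b ≤ n - t. Its purpose is to describe the module of `div_isTwoCopies_one`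
again, on another plane, where the generator not yet diagonalized becomes bidiagonal. -/
theorem div_isTwoCopies_two {ψ : BI ≃ₐ[ℂ] BI} (hψ : SignedShift ψ l 1 (-1)) {a b c : ℂ}
    (ha : a = (k 0 + k 1 + k 2) + (n + 1) / 2) (hb : b = -k l - (n + 1) / 2)
    (hc : c = -k (l + 2) - (n + 1) / 2) (hd : Odd (n - t)) :
    IsTwoCopies (monogenicsDiv k n (l + 1)) (Twist ψ (ModE (n - t) hd a b c)) := by
  have hK : (k 0 + k 1 + k 2 : ℂ) = k l + k (l + 1) + k (l + 2) := by
    rw [← fin3_sum l (fun i => (k i : ℂ)), Fin.sum_univ_three]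
  have hk' := multiplicity_eq hk
  have hpos := ht.pos
  have hdc : ((n - t : ℕ) : ℂ) = n - t := Nat.cast_sub htn
  obtain ⟨F, hF, hFs⟩ := exists_hom_of_coords (l := l) (b₀ := 0) (d := n - t) (s := 1) (s' := -1) hn
    (monogenicsDiv k n (l + 1)) inf_le_left (by omega)
    (fun f hf => Or.inl rfl)
    (fun f hf => Or.inr (Or.inr
      (((mem_monogenicsDiv_one_iff ht htn hk hl).1 hf).2 _ (by omega) (by omega))))
    -- The arguments n - i exceed t, the only positive zero of this bracket.
    (fun i hi => bracket_ne_zero (by omega) (by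
      rw [tIndex_eq_of_odd ht hk]
      intro h
      have : t = n - 0 - i := by exact_mod_cast h
      omega))
    (by norm_num) (by norm_num) (splitModelE (n - t) hd a b c) hψ
    (fun i hi => by
      rw [biTheta, hdc, ha, hK, hk']; push_cast; ring)
    (fun i hi => by
      rw [biTheta, hdc, hb, hk']; push_cast; ring)
    (fun i hi => by
      have hcast : ((n - 0 - i : ℕ) : ℂ) = n - i := by
        rw [Nat.cast_sub (by omega)]; simp
      have hKa : a = (k l + k (l + 1) + k (l + 2)) + (n + 1) / 2 := by rw [ha, hK]
      rcases Nat.even_or_odd i with he | ho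
      · have h1 : Even (n - 0 - i) := (Nat.even_sub (by omega)).2 (iff_of_true hn he)
        have h2 : Odd (0 + i + 1) := by rw [zero_add]; exact he.add_one
        rw [bracket_even_cast h1, bracket_odd_cast h2, phiE,
          if_neg (Nat.not_even_iff_odd.2 he.add_one), hcast, hdc, hKa, hb, hc, hk']
        push_cast; ring
      · have h1 : Odd (n - 0 - i) := Nat.Even.sub_odd (by omega) hn ho
        have h2 : Even (0 + i + 1) := by rw [zero_add]; exact ho.add_one
        rw [bracket_odd_cast h1, bracket_even_cast h2, phiE,
          if_pos ho.add_one, hcast, hdc, hk']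
        push_cast; ring)
    (by rw [ha, hb, hc, hdc, hK, hk']; ring)
  refine isTwoCopies_of_bijective F (fun f hf => ?_) (hFs fun g => ?_)
  · have h := (hF f).1 hf
    have h' := (mem_monogenicsDiv_one_iff ht htn hk hl).1 f.2
    refine Subtype.ext (monogenics_eq_zero h'.1 hl fun b hb => ?_)
    by_cases hbt : n - t < b
    · exact h'.2 b hb hbt
    · have := h b (by omega)
      rwa [zero_add] at this
  · obtain ⟨f, hf, hfg⟩ := exists_monogenic hl (fun b => if n - t < b then 0 else g b)
    refine ⟨f, (mem_monogenicsDiv_one_iff ht htn hk hl).2 ⟨hf, fun b hb hb' => ?_⟩, fun i hi => ?_⟩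
    · rw [hfg _ _ (by omega), if_pos hb']
    · refine (hfg _ _ (by omega)).trans ?_
      rw [if_neg (by omega), zero_add]

/-- The strip is n - t < b ≤ n. The entry from b = n - t carries the factor [t] = 0 and so
disappears on all of ℳₙ. -/
theorem quot_isTwoCopies_two {ψ : BI ≃ₐ[ℂ] BI} (hψ : SignedShift ψ l 1 (-1)) {a b c : ℂ}
    (ha : a = (k 0 + k 1 + k 2) + n + 1) (hb : b = -k l)
    (hc : c = -k (l + 2)) (hd : Even (t - 1)) :
    IsTwoCopies (MonogenicsQuot k n (l + 1)) (Twist ψ (ModO (t - 1) hd a b c)) := by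
  have hK : (k 0 + k 1 + k 2 : ℂ) = k l + k (l + 1) + k (l + 2) := by
    rw [← fin3_sum l (fun i => (k i : ℂ)), Fin.sum_univ_three]
  have hk' := multiplicity_eq hk
  have hpos := ht.pos
  have hdc : ((t - 1 : ℕ) : ℂ) = t - 1 := by rw [Nat.cast_sub (by omega)]; simp
  have hpar : Even (n - t + 1) := (Nat.Even.sub_odd htn hn ht).add_one
  have hbc : ((n - t + 1 : ℕ) : ℂ) = n - t + 1 := by push_cast [Nat.cast_sub htn]; ring
  obtain ⟨F, hF, hFs⟩ := exists_hom_of_coords (l := l) (b₀ := n - t + 1) (d := t - 1) (s := 1)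
    (s' := -1) hn (monogenics k n) le_rfl (by omega)
    (fun f hf => Or.inr (Or.inl (by
      rw [show n - (n - t + 1) + 1 = t by omega]; exact bracket_eq_zero ht hk)))
    (fun f hf => Or.inl (by omega))
    (fun i hi => bracket_ne_zero (by omega) (by
      rw [tIndex_eq_of_odd ht hk]
      intro h
      have : t = n - (n - t + 1) - i := by exact_mod_cast h
      omega))
    (by norm_num) (by norm_num) (splitModelO (t - 1) hd a b c) hψ
    (fun i hi => by
      rw [biTheta, pow_add, hpar.neg_one_pow, Nat.cast_add, hbc, hdc, ha, hK, hk']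
      push_cast; ring)
    (fun i hi => by
      rw [biTheta, pow_add, hpar.neg_one_pow, Nat.cast_add, hbc, hdc, hb, hk']; push_cast; ring)
    (fun i hi => by
      have hcast : ((n - (n - t + 1) - i : ℕ) : ℂ) = t - 1 - i := by
        rw [show n - (n - t + 1) - i = t - 1 - i by omega, Nat.cast_sub (by omega), hdc]
      have hKa : a = (k l + k (l + 1) + k (l + 2)) + n + 1 := by rw [ha, hK]
      have hcast2 : ((n - t + 1 + i + 1 : ℕ) : ℂ) = n - t + 1 + i + 1 := by
        rw [Nat.cast_add, Nat.cast_add, hbc]; simp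
      rcases Nat.even_or_odd i with he | ho
      · have h1 : Even (n - (n - t + 1) - i) := by
          rw [show n - (n - t + 1) - i = t - 1 - i by omega]
          exact (Nat.even_sub (by omega)).2 (iff_of_true hd he)
        have h2 : Odd (n - t + 1 + i + 1) := (hpar.add he).add_one
        rw [bracket_even_cast h1, bracket_odd_cast h2, phiO,
          if_neg (Nat.not_even_iff_odd.2 he.add_one), hcast, hcast2, hdc, hKa, hb, hc, hk']
        push_cast; ring
      · have h1 : Odd (n - (n - t + 1) - i) := by
          rw [show n - (n - t + 1) - i = t - 1 - i by omega]
          exact Nat.Even.sub_odd (by omega) hd ho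
        have h2 : Even (n - t + 1 + i + 1) := (hpar.add_odd ho).add_one
        rw [bracket_odd_cast h1, bracket_even_cast h2, phiO,
          if_pos ho.add_one, hcast, hcast2, hdc, hKa, hb, hc, hk']
        push_cast; ring)
    (by rw [ha, hb, hc, hdc, hK, hk']; ring)
  refine isTwoCopies_quot _ _ F (fun f => ?_) (hFs fun g => ?_)
  · rw [hF]
    refine Iff.trans ?_ (mem_monogenicsDiv_one_iff ht htn hk hl).symm
    refine ⟨fun h => ⟨f.2, fun b hb hb' => ?_⟩, fun h i hi => ?_⟩
    · have := h (b - (n - t + 1)) (by omega)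
      rwa [show n - t + 1 + (b - (n - t + 1)) = b by omega] at this
    · exact h.2 _ (by omega) (by omega)
  · obtain ⟨f, hf, hfg⟩ := exists_monogenic hl (fun b => g (b - (n - t + 1)))
    exact ⟨f, hf, fun i hi => (hfg _ _ (by omega)).trans (by rw [Nat.add_sub_cancel_left])⟩

end FormTwo

end

/-! ### Irreducibility from the two split sequences -/

section Irreducibility

variable {d : ℕ}

/-- The coordinates of a vector, extended by zero. -/
def coordN (i : ℕ) : (Fin (d + 1) → ℂ) →ₗ[ℂ] ℂ :=
  if h : i < d + 1 then LinearMap.proj ⟨i, h⟩ else 0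

theorem coordN_of_lt {i : ℕ} (h : i < d + 1) (y : Fin (d + 1) → ℂ) : coordN i y = y ⟨i, h⟩ := by
  rw [coordN, dif_pos h]; rfl

theorem coordN_of_gt {i : ℕ} (h : d < i) (y : Fin (d + 1) → ℂ) : coordN i y = 0 := by
  rw [coordN, dif_neg (by omega)]; rfl

theorem coordN_ext {y : Fin (d + 1) → ℂ} (h : ∀ i ≤ d, coordN i y = 0) : y = 0 := by
  funext ⟨i, hi⟩
  exact (coordN_of_lt hi y).symm.trans (h i (by omega))

theorem coordN_basisVec (i j : ℕ) (hi : i ≤ d) : coordN i (basisVec d j) = if i = j then 1 else 0 := by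
  rw [coordN_of_lt (by omega)]; rfl

theorem coordN_endX_zero (a : ℂ) (y : Fin (d + 1) → ℂ) :
    coordN 0 (endX d a y) = biTheta d a 0 * coordN 0 y := by
  rw [coordN_of_lt d.succ_pos, coordN_of_lt d.succ_pos, endX_zero]

theorem coordN_endX_succ (a : ℂ) (y : Fin (d + 1) → ℂ) {i : ℕ} (h : i + 1 ≤ d) :
    coordN (i + 1) (endX d a y) = biTheta d a (i + 1) * coordN (i + 1) y + coordN i y := by
  rw [coordN_of_lt (by omega), coordN_of_lt (by omega), coordN_of_lt (by omega), endX_succ]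

theorem coordN_endY (b : ℂ) (φ : ℕ → ℂ) (y : Fin (d + 1) → ℂ) (i : ℕ) :
    coordN i (endY d b φ y) = biTheta d b i * coordN i y + φ (i + 1) * coordN (i + 1) y := by
  rcases lt_trichotomy i d with h | h | h
  · rw [coordN_of_lt (by omega), coordN_of_lt (by omega), coordN_of_lt (by omega), endY_lt]
  · rw [coordN_of_lt (by omega), coordN_of_lt (by omega), coordN_of_gt (by omega),
      endY_last _ _ _ _ _ _ h]
    simp
  · rw [coordN_of_gt h, coordN_of_gt h, coordN_of_gt (by omega)]; simp

/-- The product of `X - θᵢ` over `s ≤ i < s + m`. -/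
noncomputable def prodX (d : ℕ) (a : ℂ) (s : ℕ) : ℕ → Module.End ℂ (Fin (d + 1) → ℂ)
  | 0 => 1
  | m + 1 => (endX d a - biTheta d a (s + m) • 1) * prodX d a s m

theorem prodX_succ_apply (a : ℂ) (s m : ℕ) (y : Fin (d + 1) → ℂ) : prodX d a s (m + 1) y
    = endX d a (prodX d a s m y) - biTheta d a (s + m) • prodX d a s m y := rfl

theorem prodX_mem {a : ℂ} {N : Submodule ℂ (Fin (d + 1) → ℂ)} (hX : ∀ y ∈ N, endX d a y ∈ N)
    (s m : ℕ) {y : Fin (d + 1) → ℂ} (hy : y ∈ N) : prodX d a s m y ∈ N := by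
  induction m with
  | zero => exact hy
  | succ m ih =>
    rw [prodX_succ_apply]
    exact N.sub_mem (hX _ ih) (N.smul_mem _ ih)

/-- X is lower bidiagonal, so each factor X - θ_i clears the first coordinate not yet known to
vanish. -/
theorem coordN_prodX_eq_zero (a : ℂ) (s m : ℕ) {y : Fin (d + 1) → ℂ}
    (hy : ∀ i < s, coordN i y = 0) : ∀ i < s + m, coordN i (prodX d a s m y) = 0 := by
  induction m with
  | zero => exact hy
  | succ m ih =>
    intro i hi
    by_cases hid : d < i
    · exact coordN_of_gt hid _
    rw [prodX_succ_apply, map_sub, map_smul, smul_eq_mul]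
    rcases i with _ | i
    · rw [coordN_endX_zero]
      rcases Nat.eq_zero_or_pos (s + m) with h | h
      · rw [h]; ring
      · rw [ih 0 h]; ring
    · rw [coordN_endX_succ _ _ (by omega), ih i (by omega)]
      by_cases h : i + 1 < s + m
      · rw [ih _ h]; ring
      · rw [show s + m = i + 1 by omega]; ring

/-- The subdiagonal entries are 1, so each factor moves the highest coordinate up by one and keeps
its value. -/
theorem coordN_prodX_top (a : ℂ) (s m r : ℕ) {y : Fin (d + 1) → ℂ}
    (hy : ∀ i, r < i → coordN i y = 0) : (∀ i, r + m < i → coordN i (prodX d a s m y) = 0) ∧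
      (r + m ≤ d → coordN (r + m) (prodX d a s m y) = coordN r y) := by
  induction m with
  | zero => exact ⟨hy, fun _ => rfl⟩
  | succ m ih =>
    refine ⟨fun i hi => ?_, fun h => ?_⟩
    · by_cases hid : d < i
      · exact coordN_of_gt hid _
      obtain ⟨i, rfl⟩ : ∃ i', i = i' + 1 := ⟨i - 1, by omega⟩
      rw [prodX_succ_apply, map_sub, map_smul, coordN_endX_succ _ _ (by omega),
        ih.1 _ (by omega), ih.1 _ (by omega)]
      simp
    · rw [prodX_succ_apply, map_sub, map_smul, ← add_assoc, coordN_endX_succ _ _ (by omega),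
        ih.1 _ (by omega), ih.2 (by omega)]
      simp

/-- This is the coordinate just below the top one, to which the factor X - θ_{s+r} contributes θ_r -
θ_{s+r}. -/
theorem coordN_prodX_basisVec (a : ℂ) (s m : ℕ) (hm : m + 1 ≤ d) :
    coordN m (prodX d a s (m + 1) (basisVec d 0))
      = ∑ r ∈ Finset.range (m + 1), (biTheta d a r - biTheta d a (s + r)) := by
  have h0 : ∀ i, 0 < i → coordN i (basisVec d 0) = 0 := by
    intro i hi
    by_cases hid : d < i
    · exact coordN_of_gt hid _
    · rw [coordN_basisVec _ _ (by omega), if_neg (by omega)]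
  induction m with
  | zero =>
    rw [prodX_succ_apply, map_sub, map_smul, coordN_endX_zero]
    simp [prodX, coordN_basisVec]
  | succ m ih =>
    have h1 := (coordN_prodX_top a s (m + 1) 0 h0).2 (by omega)
    rw [zero_add, coordN_basisVec _ _ (by omega), if_pos rfl] at h1
    rw [prodX_succ_apply, map_sub, map_smul, coordN_endX_succ _ _ (by omega), h1, ih (by omega),
      Finset.sum_range_succ _ (m + 1)]
    simp only [smul_eq_mul]; ring

/-- A criterion for irreducibility in terms of the two split sequences. -/
theorem eq_bot_or_top_of_split {a b : ℂ} {φ : ℕ → ℂ} (hφ : ∀ i < d, φ (i + 1) ≠ 0)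
    (hφ' : ∀ m < d, (biTheta d b m - biTheta d b (m + 1)) *
      ∑ r ∈ Finset.range (m + 1), (biTheta d a r - biTheta d a (d - m + r)) + φ (m + 1) ≠ 0)
    (N : Submodule ℂ (Fin (d + 1) → ℂ)) (hX : ∀ y ∈ N, endX d a y ∈ N)
    (hY : ∀ y ∈ N, endY d b φ y ∈ N) : N = ⊥ ∨ N = ⊤ := by
  classical
  by_cases hN : N = ⊥
  · exact Or.inl hN
  right
  -- The possible positions of the first nonzero coordinate of a vector in N; M below is the largest
  -- of them.
  let p : ℕ → Prop := fun m => ∃ g ∈ N, (∀ i < m, coordN i g = 0) ∧ coordN m g ≠ 0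
  have hp : ∀ g ∈ N, g ≠ 0 → ∃ m, (∀ i < m, coordN i g = 0) ∧ coordN m g ≠ 0 := by
    intro g _ hg0
    have h : ∃ m, coordN m g ≠ 0 := by
      by_contra! h
      exact hg0 (coordN_ext fun i _ => h i)
    exact ⟨Nat.find h, fun i hi => not_not.1 (Nat.find_min h hi), Nat.find_spec h⟩
  have hpd : ∀ m, p m → m ≤ d := by
    rintro m ⟨g, -, -, h⟩
    by_contra hm
    exact h (coordN_of_gt (by omega) g)
  obtain ⟨g, hg, hg0⟩ := N.exists_mem_ne_zero_of_ne_bot hN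
  obtain ⟨m₀, hm₀⟩ := hp g hg hg0
  have hpm₀ : p m₀ := ⟨g, hg, hm₀⟩
  let M := Nat.findGreatest p d
  have hM : p M := Nat.findGreatest_spec (hpd m₀ hpm₀) hpm₀
  have hMmax : ∀ m, p m → m ≤ M := fun m hm => Nat.le_findGreatest (hpd m hm) hm
  have hMd := hpd M hM
  -- Y moves the first nonzero coordinate from m + 1 to m, with the nonzero factor φ_{m+1}.
  have hdown : ∀ m, p (m + 1) → p m := by
    intro m hm
    have hmd := hpd _ hm
    obtain ⟨g, hg, h1, h2⟩ := hm
    refine ⟨_, hY g hg, fun i hi => ?_, ?_⟩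
    · rw [coordN_endY, h1 i (by omega), h1 (i + 1) (by omega)]; ring
    · rw [coordN_endY, h1 m (by omega), mul_zero, zero_add]
      exact mul_ne_zero (hφ m (by omega)) h2
  have hall : ∀ j m, m + j = M → p m := by
    intro j
    induction j with
    | zero => rintro m rfl; exact hM
    | succ j ih => intro m hm; exact hdown m (ih (m + 1) (by omega))
  -- All positions 0, …, M occur, so elimination changes v_0 by an element of N into a vector that
  -- vanishes in the coordinates 0, …, M.
  have happrox : ∀ r ≤ M + 1, ∃ g ∈ N, ∀ i < r, coordN i (basisVec d 0 - g) = 0 := by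
    intro r
    induction r with
    | zero => exact fun _ => ⟨0, N.zero_mem, fun i hi => by omega⟩
    | succ r ih =>
      intro hr
      obtain ⟨g, hg, hgr⟩ := ih (by omega)
      obtain ⟨h, hh, hhr, hh0⟩ := hall (M - r) r (by omega)
      refine ⟨g + (coordN r (basisVec d 0 - g) / coordN r h) • h,
        N.add_mem hg (N.smul_mem _ hh), fun i hi => ?_⟩
      rw [← sub_sub, map_sub, map_smul, smul_eq_mul]
      by_cases hir : i < r
      · rw [hgr i hir, hhr i hir]; ring
      · rw [show i = r by omega, div_mul_cancel₀ _ hh0, sub_self]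
  obtain ⟨g, hg, hgM⟩ := happrox (M + 1) le_rfl
  -- The product of X - θ_i over M < i ≤ d annihilates that remainder; hence its value f at v_0 is
  -- its value at an element of N.
  set f := prodX d a (M + 1) (d - M) (basisVec d 0) with hf
  have hfN : f ∈ N := by
    have h0 : prodX d a (M + 1) (d - M) (basisVec d 0 - g) = 0 :=
      coordN_ext fun i hi => coordN_prodX_eq_zero a _ _ hgM i (by omega)
    rw [map_sub, sub_eq_zero] at h0
    rw [hf, h0]
    exact prodX_mem hX _ _ hg
  have hv0 : ∀ i, 0 < i → coordN i (basisVec d 0) = 0 := by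
    intro i hi
    by_cases hid : d < i
    · exact coordN_of_gt hid _
    · rw [coordN_basisVec _ _ (by omega), if_neg (by omega)]
  have hftop := coordN_prodX_top a (M + 1) (d - M) 0 hv0
  simp only [zero_add] at hftop
  rw [coordN_basisVec _ _ (by omega), if_pos rfl, ← hf] at hftop
  -- If M = d the product is empty, so v_0 is in N and X generates the whole space from it.
  rcases Nat.eq_zero_or_pos (d - M) with hs | hs
  · rw [hs] at hf
    have h0 : basisVec d 0 ∈ N := by
      have : f = basisVec d 0 := hf
      rwa [← this]
    have hb : ∀ i, basisVec d i ∈ N := by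
      intro i
      induction i with
      | zero => exact h0
      | succ i ih =>
        have h1 : endX d a (basisVec d i) = _ := matX_basis d a i
        have h2 := hX _ ih
        rw [h1] at h2
        have := N.sub_mem h2 (N.smul_mem (biTheta d a i) ih)
        rwa [add_sub_cancel_left] at this
    rw [eq_top_iff]
    intro y _
    have hy : y = ∑ i : Fin (d + 1), y i • basisVec d i := by
      funext j
      simp [basisVec, Fin.val_inj]
    rw [hy]
    exact N.sum_mem fun i _ => N.smul_mem _ (hb i)
  · exfalso
    obtain ⟨m, hm⟩ : ∃ m, d - M = m + 1 := ⟨d - M - 1, by omega⟩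
    -- The product of X - θ_i over i ≤ M clears the coordinates up to M but preserves the top
    -- coefficient; a nonzero result would contradict the maximality of M.
    have hlow : ∀ h ∈ N, (∀ i, m < i → coordN i h = 0) → h = 0 := by
      intro h hh hhm
      by_contra hne
      have hex : ∃ r, coordN r h ≠ 0 := by
        by_contra! h'
        exact hne (coordN_ext fun i _ => h' i)
      obtain ⟨r₀, hr₀⟩ := hex
      have hrm : ∀ r, coordN r h ≠ 0 → r ≤ m := fun r hr => by
        by_contra h'
        exact hr (hhm r (by omega))
      let R := Nat.findGreatest (fun r => coordN r h ≠ 0) m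
      have hR : coordN R h ≠ 0 := Nat.findGreatest_spec (P := fun r => coordN r h ≠ 0) (hrm r₀ hr₀) hr₀
      have hRmax : ∀ i, R < i → coordN i h = 0 := by
        intro i hi
        by_contra h'
        exact absurd (Nat.le_findGreatest (P := fun r => coordN r h ≠ 0) (hrm i h') h') (by omega)
      have hRm := hrm R hR
      have h1 := (coordN_prodX_top a 0 (M + 1) R hRmax).2 (by omega)
      have h2 := coordN_prodX_eq_zero a 0 (M + 1) (y := h) (fun i hi => by omega)
      have h3 : prodX d a 0 (M + 1) h ≠ 0 := by
        intro h0
        rw [h0, map_zero] at h1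
        exact hR h1.symm
      have h4 := prodX_mem hX 0 (M + 1) hh
      obtain ⟨q, hq1, hq2⟩ := hp _ h4 h3
      have := hMmax q ⟨_, h4, hq1, hq2⟩
      exact hq2 (h2 q (by omega))
    rw [hm] at hftop
    -- Subtracting θ*_{m+1} f removes the top coordinate of Y f, so the difference falls under
    -- `hlow`. Its coordinate m is the forbidden zero of the second split sequence.
    have hw : endY d b φ f - biTheta d b (m + 1) • f = 0 := by
      refine hlow _ (N.sub_mem (hY f hfN) (N.smul_mem _ hfN)) fun i hi => ?_
      rw [map_sub, map_smul, smul_eq_mul, coordN_endY]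
      by_cases him : i = m + 1
      · rw [him, hftop.1 (m + 1 + 1) (by omega)]; ring
      · rw [hftop.1 i (by omega), hftop.1 (i + 1) (by omega)]; ring
    have hw' := congrArg (coordN m) hw
    rw [map_sub, map_smul, smul_eq_mul, coordN_endY, hftop.2 (by omega), map_zero, hf, hm,
      coordN_prodX_basisVec _ _ _ (by omega), show M + 1 = d - m by omega] at hw'
    refine hφ' m (by omega) ?_
    rw [← hw']; ring

theorem SplitModel.isSimpleModule {M : Type*} [AddCommGroup M] [Module BI M] [Module ℂ M]
    [IsScalarTower ℂ BI M] {a b κ : ℂ} {φ : ℕ → ℂ} (S : SplitModel M d a b φ κ)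
    (hφ : ∀ i < d, φ (i + 1) ≠ 0)
    (hφ' : ∀ m < d, (biTheta d b m - biTheta d b (m + 1)) *
      ∑ r ∈ Finset.range (m + 1), (biTheta d a r - biTheta d a (d - m + r)) + φ (m + 1) ≠ 0) :
    IsSimpleModule BI M := by
  have hnt : Nontrivial M := S.equiv.toEquiv.nontrivial
  have : Nontrivial (Submodule BI M) := (Submodule.nontrivial_iff BI).2 hnt
  refine (isSimpleModule_iff BI M).2 { eq_bot_or_eq_top := fun N => ?_ }
  let N' : Submodule ℂ (Fin (d + 1) → ℂ) :=
    (N.restrictScalars ℂ).map S.equiv.toLinearMap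
  have hst : ∀ i, ∀ y ∈ N', biTriple (endX d a) (endY d b φ) κ i y ∈ N' := by
    rintro i _ ⟨v, hv, rfl⟩
    exact ⟨BI.gen i • v, N.smul_mem _ hv, S.gen_smul i v⟩
  rcases eq_bot_or_top_of_split hφ hφ' N' (hst 0) (hst 1) with h | h
  · left
    rw [Submodule.map_eq_bot_iff] at h
    simp at h
    rw [eq_bot_iff]
    intro v hv
    have : v ∈ N.restrictScalars ℂ := hv
    rw [h] at this
    exact this
  · right
    rw [eq_top_iff]
    intro v _
    have : S.equiv v ∈ N' := h ▸ Submodule.mem_top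
    obtain ⟨w, hw, hwv⟩ := this
    have := S.equiv.injective hwv
    rw [← this]; exact hw

end Irreducibility

/-! ### Annihilating polynomials and extreme eigenvalues -/

section Spectrum

variable {V W : Type*} [AddCommGroup V] [Module ℂ V] [AddCommGroup W] [Module ℂ W]

/-- The polynomial with roots `θ₀, …, θ_d`. -/
noncomputable def thetaPoly (d : ℕ) (a : ℂ) : Polynomial ℂ :=
  ∏ i ∈ Finset.range (d + 1), (Polynomial.X - Polynomial.C (biTheta d a i))

/-- The operator `T` is annihilated by the polynomial with roots `θ₀, …, θ_d`, and `θ_d` is an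
eigenvalue. -/
structure HasSpec (T : Module.End ℂ V) (d : ℕ) (a : ℂ) : Prop where
  annihilates : Polynomial.aeval T (thetaPoly d a) = 0
  top : ∃ v, v ≠ 0 ∧ T v = biTheta d a d • v

theorem aeval_semiconj {T : Module.End ℂ V} {T' : Module.End ℂ W} (e : V →ₗ[ℂ] W)
    (h : ∀ v, e (T v) = T' (e v)) (p : Polynomial ℂ) :
    ∀ v, e (Polynomial.aeval T p v) = Polynomial.aeval T' p (e v) := by
  induction p using Polynomial.induction_on' with
  | add p q hp hq => intro v; simp [hp, hq]
  | monomial m c =>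
    intro v
    simp only [Polynomial.aeval_monomial, Module.End.mul_apply, Module.algebraMap_end_apply,
      map_smul]
    congr 1
    induction m generalizing v with
    | zero => rfl
    | succ m ih => rw [pow_succ, pow_succ, Module.End.mul_apply, Module.End.mul_apply, ih, h]

theorem aeval_eigen {T : Module.End ℂ V} {c : ℂ} {v : V} (h : T v = c • v) (p : Polynomial ℂ) :
    Polynomial.aeval T p v = p.eval c • v := by
  induction p using Polynomial.induction_on' with
  | add p q hp hq => simp [hp, hq, add_smul]
  | monomial m s =>
    simp only [Polynomial.aeval_monomial, Module.End.mul_apply, Module.algebraMap_end_apply,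
      Polynomial.eval_monomial, mul_smul]
    congr 1
    induction m with
    | zero => simp
    | succ m ih => rw [pow_succ', Module.End.mul_apply, ih, map_smul, h, smul_smul, ← pow_succ]

theorem HasSpec.of_injective {T : Module.End ℂ V} {T' : Module.End ℂ W} {d : ℕ} {a : ℂ}
    (hT : HasSpec T' d a) (e : V ≃ₗ[ℂ] W) (h : ∀ v, e (T v) = T' (e v)) : HasSpec T d a := by
  refine ⟨LinearMap.ext fun v => e.injective ?_, ?_⟩
  · have := aeval_semiconj e.toLinearMap h (thetaPoly d a) v
    rw [hT.annihilates] at this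
    simpa using this
  · obtain ⟨w, hw, hw'⟩ := hT.top
    refine ⟨e.symm w, by simpa using hw, e.injective ?_⟩
    rw [h]; simp [hw']

theorem HasSpec.prod {T : Module.End ℂ V} {T' : Module.End ℂ (V × V)} {d : ℕ} {a : ℂ}
    (hT : HasSpec T d a) (h : ∀ v, T' v = (T v.1, T v.2)) : HasSpec T' d a := by
  refine ⟨LinearMap.ext fun v => ?_, ?_⟩
  · have h1 := aeval_semiconj (T := T') (T' := T) (LinearMap.fst ℂ V V)
      (fun v => by rw [h]; rfl) (thetaPoly d a) v
    have h2 := aeval_semiconj (T := T') (T' := T) (LinearMap.snd ℂ V V)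
      (fun v => by rw [h]; rfl) (thetaPoly d a) v
    rw [hT.annihilates] at h1 h2
    exact Prod.ext h1 h2
  · obtain ⟨w, hw, hw'⟩ := hT.top
    exact ⟨(w, 0), by simp [hw], by rw [h]; simp [hw']⟩

theorem HasSpec.of_prod {T : Module.End ℂ V} {T' : Module.End ℂ (V × V)} {d : ℕ} {a : ℂ}
    (hT : HasSpec T' d a) (h : ∀ v, T' v = (T v.1, T v.2)) : HasSpec T d a := by
  refine ⟨LinearMap.ext fun v => ?_, ?_⟩
  · have h1 := aeval_semiconj (T := T') (T' := T) (LinearMap.fst ℂ V V)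
      (fun v => by rw [h]; rfl) (thetaPoly d a) (v, v)
    rw [hT.annihilates] at h1
    exact h1.symm
  · obtain ⟨⟨w, w'⟩, hw, hw'⟩ := hT.top
    rw [h] at hw'
    have h1 := congrArg Prod.fst hw'
    have h2 := congrArg Prod.snd hw'
    by_cases h0 : w = 0
    · refine ⟨w', fun h' => hw ?_, h2⟩
      rw [h0, h']; rfl
    · exact ⟨w, h0, h1⟩

/-- Changing the sign of the parameter reverses the order of the sequence; for even d it also
changes all signs. -/
theorem biTheta_neg_of_odd {d : ℕ} (hd : Odd d) (a : ℂ) {i : ℕ} (hi : i ≤ d) :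
    biTheta d (-a) i = biTheta d a (d - i) := by
  have h : ((-1 : ℂ)) ^ (d - i) = -(-1) ^ i := by
    have h1 : ((-1 : ℂ)) ^ (d - i) * (-1) ^ i = -1 := by
      rw [← pow_add, Nat.sub_add_cancel hi, hd.neg_one_pow]
    have h2 : ((-1 : ℂ)) ^ i * (-1) ^ i = 1 := by rw [← mul_pow]; simp
    linear_combination (-1) ^ i * h1 - (-1) ^ (d - i) * h2
  rw [biTheta, biTheta, h, Nat.cast_sub hi]; ring

theorem biTheta_neg_of_even {d : ℕ} (hd : Even d) (a : ℂ) {i : ℕ} (hi : i ≤ d) :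
    biTheta d (-a) i = -biTheta d a (d - i) := by
  have h : ((-1 : ℂ)) ^ (d - i) = (-1) ^ i := by
    have h1 : ((-1 : ℂ)) ^ (d - i) * (-1) ^ i = 1 := by
      rw [← pow_add, Nat.sub_add_cancel hi, hd.neg_one_pow]
    have h2 : ((-1 : ℂ)) ^ i * (-1) ^ i = 1 := by rw [← mul_pow]; simp
    linear_combination (-1) ^ i * h1 - (-1) ^ (d - i) * h2
  rw [biTheta, biTheta, h, Nat.cast_sub hi]; ring

theorem thetaPoly_neg_of_odd {d : ℕ} (hd : Odd d) (a : ℂ) :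
    thetaPoly d (-a) = thetaPoly d a := by
  rw [thetaPoly, thetaPoly, ← Finset.prod_range_reflect]
  refine Finset.prod_congr rfl fun i hi => ?_
  have := Finset.mem_range.1 hi
  rw [biTheta_neg_of_odd hd a (by omega), show d - (d + 1 - 1 - i) = i by omega]

theorem thetaPoly_neg_comp {d : ℕ} (hd : Even d) (a : ℂ) (T : Module.End ℂ V)
    (h : Polynomial.aeval T (thetaPoly d a) = 0) :
    Polynomial.aeval (-T) (thetaPoly d (-a)) = 0 := by
  have h1 : thetaPoly d (-a)
      = Polynomial.C (-1) ^ (d + 1) * (thetaPoly d a).comp (-Polynomial.X) := by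
    rw [thetaPoly, thetaPoly, ← Finset.prod_range_reflect, Polynomial.prod_comp]
    conv_rhs => rw [← Finset.card_range (d + 1), ← Finset.prod_const, Finset.card_range,
      ← Finset.prod_mul_distrib]
    refine Finset.prod_congr rfl fun i hi => ?_
    have := Finset.mem_range.1 hi
    rw [biTheta_neg_of_even hd a (by omega), show d - (d + 1 - 1 - i) = i by omega]
    simp
    ring
  rw [h1, map_mul, Polynomial.aeval_comp]
  simp [h]

theorem hasSpec_endX (d : ℕ) (a : ℂ) : HasSpec (endX d a) d a := by
  constructor
  · have h : ∀ m y, Polynomial.aeval (endX d a) (∏ i ∈ Finset.range m,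
        (Polynomial.X - Polynomial.C (biTheta d a i))) y = prodX d a 0 m y := by
      intro m y
      induction m with
      | zero => simp [prodX]
      | succ m ih =>
        rw [Finset.prod_range_succ, mul_comm, map_mul, Module.End.mul_apply, ih, prodX_succ_apply,
          zero_add]
        simp [Module.algebraMap_end_apply]
    refine LinearMap.ext fun y => ?_
    rw [thetaPoly, h]
    exact coordN_ext fun i hi => coordN_prodX_eq_zero a 0 (d + 1) (fun i hi => by omega) i (by omega)
  · refine ⟨basisVec d d, fun h => ?_, ?_⟩
    · have := coordN_basisVec (d := d) d d le_rfl
      rw [h] at this; simp at this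
    · have h1 : endX d a (basisVec d d) = _ := matX_basis d a d
      rw [h1]
      have h2 : basisVec d (d + 1) = 0 := by
        funext t; have := t.2; simp [basisVec]; omega
      rw [h2, add_zero]

/-- Y is upper bidiagonal: with the factors applied in the order θ*_d, θ*_{d-1}, …, each clears one
more coordinate from the top. -/
theorem aeval_endY (d : ℕ) (b : ℂ) (φ : ℕ → ℂ) :
    Polynomial.aeval (endY d b φ) (thetaPoly d b) = 0 := by
  rw [thetaPoly, ← Finset.prod_range_reflect]
  have h : ∀ m (y : Fin (d + 1) → ℂ), ∀ i, d + 1 - m ≤ i → coordN i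
      (Polynomial.aeval (endY d b φ) (∏ i ∈ Finset.range m,
        (Polynomial.X - Polynomial.C (biTheta d b (d + 1 - 1 - i)))) y) = 0 := by
    intro m y
    induction m with
    | zero => intro i hi; exact coordN_of_gt (by omega) _
    | succ m ih =>
      intro i hi
      rw [Finset.prod_range_succ, mul_comm, map_mul, Module.End.mul_apply]
      simp only [map_sub, Polynomial.aeval_X, Polynomial.aeval_C, LinearMap.sub_apply,
        Module.algebraMap_end_apply, map_smul, smul_eq_mul]
      rw [coordN_endY, ih (i + 1) (by omega)]
      by_cases h : d + 1 - m ≤ i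
      · rw [ih i h]; ring
      · rw [show d + 1 - 1 - m = i by omega]; ring
  refine LinearMap.ext fun y => coordN_ext fun i hi => h (d + 1) y i (by omega)

theorem hasSpec_endY (d : ℕ) (b : ℂ) (φ : ℕ → ℂ) : HasSpec (endY d b φ) d b := by
  refine ⟨aeval_endY d b φ, ?_⟩
  -- The last coordinate of (Y - θ*_d) y is always zero. So this operator is not surjective, hence
  -- not injective, and no explicit eigenvector is needed.
  let T : Module.End ℂ (Fin (d + 1) → ℂ) := endY d b φ - biTheta d b d • 1
  have hns : ¬ Function.Surjective T := by
    intro h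
    obtain ⟨y, hy⟩ := h (basisVec d d)
    have h1 := congrArg (coordN d) hy
    rw [coordN_basisVec _ _ le_rfl, show T y = endY d b φ y - biTheta d b d • y from rfl, map_sub, coordN_endY,
      coordN_of_gt (i := d + 1) (by omega)] at h1
    simp at h1
  rw [← LinearMap.injective_iff_surjective, injective_iff_map_eq_zero] at hns
  push Not at hns
  obtain ⟨v, hv, hv0⟩ := hns
  refine ⟨v, hv0, ?_⟩
  rw [← sub_eq_zero]
  exact hv

theorem endY_basisVec_zero (d : ℕ) (b : ℂ) (φ : ℕ → ℂ) :
    endY d b φ (basisVec d 0) = biTheta d b 0 • basisVec d 0 := matY_basis_zero d b φ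

theorem basisVec_zero_ne_zero (d : ℕ) : basisVec d 0 ≠ 0 := fun h => by
  have := coordN_basisVec (d := d) 0 0 (by omega)
  rw [h] at this; simp at this

/-- The eigenvector is v_0, with eigenvalue θ*_0(-b) = θ*_d(b). Thus the recorded data do not
distinguish the parameters b and -b. -/
theorem hasSpec_endY_neg_of_odd {d : ℕ} (hd : Odd d) (b : ℂ) (φ : ℕ → ℂ) :
    HasSpec (endY d (-b) φ) d b := by
  refine ⟨?_, basisVec d 0, basisVec_zero_ne_zero d, ?_⟩
  · rw [← thetaPoly_neg_of_odd hd]; exact aeval_endY d (-b) φ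
  · rw [endY_basisVec_zero, biTheta_neg_of_odd hd b (by omega), Nat.sub_zero]

/-- For even d the reversal changes signs, so the comparison is with -Y; this produces the twist by
(1, -1). -/
theorem hasSpec_neg_endY_of_even {d : ℕ} (hd : Even d) (b : ℂ) (φ : ℕ → ℂ) :
    HasSpec (-endY d (-b) φ) d b := by
  refine ⟨?_, basisVec d 0, basisVec_zero_ne_zero d, ?_⟩
  · have := thetaPoly_neg_comp hd (-b) _ (aeval_endY d (-b) φ)
    rwa [neg_neg] at this
  · rw [LinearMap.neg_apply, endY_basisVec_zero, biTheta_neg_of_even hd b (by omega), Nat.sub_zero,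
      neg_smul, neg_neg]

end Spectrum

/-! ### The universal property of the bidiagonal modules -/

section Universal

variable {V : Type*} [AddCommGroup V] [Module ℂ V]

/-- The parameters of the even-dimensional or of the odd-dimensional modules. -/
def IsParam (d : ℕ) (a b c : ℂ) (φ : ℕ → ℂ) (κ l m : ℂ) : Prop :=
  (φ = phiE d a b c ∧
      κ = c ^ 2 - a ^ 2 - b ^ 2 + ((d : ℂ) + 1) ^ 2 / 4 ∧
      l = a ^ 2 - b ^ 2 - c ^ 2 + ((d : ℂ) + 1) ^ 2 / 4 ∧
      m = b ^ 2 - c ^ 2 - a ^ 2 + ((d : ℂ) + 1) ^ 2 / 4) ∨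
    (φ = phiO d a b c ∧
      κ = 2 * a * b - c * (d + 1) ∧ l = 2 * b * c - a * (d + 1) ∧ m = 2 * c * a - b * (d + 1))

/-- The values of the three anticommutator relations. -/
structure HasCentral (X Y Z : Module.End ℂ V) (κ l m : ℂ) : Prop where
  xy : X * Y + Y * X - Z = κ • 1
  yz : Y * Z + Z * Y - X = l • 1
  zx : Z * X + X * Z - Y = m • 1

/-- The vectors generated from `w` by `X`. -/
noncomputable def splitVec (X : Module.End ℂ V) (d : ℕ) (a : ℂ) (w : V) : ℕ → V
  | 0 => w
  | i + 1 => X (splitVec X d a w i) - biTheta d a i • splitVec X d a w i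

theorem X_splitVec (X : Module.End ℂ V) (d : ℕ) (a : ℂ) (w : V) (i : ℕ) :
    X (splitVec X d a w i) = biTheta d a i • splitVec X d a w i + splitVec X d a w (i + 1) := by
  rw [splitVec]; abel

theorem splitVec_eq_aeval (X : Module.End ℂ V) (d : ℕ) (a : ℂ) (w : V) (i : ℕ) :
    splitVec X d a w i = Polynomial.aeval X (∏ r ∈ Finset.range i,
      (Polynomial.X - Polynomial.C (biTheta d a r))) w := by
  induction i with
  | zero => simp [splitVec]
  | succ i ih =>
    rw [Finset.prod_range_succ, mul_comm, map_mul, Module.End.mul_apply, ← ih, splitVec]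
    simp [Module.algebraMap_end_apply]

variable {X Y Z : Module.End ℂ V} {d : ℕ} {a b c κ l m : ℂ} {φ : ℕ → ℂ}

/-- With θ = θ*_0, the relation {Y, Z} - X = l applied to w becomes (Y + θ - 1)(Y + θ + 1) X w = (l
+ 2κθ) w. Since (Y + θ - 1) w = (2θ - 1) w ≠ 0 and Y + θ - 1 is injective, it can be cancelled,
which gives Y X w. -/
theorem Y_splitVec_one (H : HasCentral X Y Z κ l m) (hp : IsParam d a b c φ κ l m)
    {w : V} (hw : Y w = biTheta d b 0 • w)
    (hinj : ∀ u, Y u = (1 - biTheta d b 0) • u → u = 0) (hne : 2 * biTheta d b 0 - 1 ≠ 0) :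
    Y (splitVec X d a w 1) = biTheta d b 1 • splitVec X d a w 1 + φ 1 • w := by
  have hZ : Z = X * Y + Y * X - κ • 1 := by rw [← H.xy]; abel
  have h := LinearMap.congr_fun H.yz w
  simp only [hZ, LinearMap.add_apply, LinearMap.sub_apply, Module.End.mul_apply,
    LinearMap.smul_apply, Module.End.one_apply, map_add, map_sub, map_smul, hw] at h
  have ht1 : biTheta d b 1 = -biTheta d b 0 - 1 := by simp [biTheta]; ring
  set θ := biTheta d b 0 with hθ
  set c' := (l + 2 * κ * θ) / (2 * θ - 1) with hc'
  have hc : c' * (2 * θ - 1) = l + 2 * κ * θ := div_mul_cancel₀ _ hne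
  clear_value c'
  have hu : Y (X w) + (θ + 1) • X w - c' • w = 0 := by
    apply hinj
    rw [← sub_eq_zero] at h ⊢
    simp only [map_sub, map_add, map_smul, hw]
    refine Eq.trans ?_ h
    match_scalars <;> first | ring1 | linear_combination -hc
  -- The constant found by cancellation is the one prescribed by the parameters, for both families.
  have hφ : φ 1 = c' - biTheta d a 0 * (2 * θ + 1) := by
    apply mul_right_cancel₀ hne
    rw [sub_mul, hc]
    rcases hp with ⟨rfl, rfl, rfl, -⟩ | ⟨rfl, rfl, rfl, -⟩
    · simp [phiE, hθ, biTheta]; ring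
    · simp [phiO, hθ, biTheta]; ring
  have hYX : Y (X w) = c' • w - (θ + 1) • X w := by
    rw [← sub_eq_zero, ← hu]; abel
  rw [splitVec, splitVec, map_sub, map_smul, hYX, hw, ht1, hφ]
  module

/-- The relation {Z, X} - Y = m, with Z eliminated, contains YX² once; so it determines Y on each
vector of the chain from its values on the two preceding ones. -/
theorem Y_splitVec_succ (H : HasCentral X Y Z κ l m) (hp : IsParam d a b c φ κ l m)
    {w : V} (hw : Y w = biTheta d b 0 • w)
    (h1 : Y (splitVec X d a w 1) = biTheta d b 1 • splitVec X d a w 1 + φ 1 • w) (i : ℕ) :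
    Y (splitVec X d a w (i + 1)) = biTheta d b (i + 1) • splitVec X d a w (i + 1)
      + φ (i + 1) • splitVec X d a w i := by
  have hZ : Z = X * Y + Y * X - κ • 1 := by rw [← H.xy]; abel
  have hX := X_splitVec X d a w
  have hφE : ∀ i, φ i = (1 + (-1) ^ i) / 2 * (i * (d - i + 1))
      + (1 - (-1) ^ i) / 2 * (c ^ 2 - (2 * a + 2 * b - d + 2 * i - 1) ^ 2 / 4) ∨
      φ i = (1 + (-1) ^ i) / 2 * (i * (d + 1 - 2 * i - 2 * a - 2 * b - 2 * c) / 2)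
      + (1 - (-1) ^ i) / 2 * ((i - d - 1) * (d + 1 - 2 * i - 2 * a - 2 * b + 2 * c) / 2) := by
    intro i
    rcases hp with ⟨rfl, -⟩ | ⟨rfl, -⟩
    · exact Or.inl (phiE_eq d a b c i)
    · exact Or.inr (phiO_eq d a b c i)
  induction i using Nat.strong_induction_on with
  | _ i ih =>
    match i with
    | 0 => exact h1
    | 1 =>
      have h := LinearMap.congr_fun H.zx w
      have hX0 := hX 0
      have hX1 := hX 1
      rw [show splitVec X d a w 0 = w from rfl] at hX0
      simp only [hZ, LinearMap.add_apply, LinearMap.sub_apply, Module.End.mul_apply,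
        LinearMap.smul_apply, Module.End.one_apply, map_add, map_sub, map_smul, hw, hX0, hX1,
        zero_add, h1] at h
      rw [← sub_eq_zero] at h ⊢
      refine Eq.trans ?_ h
      rw [show 1 + 1 = 2 by rfl]
      rcases hp with ⟨rfl, rfl, rfl, rfl⟩ | ⟨rfl, rfl, rfl, rfl⟩
      · match_scalars <;> simp only [biTheta, phiE_eq, pow_succ, pow_zero] <;> push_cast <;> ring
      · match_scalars <;> simp only [biTheta, phiO_eq, pow_succ, pow_zero] <;> push_cast <;> ring
    | i + 2 =>
      have h := LinearMap.congr_fun H.zx (splitVec X d a w (i + 1))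
      have e0 := ih i (by omega)
      have e1 := ih (i + 1) (by omega)
      have hX0 := hX i
      have hX1 := hX (i + 1)
      have hX2 := hX (i + 2)
      simp only [hZ, LinearMap.add_apply, LinearMap.sub_apply, Module.End.mul_apply,
        LinearMap.smul_apply, Module.End.one_apply, map_add, map_sub, map_smul, hX0, hX1, hX2,
        e0, e1] at h
      rw [← sub_eq_zero] at h ⊢
      refine Eq.trans ?_ h
      rcases hp with ⟨rfl, rfl, rfl, rfl⟩ | ⟨rfl, rfl, rfl, rfl⟩
      · match_scalars <;> rcases neg_one_pow_eq_or ℂ i with h | h <;>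
          simp only [biTheta, phiE_eq, pow_succ, h] <;> push_cast <;> ring
      · match_scalars <;> rcases neg_one_pow_eq_or ℂ i with h | h <;>
          simp only [biTheta, phiO_eq, pow_succ, h] <;> push_cast <;> ring

end Universal

/-! ### Maps out of the bidiagonal modules -/

section Universal

variable {V W : Type*} [AddCommGroup V] [Module ℂ V] [AddCommGroup W] [Module ℂ W]
  {X Y Z : Module.End ℂ V} {d : ℕ} {a b c κ l m : ℂ} {φ : ℕ → ℂ}

theorem basisVec_of_lt {i : ℕ} (h : d < i) : basisVec d i = 0 := by
  funext j
  have := j.2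
  simp only [basisVec, Pi.zero_apply, ite_eq_right_iff]
  omega

/-- The universal property of the modules given by bidiagonal matrices. -/
theorem exists_linearMap_of_eigenvector (H : HasCentral X Y Z κ l m)
    (hp : IsParam d a b c φ κ l m) (hφ : φ (d + 1) = 0)
    (hX : Polynomial.aeval X (thetaPoly d a) = 0) {w : V} (hw : Y w = biTheta d b 0 • w)
    (hinj : ∀ u, Y u = (1 - biTheta d b 0) • u → u = 0) (hne : 2 * biTheta d b 0 - 1 ≠ 0) :
    ∃ ψ : (Fin (d + 1) → ℂ) →ₗ[ℂ] V, ψ (basisVec d 0) = w ∧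
      ∀ i v, ψ (biTriple (endX d a) (endY d b φ) κ i v) = ![X, Y, Z] i (ψ v) := by
  have hY1 := Y_splitVec_succ H hp hw (Y_splitVec_one H hp hw hinj hne)
  -- The polynomial that annihilates X ends the chain after index d.
  have hzero : ∀ i, splitVec X d a w (d + 1 + i) = 0 := by
    intro i
    induction i with
    | zero =>
      rw [add_zero, splitVec_eq_aeval]
      exact LinearMap.congr_fun hX w
    | succ i ih => rw [← add_assoc, splitVec, ih]; simp
  let ψ : (Fin (d + 1) → ℂ) →ₗ[ℂ] V :=
    Fintype.linearCombination ℂ fun i : Fin (d + 1) => splitVec X d a w i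
  have hψ : ∀ i, ψ (basisVec d i) = splitVec X d a w i := by
    intro i
    by_cases h : d < i
    · obtain ⟨r, rfl⟩ := Nat.exists_eq_add_of_lt h
      rw [basisVec_of_lt h, map_zero, show d + r + 1 = d + 1 + r by omega, hzero]
    · have : basisVec d i = Pi.single ⟨i, by omega⟩ 1 := by
        funext t; simp [basisVec, Pi.single_apply, Fin.ext_iff]
      rw [this]
      simp only [ψ, Fintype.linearCombination_apply_single, one_smul]
  have key : ∀ f g : (Fin (d + 1) → ℂ) →ₗ[ℂ] V, (∀ i, f (basisVec d i) = g (basisVec d i)) →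
      f = g := by
    intro f g h
    apply LinearMap.pi_ext'
    intro i
    apply LinearMap.ext_ring
    have : basisVec d i = Pi.single i 1 := by
      funext t; simp [basisVec, Pi.single_apply, Fin.ext_iff]
    simpa [this] using h i
  have hψX : ∀ v, ψ (endX d a v) = X (ψ v) := by
    refine LinearMap.congr_fun (key (ψ ∘ₗ endX d a) (X ∘ₗ ψ) fun i => ?_)
    have h : endX d a (basisVec d i) = _ := matX_basis d a i
    rw [LinearMap.comp_apply, LinearMap.comp_apply, h, map_add, map_smul, hψ, hψ, X_splitVec]
  have hψY : ∀ v, ψ (endY d b φ v) = Y (ψ v) := by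
    refine LinearMap.congr_fun (key (ψ ∘ₗ endY d b φ) (Y ∘ₗ ψ) fun i => ?_)
    rw [LinearMap.comp_apply, LinearMap.comp_apply]
    cases i with
    | zero => rw [endY_basisVec_zero, map_smul, hψ]; exact hw.symm
    | succ i =>
      have h : endY d b φ (basisVec d (i + 1)) = _ := matY_basis_succ d b φ hφ i
      rw [h, map_add, map_smul, map_smul, hψ, hψ, hY1]
  refine ⟨ψ, hψ 0, fun i v => ?_⟩
  fin_cases i
  · exact hψX v
  · exact hψY v
  · have hZ : Z = X * Y + Y * X - κ • 1 := by rw [← H.xy]; abel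
    show ψ ((endX d a * endY d b φ + endY d b φ * endX d a - κ • 1) v) = Z (ψ v)
    rw [hZ]
    simp only [LinearMap.add_apply, LinearMap.sub_apply, Module.End.mul_apply,
      LinearMap.smul_apply, Module.End.one_apply, map_add, map_sub, map_smul, hψX, hψY]

theorem HasCentral.of_injective {X' Y' Z' : Module.End ℂ W} (H : HasCentral X' Y' Z' κ l m)
    (e : V →ₗ[ℂ] W) (he : Function.Injective e) (hX : ∀ v, e (X v) = X' (e v))
    (hY : ∀ v, e (Y v) = Y' (e v)) (hZ : ∀ v, e (Z v) = Z' (e v)) : HasCentral X Y Z κ l m := by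
  constructor <;> refine LinearMap.ext fun v => he ?_
  · have := LinearMap.congr_fun H.xy (e v)
    simpa [hX, hY, hZ] using this
  · have := LinearMap.congr_fun H.yz (e v)
    simpa [hX, hY, hZ] using this
  · have := LinearMap.congr_fun H.zx (e v)
    simpa [hX, hY, hZ] using this

theorem hasCentral_biTriple (hp : IsParam d a b c φ κ l m) (hφ : φ (d + 1) = 0) :
    HasCentral (endX d a) (endY d b φ) (biTriple (endX d a) (endY d b φ) κ 2) κ l m := by
  have main := bidiag (endX d a) (endY d b φ) (basisVec d) (biTheta d a) (biTheta d b)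
    φ a b c d κ l m (matX_basis d a) (matY_basis_zero d b _)
    (matY_basis_succ d b _ hφ) (fun _ => rfl) (fun _ => rfl) (by
      rcases hp with ⟨rfl, h⟩ | ⟨rfl, h⟩
      · exact Or.inl ⟨phiE_eq d a b c, h⟩
      · exact Or.inr ⟨phiO_eq d a b c, h⟩)
  refine ⟨?_, end_ext_basis fun n => (main n).1, end_ext_basis fun n => (main n).2⟩
  show _ - (endX d a * endY d b φ + endY d b φ * endX d a - κ • 1) = _
  rw [sub_sub_cancel]

/-- For β ≥ 0 all |θ_i| are at most β + d/2. The number 1 + β + d/2 is 1 - θ*_0(-β), which the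
universal property excludes from the spectrum; the negative sign serves the case of -Y. -/
theorem eval_thetaPoly_ne_zero (d : ℕ) {β : ℝ} (hβ : 0 ≤ β) {s : ℝ} (hs : s = 1 ∨ s = -1) :
    (thetaPoly d β).eval ((s * (1 + β + d / 2) : ℝ) : ℂ) ≠ 0 := by
  rw [thetaPoly, Polynomial.eval_prod, Finset.prod_ne_zero_iff]
  intro i hi
  have hid : (i : ℝ) ≤ d := by
    exact_mod_cast Nat.lt_succ_iff.1 (Finset.mem_range.1 hi)
  have hi0 : (0 : ℝ) ≤ i := Nat.cast_nonneg i
  have h : (Polynomial.X - Polynomial.C (biTheta d β i)).eval ((s * (1 + β + d / 2) : ℝ) : ℂ)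
      = ((s * (1 + β + d / 2) - (-1) ^ i * (2 * β - d + 2 * i) / 2 : ℝ) : ℂ) := by
    simp [biTheta]
  rw [h, Complex.ofReal_ne_zero]
  intro h0
  rcases hs with rfl | rfl <;> rcases neg_one_pow_eq_or ℝ i with h | h <;> rw [h] at h0 <;>
    linarith

end Universal

/-! ### Recognizing irreducible modules by their spectral data -/

section Recognition

variable {M M' N N' S : Type*} [AddCommGroup M] [Module BI M] [Module ℂ M] [IsScalarTower ℂ BI M]
  [AddCommGroup N] [Module BI N] [Module ℂ N] [IsScalarTower ℂ BI N]
  [AddCommGroup N'] [Module BI N'] [Module ℂ N'] [IsScalarTower ℂ BI N']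
  [AddCommGroup S] [Module BI S] [Module ℂ S] [IsScalarTower ℂ BI S]
  {d : ℕ} {a b c κ l m : ℂ} {φ : ℕ → ℂ}

theorem SplitModel.hasSpec_zero (T : SplitModel M d a b φ κ) :
    HasSpec (actEnd M (BI.gen 0)) d a :=
  (hasSpec_endX d a).of_injective T.equiv fun v => T.gen_smul 0 v

theorem SplitModel.hasSpec_one (T : SplitModel M d a b φ κ) :
    HasSpec (actEnd M (BI.gen 1)) d b :=
  (hasSpec_endY d b φ).of_injective T.equiv fun v => T.gen_smul 1 v

theorem SplitModel.hasCentral (T : SplitModel M d a b φ κ) (hp : IsParam d a b c φ κ l m)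
    (hφ : φ (d + 1) = 0) :
    HasCentral (actEnd M (BI.gen 0)) (actEnd M (BI.gen 1)) (actEnd M (BI.gen 2)) κ l m :=
  (hasCentral_biTriple hp hφ).of_injective T.equiv.toLinearMap T.equiv.injective
    (fun v => T.gen_smul 0 v) (fun v => T.gen_smul 1 v) fun v => T.gen_smul 2 v

theorem bijective_of_ne_zero_of_simple_domain [IsSimpleModule BI S] [Module.Finite ℂ S]
    [Module.Finite ℂ N]
    (h : Module.finrank ℂ S = Module.finrank ℂ N) (F : S →ₗ[BI] N) (hF : F ≠ 0) :
    Function.Bijective F := by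
  have hi : Function.Injective F := LinearMap.injective_of_ne_zero hF
  exact ⟨hi, (LinearMap.injective_iff_surjective_of_finrank_eq_finrank
    (f := F.restrictScalars ℂ) h).1 hi⟩

theorem bijective_of_ne_zero_of_simple_codomain [IsSimpleModule BI N] [Module.Finite ℂ S]
    [Module.Finite ℂ N]
    (h : Module.finrank ℂ S = Module.finrank ℂ N) (F : S →ₗ[BI] N) (hF : F ≠ 0) :
    Function.Bijective F := by
  have hs : Function.Surjective F := LinearMap.surjective_of_ne_zero hF
  exact ⟨(LinearMap.injective_iff_surjective_of_finrank_eq_finrank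
    (f := F.restrictScalars ℂ) h).2 hs, hs⟩

/-- A nonzero map to the irreducible N is onto, hence bijective by dimension. So S is irreducible
too, and its nonzero map to N' is injective, hence bijective; irreducibility of N' is a consequence.
-/
theorem isIsomorphic_of_common_source [IsSimpleModule BI N] [Module.Finite ℂ S]
    [Module.Finite ℂ N] [Module.Finite ℂ N'] (h : Module.finrank ℂ S = Module.finrank ℂ N)
    (h' : Module.finrank ℂ S = Module.finrank ℂ N')
    (hF : ∃ F : S →ₗ[BI] N, F ≠ 0) (hG : ∃ G : S →ₗ[BI] N', G ≠ 0) : IsIsomorphic N N' := by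
  obtain ⟨F, hF⟩ := hF
  obtain ⟨G, hG⟩ := hG
  let e := LinearEquiv.ofBijective F (bijective_of_ne_zero_of_simple_codomain h F hF)
  have : IsSimpleModule BI S := IsSimpleModule.congr e
  exact ⟨e.symm.trans (LinearEquiv.ofBijective G (bijective_of_ne_zero_of_simple_domain h' G hG))⟩

theorem eq_zero_of_annihilated {V : Type*} [AddCommGroup V] [Module ℂ V] {T : Module.End ℂ V}
    {β : ℝ} (hβ : 0 ≤ β) (hT : Polynomial.aeval T (thetaPoly d β) = 0) {s : ℝ}
    (hs : s = 1 ∨ s = -1) {u : V} (hu : T u = ((s * (1 + β + d / 2) : ℝ) : ℂ) • u) : u = 0 := by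
  have h := aeval_eigen hu (thetaPoly d β)
  rw [hT, LinearMap.zero_apply] at h
  exact (smul_eq_zero.1 h.symm).resolve_left (eval_thetaPoly_ne_zero d hβ hs)

theorem two_mul_biTheta_zero_sub_one_ne_zero (d : ℕ) {β : ℝ} (hβ : 0 ≤ β) :
    2 * biTheta d (-β) 0 - 1 ≠ 0 := by
  have h : 2 * biTheta d (-β) 0 - 1 = ((-(2 * β + d + 1) : ℝ) : ℂ) := by
    simp [biTheta]; ring
  rw [h, Complex.ofReal_ne_zero]
  have : (0 : ℝ) ≤ d := Nat.cast_nonneg d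
  linarith

theorem one_sub_biTheta_zero (d : ℕ) (β : ℝ) :
    1 - biTheta d (-β) 0 = ((1 + β + d / 2 : ℝ) : ℂ) := by
  simp [biTheta]; ring

/-- The eigenvector of Y for θ*_d(β) = θ*_0(-β) is the image of v_0; the scalars κ, l, m involve
only squares of the parameters and do not see the sign of β. -/
theorem exists_hom_modE (hd : Odd d) {β : ℝ} (hβ : 0 ≤ β)
    (hX : HasSpec (actEnd N (BI.gen 0)) d a) (hY : HasSpec (actEnd N (BI.gen 1)) d β)
    (H : HasCentral (actEnd N (BI.gen 0)) (actEnd N (BI.gen 1)) (actEnd N (BI.gen 2)) κ l m)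
    (hκ : κ = c ^ 2 - a ^ 2 - β ^ 2 + ((d : ℂ) + 1) ^ 2 / 4)
    (hl : l = a ^ 2 - β ^ 2 - c ^ 2 + ((d : ℂ) + 1) ^ 2 / 4)
    (hm : m = β ^ 2 - c ^ 2 - a ^ 2 + ((d : ℂ) + 1) ^ 2 / 4) :
    ∃ F : ModE d hd a (-β) c →ₗ[BI] N, F ≠ 0 := by
  obtain ⟨w, hw0, hw⟩ := hY.top
  have hp : IsParam d a (-β) c (phiE d a (-β) c) κ l m :=
    Or.inl ⟨rfl, by rw [hκ]; ring, by rw [hl]; ring, by rw [hm]; ring⟩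
  obtain ⟨ψ, hψw, hψ⟩ := exists_linearMap_of_eigenvector H hp (by simp [phiE, hd.add_one])
    hX.annihilates (w := w) (by rw [hw, biTheta_neg_of_odd hd _ (by omega), Nat.sub_zero])
    (fun u hu => eq_zero_of_annihilated hβ hY.annihilates (Or.inl rfl) (by
      rw [hu, one_sub_biTheta_zero, one_mul]))
    (two_mul_biTheta_zero_sub_one_ne_zero d hβ)
  have hk : c ^ 2 - a ^ 2 - (-(β : ℂ)) ^ 2 + ((d : ℂ) + 1) ^ 2 / 4 = κ := by rw [hκ]; ring
  obtain ⟨T⟩ : Nonempty (SplitModel (ModE d hd a (-β) c) d a (-β) (phiE d a (-β) c) κ) :=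
    hk ▸ ⟨splitModelE d hd a (-β) c⟩
  refine ⟨linearMapOfGen (ψ ∘ₗ T.equiv.toLinearMap) fun i v => ?_, fun h => ?_⟩
  · have h := T.gen_smul i v
    simp only [LinearMap.comp_apply, LinearEquiv.coe_coe]
    rw [h, hψ]
    fin_cases i <;> rfl
  · have h1 := LinearMap.congr_fun h (T.equiv.symm (basisVec d 0))
    have h2 : ψ (T.equiv (T.equiv.symm (basisVec d 0))) = 0 := h1
    rw [LinearEquiv.apply_symm_apply, hψw] at h2
    exact hw0 h2

theorem HasCentral.neg {V : Type*} [AddCommGroup V] [Module ℂ V] {X Y Z : Module.End ℂ V}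
    (H : HasCentral X Y Z κ l m) : HasCentral X (-Y) (-Z) (-κ) l (-m) := by
  constructor
  · rw [neg_smul, ← H.xy]; noncomm_ring
  · rw [← H.yz]; noncomm_ring
  · rw [neg_smul, ← H.zx]; noncomm_ring

/-- Here θ*_d(β) = -θ*_0(-β), so the universal property is applied to X, -Y, -Z. This negates κ and
m, which matches the parameters a, -β, -c. -/
theorem exists_hom_modO (hd : Even d) {β : ℝ} (hβ : 0 ≤ β)
    (hX : HasSpec (actEnd N (BI.gen 0)) d a) (hY : HasSpec (actEnd N (BI.gen 1)) d β)
    (H : HasCentral (actEnd N (BI.gen 0)) (actEnd N (BI.gen 1)) (actEnd N (BI.gen 2)) κ l m)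
    (hκ : κ = 2 * a * β - c * (d + 1)) (hl : l = 2 * β * c - a * (d + 1))
    (hm : m = 2 * c * a - β * (d + 1)) :
    ∃ F : Twist (BI.signAut (1, -1)) (ModO d hd a (-β) (-c)) →ₗ[BI] N, F ≠ 0 := by
  obtain ⟨w, hw0, hw⟩ := hY.top
  have hp : IsParam d a (-β) (-c) (phiO d a (-β) (-c)) (-κ) l (-m) :=
    Or.inr ⟨rfl, by rw [hκ]; ring, by rw [hl]; ring, by rw [hm]; ring⟩
  obtain ⟨ψ, hψw, hψ⟩ := exists_linearMap_of_eigenvector H.neg hp (by simp [phiO, hd.add_one])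
    hX.annihilates (w := w)
    (by rw [LinearMap.neg_apply, hw, biTheta_neg_of_even hd _ (by omega), Nat.sub_zero, neg_smul])
    (fun u hu => eq_zero_of_annihilated hβ hY.annihilates (Or.inr rfl) (by
      rw [LinearMap.neg_apply, one_sub_biTheta_zero] at hu
      rw [← neg_neg (actEnd N (BI.gen 1) u), hu, ← neg_smul]
      push_cast; congr 1; ring))
    (two_mul_biTheta_zero_sub_one_ne_zero d hβ)
  have hk : 2 * a * (-(β : ℂ)) - -c * ((d : ℂ) + 1) = -κ := by rw [hκ]; ring
  obtain ⟨T⟩ : Nonempty (SplitModel (ModO d hd a (-β) (-c)) d a (-β) (phiO d a (-β) (-c)) (-κ)) :=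
    hk ▸ ⟨splitModelO d hd a (-β) (-c)⟩
  let ψ' : Twist (BI.signAut (1, -1)) (ModO d hd a (-β) (-c)) →ₗ[ℂ] N := ψ ∘ₗ T.equiv.toLinearMap
  have hT : ∀ (i : Fin 3) (v : ModO d hd a (-β) (-c)),
      ψ (T.equiv (BI.gen i • v)) = ((BI.signs (1, -1) i : ℤ) : ℂ) • BI.gen i • ψ (T.equiv v) := by
    intro i v
    have h := T.gen_smul i v
    rw [h, hψ]
    fin_cases i <;> simp [BI.signs]
  refine ⟨linearMapOfGen ψ' fun i v => ?_, fun h => ?_⟩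
  · have h : ψ' (BI.gen i • v) = ψ (T.equiv (BI.signAut (1, -1) (BI.gen i) •
        (show ModO d hd a (-β) (-c) from v))) := rfl
    have h' : ψ' v = ψ (T.equiv v) := rfl
    rw [h, h', BI.signAut_gen, smul_assoc, map_smul, map_smul, hT]
    rcases Int.units_eq_one_or (BI.signs (1, -1) i) with h | h <;> simp [h]
  · have h1 := LinearMap.congr_fun h (T.equiv.symm (basisVec d 0))
    have h2 : ψ (T.equiv (T.equiv.symm (basisVec d 0))) = 0 := h1
    rw [LinearEquiv.apply_symm_apply, hψw] at h2
    exact hw0 h2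

/-- An irreducible module with the spectral data of `E_d(a, b, c)` is isomorphic to it. -/
theorem isIsomorphic_modE [IsSimpleModule BI N] [Module.Finite ℂ N]
    (hN : Module.finrank ℂ N = d + 1) (hd : Odd d) {β : ℝ} (hβ : 0 ≤ β)
    (hX : HasSpec (actEnd N (BI.gen 0)) d a) (hY : HasSpec (actEnd N (BI.gen 1)) d β)
    (H : HasCentral (actEnd N (BI.gen 0)) (actEnd N (BI.gen 1)) (actEnd N (BI.gen 2))
      (c ^ 2 - a ^ 2 - β ^ 2 + ((d : ℂ) + 1) ^ 2 / 4)
      (a ^ 2 - β ^ 2 - c ^ 2 + ((d : ℂ) + 1) ^ 2 / 4)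
      (β ^ 2 - c ^ 2 - a ^ 2 + ((d : ℂ) + 1) ^ 2 / 4)) :
    IsIsomorphic N (ModE d hd a β c) := by
  have T := splitModelE d hd a (-β) c
  have T' := splitModelE d hd a β c
  have := T.finite
  have := T'.finite
  refine isIsomorphic_of_common_source (S := ModE d hd a (-β) c) (by rw [T.finrank, hN])
    (by rw [T.finrank, T'.finrank])
    (exists_hom_modE hd hβ hX hY H rfl rfl rfl)
    (exists_hom_modE hd hβ T'.hasSpec_zero T'.hasSpec_one
      (T'.hasCentral (Or.inl ⟨rfl, rfl, rfl, rfl⟩) (by simp [phiE, hd.add_one])) rfl rfl rfl)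

/-- An irreducible module with the spectral data of `O_d(a, b, c)` is isomorphic to it. -/
theorem isIsomorphic_modO [IsSimpleModule BI N] [Module.Finite ℂ N]
    (hN : Module.finrank ℂ N = d + 1) (hd : Even d) {β : ℝ} (hβ : 0 ≤ β)
    (hX : HasSpec (actEnd N (BI.gen 0)) d a) (hY : HasSpec (actEnd N (BI.gen 1)) d β)
    (H : HasCentral (actEnd N (BI.gen 0)) (actEnd N (BI.gen 1)) (actEnd N (BI.gen 2))
      (2 * a * β - c * (d + 1)) (2 * β * c - a * (d + 1)) (2 * c * a - β * (d + 1))) :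
    IsIsomorphic N (ModO d hd a β c) := by
  have T := splitModelO d hd a (-β) (-c)
  have T' := splitModelO d hd a β c
  have := T.finite
  have := T'.finite
  have : Module.Finite ℂ (Twist (BI.signAut (1, -1)) (ModO d hd a (-β) (-c))) := T.finite
  have h : Module.finrank ℂ (Twist (BI.signAut (1, -1)) (ModO d hd a (-β) (-c))) = d + 1 :=
    T.finrank
  refine isIsomorphic_of_common_source (by rw [h, hN]) (by rw [h, T'.finrank])
    (exists_hom_modO hd hβ hX hY H rfl rfl rfl)
    (exists_hom_modO hd hβ T'.hasSpec_zero T'.hasSpec_one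
      (T'.hasCentral (Or.inr ⟨rfl, rfl, rfl, rfl⟩) (by simp [phiO, hd.add_one])) rfl rfl rfl)

theorem IsIsomorphic.of_twist {φ : BI ≃ₐ[ℂ] BI} (hφ : ∀ b, φ (φ b) = b) {M T : Type*}
    [AddCommGroup M] [Module BI M] [AddCommGroup T] [Module BI T]
    (h : IsIsomorphic (Twist φ M) T) : IsIsomorphic M (Twist φ T) := by
  obtain ⟨e⟩ := h
  refine ⟨{ toFun := fun v => e v, invFun := fun t => e.symm t, map_add' := fun v w => e.map_add v w,
            map_smul' := fun b v => ?_, left_inv := e.symm_apply_apply,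
            right_inv := e.apply_symm_apply }⟩
  have h : e (@HSMul.hSMul BI M M _ (φ (φ b)) v) = φ b • e v := e.map_smul (φ b) v
  rw [hφ] at h
  exact h

end Recognition

/-! ### The second split sequence and nonvanishing -/

section SecondSplit

theorem sum_biTheta (d : ℕ) (a : ℂ) (s N : ℕ) :
    ∑ r ∈ Finset.range N, biTheta d a (s + r)
      = (-1) ^ s * ((1 - (-1) ^ N) / 2 * (a - d / 2 + s) + (-(-1) ^ N * (2 * N - 1) - 1) / 4) := by
  induction N with
  | zero => simp
  | succ N ih =>
    rw [Finset.sum_range_succ, ih, biTheta, pow_add, pow_succ]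
    push_cast; ring

theorem neg_one_pow_sub {d m : ℕ} (h : m ≤ d) : ((-1 : ℂ)) ^ (d - m) = (-1) ^ d * (-1) ^ m := by
  obtain ⟨r, rfl⟩ := Nat.exists_eq_add_of_le h
  rw [Nat.add_sub_cancel_left, pow_add]
  have : ((-1 : ℂ)) ^ m * (-1) ^ m = 1 := by rw [← mul_pow]; simp
  linear_combination -(-1 : ℂ) ^ r * this

theorem sum_biTheta_sub (d : ℕ) (a : ℂ) {m : ℕ} (h : m ≤ d) :
    ∑ r ∈ Finset.range (m + 1), (biTheta d a r - biTheta d a (d - m + r))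
      = ((1 - (-1) ^ (m + 1)) / 2 * (a - d / 2) + (-(-1) ^ (m + 1) * (2 * m + 1) - 1) / 4)
        - (-1) ^ d * (-1) ^ m * ((1 - (-1) ^ (m + 1)) / 2 * (a + d / 2 - m)
          + (-(-1) ^ (m + 1) * (2 * m + 1) - 1) / 4) := by
  have h0 := sum_biTheta d a 0 (m + 1)
  simp only [zero_add] at h0
  rw [Finset.sum_sub_distrib, h0, sum_biTheta, neg_one_pow_sub h, Nat.cast_sub h]
  push_cast; ring

/-- The right side is φ_{m+1} for the parameters -a, b, c, in accordance with the fact that a ↦ -a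
reverses the θ_i. -/
theorem second_split_E {d : ℕ} (hd : Odd d) (a b c : ℂ) {m : ℕ} (h : m < d) :
    (biTheta d b m - biTheta d b (m + 1)) *
      ∑ r ∈ Finset.range (m + 1), (biTheta d a r - biTheta d a (d - m + r))
        + phiE d a b c (m + 1)
      = if Even m then c ^ 2 - (2 * b - 2 * a - d + 2 * m + 1) ^ 2 / 4
        else (m + 1 : ℂ) * (d - m) := by
  rw [sum_biTheta_sub d a h.le, phiE_eq, biTheta, biTheta, pow_succ, hd.neg_one_pow]
  split_ifs with hm
  · rw [hm.neg_one_pow]; push_cast; ring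
  · rw [(Nat.not_even_iff_odd.1 hm).neg_one_pow]; push_cast; ring

/-- The right side is the negative of φ_{m+1} for the parameters -a, b, -c; the signs come from
θ_i(-a) = -θ_{d-i}(a). -/
theorem second_split_O {d : ℕ} (hd : Even d) (a b c : ℂ) {m : ℕ} (h : m < d) :
    (biTheta d b m - biTheta d b (m + 1)) *
      ∑ r ∈ Finset.range (m + 1), (biTheta d a r - biTheta d a (d - m + r))
        + phiO d a b c (m + 1)
      = if Even m then -((m - d) * (d - 1 - 2 * m - 2 * b + 2 * a - 2 * c) / 2)
        else -((m + 1) * (d - 1 - 2 * m - 2 * b + 2 * a + 2 * c) / 2) := by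
  rw [sum_biTheta_sub d a h.le, phiO_eq, biTheta, biTheta, pow_succ, hd.neg_one_pow]
  split_ifs with hm
  · rw [hm.neg_one_pow]; push_cast; ring
  · rw [(Nat.not_even_iff_odd.1 hm).neg_one_pow]; push_cast; ring

/-- Here q and p stand for k_l and k_{l+1}, and -t/2 for k_{l+2}. Both sequences factor, by
differences of squares, into real factors of strict sign. -/
theorem isSimpleModule_modE {n t : ℕ} (htn : t ≤ n) (hd : Odd (n - t)) {q p : ℝ} (hq : 0 ≤ q)
    (hp : 0 ≤ p) {a b c : ℂ} (ha : a = q + (n + 1) / 2) (hb : b = -(q + p - t / 2) - (n + 1) / 2)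
    (hc : c = -p - (n + 1) / 2) : IsSimpleModule BI (ModE (n - t) hd a b c) := by
  have hdc : ((n - t : ℕ) : ℂ) = n - t := Nat.cast_sub htn
  have hle : ∀ i : ℕ, i < n - t → (i : ℝ) + 1 ≤ n - t := fun i hi => by
    have : i + 1 + t ≤ n := by omega
    have : ((i + 1 + t : ℕ) : ℝ) ≤ n := by exact_mod_cast this
    push_cast at this; linarith
  have ht0 : (0 : ℝ) ≤ t := Nat.cast_nonneg t
  refine (splitModelE (n - t) hd a b c).isSimpleModule (fun i hi => ?_) (fun i hi => ?_)
  · have h := hle i hi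
    have hi0 : (0 : ℝ) ≤ i := Nat.cast_nonneg i
    rcases Nat.even_or_odd i with he | ho
    · rw [phiE, if_neg (Nat.not_even_iff_odd.2 he.add_one), hdc]
      have e : c ^ 2 - (2 * a + 2 * b - (n - t) + 2 * (i + 1 : ℕ) - 1) ^ 2 / 4
          = (((t + (i + 1)) * (2 * p + (n + 1 - t - (i + 1))) : ℝ) : ℂ) := by
        rw [ha, hb, hc]; push_cast; ring
      rw [e, Complex.ofReal_ne_zero]
      exact mul_ne_zero (by linarith) (by linarith)
    · rw [phiE, if_pos ho.add_one, hdc]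
      have e : ((i + 1 : ℕ) : ℂ) * (n - t - (i + 1 : ℕ) + 1)
          = (((i + 1) * (n - t - i) : ℝ) : ℂ) := by push_cast; ring
      rw [e, Complex.ofReal_ne_zero]
      exact mul_ne_zero (by linarith) (by linarith)
  · have h := hle i hi
    have hi0 : (0 : ℝ) ≤ i := Nat.cast_nonneg i
    rw [second_split_E hd _ _ _ hi, hdc]
    split_ifs with he
    · have e : c ^ 2 - (2 * b - 2 * a - (n - t) + 2 * i + 1) ^ 2 / 4
          = ((-((2 * q + (n - t - i)) * (2 * p + 2 * q + (2 * n + 1 - t - i))) : ℝ) : ℂ) := by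
        rw [ha, hb, hc]; push_cast; ring
      rw [e, Complex.ofReal_ne_zero]
      exact neg_ne_zero.2 (mul_ne_zero (by linarith) (by linarith))
    · have e : ((i : ℂ) + 1) * (n - t - i) = (((i + 1) * (n - t - i) : ℝ) : ℂ) := by
        push_cast; ring
      rw [e, Complex.ofReal_ne_zero]
      exact mul_ne_zero (by linarith) (by linarith)

/-- The same with factors governed by i + 1 < t ≤ n and p, q ≥ 0. -/
theorem isSimpleModule_modO {n t : ℕ} (ht : 0 < t) (htn : t ≤ n) (hd : Even (t - 1)) {q p : ℝ}
    (hq : 0 ≤ q) (hp : 0 ≤ p) {a b c : ℂ} (ha : a = q) (hb : b = -(q + p - t / 2) - n - 1)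
    (hc : c = -p) : IsSimpleModule BI (ModO (t - 1) hd a b c) := by
  have hdc : ((t - 1 : ℕ) : ℂ) = t - 1 := by rw [Nat.cast_sub (by omega)]; simp
  have hle : ∀ i : ℕ, i < t - 1 → (i : ℝ) + 2 ≤ t := fun i hi => by
    have : i + 2 ≤ t := by omega
    exact_mod_cast this
  have htn' : (t : ℝ) ≤ n := by exact_mod_cast htn
  refine (splitModelO (t - 1) hd a b c).isSimpleModule (fun i hi => ?_) (fun i hi => ?_)
  · have h := hle i hi
    have hi0 : (0 : ℝ) ≤ i := Nat.cast_nonneg i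
    rcases Nat.even_or_odd i with he | ho
    · rw [phiO, if_neg (Nat.not_even_iff_odd.2 he.add_one), hdc]
      have e : ((i + 1 : ℕ) - (t - 1) - 1) * ((t - 1) + 1 - 2 * (i + 1 : ℕ) - 2 * a - 2 * b + 2 * c) / 2
          = (((i + 1 - t) * (n - i) : ℝ) : ℂ) := by
        rw [ha, hb, hc]; push_cast; ring
      rw [e, Complex.ofReal_ne_zero]
      exact mul_ne_zero (by linarith) (by linarith)
    · rw [phiO, if_pos ho.add_one, hdc]
      have e : (i + 1 : ℕ) * ((t - 1) + 1 - 2 * (i + 1 : ℕ) - 2 * a - 2 * b - 2 * c) / 2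
          = (((i + 1) * (n - i + 2 * p) : ℝ) : ℂ) := by
        rw [ha, hb, hc]; push_cast; ring
      rw [e, Complex.ofReal_ne_zero]
      exact mul_ne_zero (by linarith) (by linarith)
  · have h := hle i hi
    have hi0 : (0 : ℝ) ≤ i := Nat.cast_nonneg i
    rw [second_split_O hd _ _ _ hi, hdc]
    split_ifs with he
    · have e : -((i - (t - 1)) * ((t - 1) - 1 - 2 * i - 2 * b + 2 * a - 2 * c) / 2)
          = (((t - 1 - i) * (n - i + 2 * q + 2 * p) : ℝ) : ℂ) := by
        rw [ha, hb, hc]; push_cast; ring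
      rw [e, Complex.ofReal_ne_zero]
      exact mul_ne_zero (by linarith) (by linarith)
    · have e : -((i + 1) * ((t - 1) - 1 - 2 * i - 2 * b + 2 * a + 2 * c) / 2)
          = ((-((i + 1) * (n - i + 2 * q)) : ℝ) : ℂ) := by
        rw [ha, hb, hc]; push_cast; ring
      rw [e, Complex.ofReal_ne_zero]
      exact neg_ne_zero.2 (mul_ne_zero (by linarith) (by linarith))

end SecondSplit

/-! ### Carrying spectra and central values between descriptions -/

section Transfer

variable {M V V' : Type*} [AddCommGroup M] [Module BI M]
  [AddCommGroup V] [Module BI V] [Module ℂ V] [IsScalarTower ℂ BI V]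
  [AddCommGroup V'] [Module BI V'] [Module ℂ V'] [IsScalarTower ℂ BI V']

/-- Annihilating polynomials and eigenvalues are the same on V and on V × V, so V × V ≅ V' × V'
suffices and V ≅ V' need not be known. -/
theorem HasSpec.of_twoCopies (h : IsTwoCopies M V) (h' : IsTwoCopies M V') {u : BI} {d : ℕ} {a : ℂ}
    (hu : HasSpec (actEnd V' u) d a) : HasSpec (actEnd V u) d a := by
  obtain ⟨e⟩ := h
  obtain ⟨e'⟩ := h'
  let f : (V × V) ≃ₗ[BI] (V' × V') := e.symm.trans e'
  have h1 : HasSpec (actEnd (V' × V') u) d a := hu.prod fun _ => rfl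
  have h2 : HasSpec (actEnd (V × V) u) d a :=
    h1.of_injective (f.restrictScalars ℂ) fun v => f.map_smul u v
  exact h2.of_prod fun _ => rfl

theorem smul_eq_zero_of_twoCopies (h : IsTwoCopies M V) {u : BI} (hu : ∀ m : M, u • m = 0)
    (v : V) : u • v = 0 := by
  obtain ⟨e⟩ := h
  have h1 := congrArg e (hu (e.symm (v, 0)))
  rw [map_smul, map_zero, LinearEquiv.apply_symm_apply] at h1
  exact congrArg Prod.fst h1

variable {k : Fin 3 → ℝ} {n : ℕ}

/-- The element of the algebra that annihilates the monogenics. -/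
noncomputable def anticommElement (k : Fin 3 → ℝ) (n : ℕ) (i : Fin 3) : BI :=
  BI.gen i * BI.gen (i + 1) + BI.gen (i + 1) * BI.gen i - BI.gen (i + 2)
    - algebraMap ℂ BI (2 * k i * k (i + 1) + 2 * k (i + 2) * (k 0 + k 1 + k 2 + n + 1))

theorem anticommElement_smul (hn : Even n) (i : Fin 3) {f : DunklSpace k}
    (hf : f ∈ monogenics k n) : anticommElement k n i • f = 0 := by
  have h := anticomm_monogenics hf hn i
  rw [anticommElement, sub_smul, sub_smul, add_smul, mul_smul, mul_smul, algebraMap_smul,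
    sub_eq_zero]
  have e : ∀ i j, BI.gen i • BI.gen j • f = (biOp k i (biOp k j f) : SpinorPoly) := by
    intro i j
    rw [gen_smul_dunklSpace k j f]
    exact gen_smul_dunklSpace k i _
  rw [e, e, gen_smul_dunklSpace k (i + 2) f]
  exact h

theorem anticommElement_smul_div (hn : Even n) (i j : Fin 3) (f : monogenicsDiv k n j) :
    anticommElement k n i • f = 0 :=
  Subtype.ext (anticommElement_smul hn i f.2.1)

theorem anticommElement_smul_quot (hn : Even n) (i j : Fin 3) (f : MonogenicsQuot k n j) :
    anticommElement k n i • f = 0 := by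
  obtain ⟨f, rfl⟩ := Submodule.Quotient.mk_surjective _ f
  rw [← Submodule.Quotient.mk_smul]
  have : anticommElement k n i • f = 0 := Subtype.ext (anticommElement_smul hn i f.2)
  rw [this]; rfl

theorem signs_mul (ε : ℤˣ × ℤˣ) (i : Fin 3) :
    ((BI.signs ε i : ℤ) : ℂ) * ((BI.signs ε (i + 1) : ℤ) : ℂ) = ((BI.signs ε (i + 2) : ℤ) : ℂ) := by
  obtain ⟨e, f⟩ := ε
  rcases Int.units_eq_one_or e with rfl | rfl <;> rcases Int.units_eq_one_or f with rfl | rfl <;>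
    fin_cases i <;> simp [BI.signs]

theorem signAut_signAut (ε : ℤˣ × ℤˣ) (b : BI) : BI.signAut ε (BI.signAut ε b) = b :=
  (BI.signAut ε).symm_apply_apply b

/-- The signs of two generators multiply to that of the third, so a sign automorphism multiplies
each relation as a whole by one sign. -/
theorem hasCentral_of_anticomm (ε : ℤˣ × ℤˣ) (hV : ∀ i (v : V), anticommElement k n i • v = 0)
    {C : Fin 3 → ℂ} (hC : ∀ i, C i = ((BI.signs ε (i + 2) : ℤ) : ℂ) *
      (2 * k i * k (i + 1) + 2 * k (i + 2) * (k 0 + k 1 + k 2 + n + 1))) :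
    HasCentral (actEnd (Twist (BI.signAut ε) V) (BI.gen 0))
      (actEnd (Twist (BI.signAut ε) V) (BI.gen 1))
      (actEnd (Twist (BI.signAut ε) V) (BI.gen 2)) (C 0) (C 1) (C 2) := by
  have key : ∀ i, actEnd (Twist (BI.signAut ε) V) (BI.gen i)
        * actEnd (Twist (BI.signAut ε) V) (BI.gen (i + 1))
      + actEnd (Twist (BI.signAut ε) V) (BI.gen (i + 1))
        * actEnd (Twist (BI.signAut ε) V) (BI.gen i)
      - actEnd (Twist (BI.signAut ε) V) (BI.gen (i + 2)) = C i • 1 := by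
    intro i
    rw [← map_mul, ← map_mul, ← map_add, ← map_sub]
    refine LinearMap.ext fun v => ?_
    have h := hV i (show V from v)
    rw [anticommElement, sub_smul, algebraMap_smul, sub_eq_zero] at h
    have e : BI.signAut ε (BI.gen i * BI.gen (i + 1) + BI.gen (i + 1) * BI.gen i - BI.gen (i + 2))
        = ((BI.signs ε (i + 2) : ℤ) : ℂ) • (BI.gen i * BI.gen (i + 1) + BI.gen (i + 1) * BI.gen i
          - BI.gen (i + 2)) := by
      rw [map_sub, map_add, map_mul, map_mul, BI.signAut_gen, BI.signAut_gen, BI.signAut_gen,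
        smul_mul_smul_comm, smul_mul_smul_comm, mul_comm ((BI.signs ε (i + 1) : ℤ) : ℂ),
        signs_mul, smul_sub, smul_add]
    show BI.signAut ε (BI.gen i * BI.gen (i + 1) + BI.gen (i + 1) * BI.gen i - BI.gen (i + 2))
      • (show V from v) = C i • (show V from v)
    rw [e, smul_assoc, h, smul_smul, hC]
  exact ⟨key 0, key 1, key 2⟩

end Transfer

/-! ### Assembly of the cyclically symmetric statement -/

section Main

variable {k : Fin 3 → ℝ} {n t : ℕ} {l : Fin 3}

/-- Supplies a twist for the second description, where only its effect on the generators matters. -/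
theorem exists_signedShift (l : Fin 3) : ∃ ψ, SignedShift ψ l 1 (-1) := by
  obtain ⟨σ, h0, h1, h2⟩ : ∃ σ : Equiv.Perm (Fin 3), σ l = 2 ∧ σ (l + 1) = 0 ∧ σ (l + 2) = 1 := by
    revert l; decide
  refine ⟨BI.aut (1, -1) σ, ?_, ?_, ?_⟩ <;> rw [BI.aut_gen] <;> simp [h0, h1, h2, BI.signs]

theorem actEnd_twist {V : Type*} [AddCommGroup V] [Module BI V] [Module ℂ V] [IsScalarTower ℂ BI V]
    {ψ : BI ≃ₐ[ℂ] BI} {u v : BI} {s : ℂ} (h : ψ u = s • v) (s' : ℂ) (hs : s' * s = 1)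
    {d : ℕ} {a : ℂ} (hV : HasSpec (actEnd V v) d a) : HasSpec (actEnd (Twist ψ V) (s' • u)) d a := by
  have e : actEnd (Twist ψ V) (s' • u) = (actEnd V v : Module.End ℂ V) := by
    refine LinearMap.ext fun w => ?_
    show ψ (s' • u) • (show V from w) = v • (show V from w)
    rw [map_smul, h, smul_smul, hs, one_smul]
  exact e ▸ hV

/-- The spectra of the generators on the summands of `ℳₙ(xⱼ)`. -/
theorem hasSpec_div (hn : Even n) (ht : Odd t) (htn : t ≤ n) (hk : 2 * k (l + 2) = -(t : ℝ))
    (hl : (n : ℕ∞) < tIndex (k l)) (hl1 : (n : ℕ∞) < tIndex (k (l + 1)))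
    {ψ : BI ≃ₐ[ℂ] BI} (hψ : SignedShift ψ l (-1) 1) {a b c : ℂ}
    (ha : a = k l + (n + 1) / 2) (hb : b = -(k 0 + k 1 + k 2) - (n + 1) / 2)
    (hc : c = -k (l + 1) - (n + 1) / 2) (hd : Odd (n - t)) :
    HasSpec (actEnd (Twist ψ (ModE (n - t) hd a b c)) ((-1 : ℂ) • BI.gen (l + 1))) (n - t)
        (k l + (n + 1) / 2) ∧
      HasSpec (actEnd (Twist ψ (ModE (n - t) hd a b c)) ((1 : ℂ) • BI.gen (l + 2))) (n - t)
        (k 0 + k 1 + k 2 + (n + 1) / 2) ∧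
      HasSpec (actEnd (Twist ψ (ModE (n - t) hd a b c)) ((-1 : ℂ) • BI.gen l)) (n - t)
        (k (l + 1) + (n + 1) / 2) := by
  obtain ⟨q1, q2, q3, q4⟩ := fin3_add l
  refine ⟨actEnd_twist hψ.one _ (by norm_num) (ha ▸ (splitModelE (n - t) hd a b c).hasSpec_zero),
    actEnd_twist hψ.two _ (by norm_num) ?_, ?_⟩
  · have hb : b = -((k 0 + k 1 + k 2) + (n + 1) / 2) := by rw [hb]; ring
    rw [hb]
    exact (hasSpec_endY_neg_of_odd hd _ _).of_injective
      (splitModelE (n - t) hd a _ c).equiv fun v => (splitModelE (n - t) hd a _ c).gen_smul 1 v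
  -- On the plane x_l = 0 the generator of index l is not bidiagonal. On the plane x_{l+1} = 0 it is
  -- the upper bidiagonal one, since (l + 1) + 2 = l, so its spectrum comes from the second
  -- description.
  · have h1 := div_isTwoCopies_one hn ht htn hk hl hl1 hψ ha hb hc hd
    obtain ⟨ψ', hψ'⟩ := exists_signedShift (l + 1)
    have h2 := div_isTwoCopies_two (l := l + 1) hn ht htn (by rw [q1]; exact hk) hl1 hψ' rfl rfl rfl hd
    rw [q1, q2] at h2
    refine HasSpec.of_twoCopies h1 h2 ?_
    have h3 := hψ'.two
    rw [q2] at h3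
    refine actEnd_twist h3 _ (by norm_num) ?_
    have hb' : -(k (l + 1) : ℂ) - (n + 1) / 2 = -(k (l + 1) + (n + 1) / 2) := by ring
    rw [hb']
    exact (hasSpec_endY_neg_of_odd hd _ _).of_injective
      (splitModelE (n - t) hd _ _ _).equiv fun v => (splitModelE (n - t) hd _ _ _).gen_smul 1 v

/-- The spectra of the generators on the summands of `ℳₙ / ℳₙ(xⱼ)`. -/
theorem hasSpec_quot (hn : Even n) (ht : Odd t) (htn : t ≤ n) (hk : 2 * k (l + 2) = -(t : ℝ))
    (hl : (n : ℕ∞) < tIndex (k l)) (hl1 : (n : ℕ∞) < tIndex (k (l + 1)))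
    {ψ : BI ≃ₐ[ℂ] BI} (hψ : SignedShift ψ l 1 (-1)) {a b c : ℂ}
    (ha : a = k l) (hb : b = -(k 0 + k 1 + k 2) - n - 1)
    (hc : c = -k (l + 1)) (hd : Even (t - 1)) :
    HasSpec (actEnd (Twist ψ (ModO (t - 1) hd a b c)) ((1 : ℂ) • BI.gen (l + 1))) (t - 1) (k l) ∧
      HasSpec (actEnd (Twist ψ (ModO (t - 1) hd a b c)) ((1 : ℂ) • BI.gen (l + 2))) (t - 1)
        (k 0 + k 1 + k 2 + n + 1) ∧
      HasSpec (actEnd (Twist ψ (ModO (t - 1) hd a b c)) ((1 : ℂ) • BI.gen l)) (t - 1)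
        (k (l + 1)) := by
  obtain ⟨q1, q2, q3, q4⟩ := fin3_add l
  have hY : ∀ a β c : ℂ, HasSpec (actEnd (ModO (t - 1) hd a (-β) c) (-BI.gen 1)) (t - 1) β :=
    fun a β c => (hasSpec_neg_endY_of_even hd _ _).of_injective
      (splitModelO (t - 1) hd a (-(β : ℂ)) c).equiv fun v => by
        have h := (splitModelO (t - 1) hd a (-β) c).gen_smul 1 v
        rw [Algebra.lsmul_coe]
        beta_reduce
        rw [neg_smul, map_neg, h]
        rfl
  refine ⟨actEnd_twist hψ.one _ (by norm_num) (ha ▸ (splitModelO (t - 1) hd a b c).hasSpec_zero),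
    actEnd_twist (v := -BI.gen 1) (s := 1) (by rw [hψ.two]; simp) _ (by norm_num) ?_, ?_⟩
  · have hb : b = -(k 0 + k 1 + k 2 + n + 1) := by rw [hb]; ring
    rw [hb]
    exact hY _ _ _
  -- As for the submodule, the plane x_{l+1} = 0 makes the generator of index l bidiagonal.
  · have h1 := quot_isTwoCopies_one hn ht htn hk hl hl1 hψ ha hb hc hd
    obtain ⟨ψ', hψ'⟩ := exists_signedShift (l + 1)
    have h2 := quot_isTwoCopies_two (l := l + 1) hn ht htn (by rw [q1]; exact hk) hl1 hψ'
      rfl rfl rfl hd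
    rw [q1, q2] at h2
    refine HasSpec.of_twoCopies h1 h2 ?_
    have h3 := hψ'.two
    rw [q2] at h3
    exact actEnd_twist (v := -BI.gen 1) (s := 1) (by rw [h3]; simp) _ (by norm_num) (hY _ _ _)

section Recognition

variable {V : Type*} [AddCommGroup V] [Module BI V] [Module ℂ V] [IsScalarTower ℂ BI V] {d : ℕ}

theorem hasSpec_twist_signAut {ε : ℤˣ × ℤˣ} {i : Fin 3} {a : ℂ}
    (h : HasSpec (actEnd V (((BI.signs ε i : ℤ) : ℂ) • BI.gen i)) d a) :
    HasSpec (actEnd (Twist (BI.signAut ε) V) (BI.gen i)) d a := by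
  have h1 := actEnd_twist (ψ := BI.signAut ε) (s := 1) (by rw [BI.signAut_gen, one_smul]) 1
    (by norm_num) h
  rwa [one_smul] at h1

theorem isIsomorphic_twist_modE [IsSimpleModule BI V] [Module.Finite ℂ V]
    (hV : Module.finrank ℂ V = d + 1) (hd : Odd d) (ε : ℤˣ × ℤˣ) {A : Fin 3 → ℝ} (hA : 0 ≤ A 1)
    (hs : ∀ i, HasSpec (actEnd V (((BI.signs ε i : ℤ) : ℂ) • BI.gen i)) d (A i))
    (hV' : ∀ i (v : V), anticommElement k n i • v = 0)
    (hC : ∀ i, (A (i + 2) : ℂ) ^ 2 - A i ^ 2 - A (i + 1) ^ 2 + ((d : ℂ) + 1) ^ 2 / 4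
      = ((BI.signs ε (i + 2) : ℤ) : ℂ) *
        (2 * k i * k (i + 1) + 2 * k (i + 2) * (k 0 + k 1 + k 2 + n + 1)))
    {a b c : ℂ} (ha : a = A 0) (hb : b = A 1) (hc : c = A 2) :
    IsIsomorphic V (Twist (BI.signAut ε) (ModE d hd a b c)) := by
  subst ha hb hc
  have : IsSimpleModule BI (Twist (BI.signAut ε) V) := isSimpleModule_twist _
  have : Module.Finite ℂ (Twist (BI.signAut ε) V) := ‹Module.Finite ℂ V›
  exact (isIsomorphic_modE (N := Twist (BI.signAut ε) V)
    (show Module.finrank ℂ (Twist (BI.signAut ε) V) = d + 1 from hV) hd hA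
    (hasSpec_twist_signAut (hs 0)) (hasSpec_twist_signAut (hs 1))
    (hasCentral_of_anticomm ε hV' hC)).of_twist (signAut_signAut ε)

theorem isIsomorphic_twist_modO [IsSimpleModule BI V] [Module.Finite ℂ V]
    (hV : Module.finrank ℂ V = d + 1) (hd : Even d) (ε : ℤˣ × ℤˣ) {A : Fin 3 → ℝ} (hA : 0 ≤ A 1)
    (hs : ∀ i, HasSpec (actEnd V (((BI.signs ε i : ℤ) : ℂ) • BI.gen i)) d (A i))
    (hV' : ∀ i (v : V), anticommElement k n i • v = 0)
    (hC : ∀ i, 2 * (A i : ℂ) * A (i + 1) - A (i + 2) * (d + 1)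
      = ((BI.signs ε (i + 2) : ℤ) : ℂ) *
        (2 * k i * k (i + 1) + 2 * k (i + 2) * (k 0 + k 1 + k 2 + n + 1)))
    {a b c : ℂ} (ha : a = A 0) (hb : b = A 1) (hc : c = A 2) :
    IsIsomorphic V (Twist (BI.signAut ε) (ModO d hd a b c)) := by
  subst ha hb hc
  have : IsSimpleModule BI (Twist (BI.signAut ε) V) := isSimpleModule_twist _
  have : Module.Finite ℂ (Twist (BI.signAut ε) V) := ‹Module.Finite ℂ V›
  exact (isIsomorphic_modO (N := Twist (BI.signAut ε) V)
    (show Module.finrank ℂ (Twist (BI.signAut ε) V) = d + 1 from hV) hd hA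
    (hasSpec_twist_signAut (hs 0)) (hasSpec_twist_signAut (hs 1))
    (hasCentral_of_anticomm ε hV' hC)).of_twist (signAut_signAut ε)

theorem IsIsomorphic.of_twist_one {M T : Type*} [AddCommGroup M] [Module BI M] [AddCommGroup T]
    [Module BI T] (h : IsIsomorphic M (Twist (BI.signAut 1) T)) : IsIsomorphic M T := by
  obtain ⟨e⟩ := h
  have h1 : ∀ b, BI.signAut 1 b = b := by
    have : (BI.signAut 1 : BI →ₐ[ℂ] BI) = AlgHom.id ℂ BI := by
      refine BI.algHom_ext fun i => ?_
      show BI.signAut 1 (BI.gen i) = BI.gen i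
      rw [BI.signAut_gen]
      fin_cases i <;> simp [BI.signs]
    exact fun b => DFunLike.congr_fun this b
  refine ⟨{ toFun := fun v => e v, invFun := fun t => e.symm t, map_add' := fun v w => e.map_add v w,
            map_smul' := fun b v => ?_, left_inv := e.symm_apply_apply,
            right_inv := e.apply_symm_apply }⟩
  have h : e (b • v) = @HSMul.hSMul BI T T _ (BI.signAut 1 b) (e v) := e.map_smul b v
  rw [h1] at h
  exact h

end Recognition

/-- The distinguished coordinate is x_{l+2}. The first pair of modules is twisted by a cyclic shift
depending on l, the second pair only by signs; so its parameters are collected by position in a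
function A and then read off as A 0, A 1, A 2. -/
theorem hasStructure_of_tIndex (hn : Even n) (ht : Odd t) (htn : t ≤ n)
    (hk : 2 * k (l + 2) = -(t : ℝ)) (hl : (n : ℕ∞) < tIndex (k l))
    (hl1 : (n : ℕ∞) < tIndex (k (l + 1))) (hE : Odd (n - t)) (hO : Even (t - 1))
    {ψ : BI ≃ₐ[ℂ] BI} (hψ : SignedShift ψ l (-1) 1)
    {ψ' : BI ≃ₐ[ℂ] BI} (hψ' : SignedShift ψ' l 1 (-1)) {ε : ℤˣ × ℤˣ}
    (hε : BI.signs ε l = -1 ∧ BI.signs ε (l + 1) = -1 ∧ BI.signs ε (l + 2) = 1)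
    {p : Prop} (hp : p → 0 ≤ k l ∧ 0 ≤ k (l + 1))
    {a b c a' b' c' x y z x' y' z' : ℂ}
    (ha : a = k l + (n + 1) / 2) (hb : b = -(k 0 + k 1 + k 2) - (n + 1) / 2)
    (hc : c = -k (l + 1) - (n + 1) / 2)
    (ha' : a' = k l) (hb' : b' = -(k 0 + k 1 + k 2) - n - 1) (hc' : c' = -k (l + 1))
    (hx : ∀ A : Fin 3 → ℂ, A l = k (l + 1) + (n + 1) / 2 → A (l + 1) = k l + (n + 1) / 2 →
      A (l + 2) = k 0 + k 1 + k 2 + (n + 1) / 2 → x = A 0 ∧ y = A 1 ∧ z = A 2)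
    (hx' : ∀ A : Fin 3 → ℂ, A l = k (l + 1) → A (l + 1) = k l →
      A (l + 2) = k 0 + k 1 + k 2 + n + 1 → x' = A 0 ∧ y' = A 1 ∧ z' = A 2) :
    HasStructure k n (l + 2) p (Twist ψ (ModE (n - t) hE a b c))
      (Twist ψ' (ModO (t - 1) hO a' b' c')) (Twist (BI.signAut ε) (ModE (n - t) hE x y z))
      (ModO (t - 1) hO x' y' z') := by
  have h1 := div_isTwoCopies_one hn ht htn hk hl hl1 hψ ha hb hc hE
  have h2 := quot_isTwoCopies_one hn ht htn hk hl hl1 hψ' ha' hb' hc' hO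
  refine ⟨h1, h2, fun h => ?_⟩
  obtain ⟨hq, hr⟩ := hp h
  have hl01 : l ≠ l + 1 ∧ l ≠ l + 2 ∧ l + 1 ≠ l + 2 := by
    obtain ⟨u, v, w⟩ := fin3_ne l
    exact ⟨u.symm, v.symm, w.symm⟩
  have hcase : ∀ i, i = l ∨ i = l + 1 ∨ i = l + 2 := by fin_cases l <;> decide
  obtain ⟨q1, q2, q3, q4⟩ := fin3_add l
  have hKR : k 0 + k 1 + k 2 = k l + k (l + 1) + k (l + 2) := by
    rw [← fin3_sum l k, Fin.sum_univ_three]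
  have hK : (k 0 + k 1 + k 2 : ℂ) = k l + k (l + 1) + k (l + 2) := by exact_mod_cast hKR
  have hk' := multiplicity_eq hk
  have htn' : (t : ℝ) ≤ n := by exact_mod_cast htn
  have hEs : IsSimpleModule BI (ModE (n - t) hE a b c) :=
    isSimpleModule_modE htn hE hq hr ha (by rw [hb, hK, hk']; ring) hc
  have hOs : IsSimpleModule BI (ModO (t - 1) hO a' b' c') :=
    isSimpleModule_modO ht.pos htn hO hq hr ha' (by rw [hb', hK, hk']; ring) hc'
  have hEt : IsSimpleModule BI (Twist ψ (ModE (n - t) hE a b c)) := isSimpleModule_twist ψ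
  have hOt : IsSimpleModule BI (Twist ψ' (ModO (t - 1) hO a' b' c')) := isSimpleModule_twist ψ'
  have hEf : Module.Finite ℂ (Twist ψ (ModE (n - t) hE a b c)) :=
    (splitModelE (n - t) hE a b c).finite
  have hOf : Module.Finite ℂ (Twist ψ' (ModO (t - 1) hO a' b' c')) :=
    (splitModelO (t - 1) hO a' b' c').finite
  have hEr : Module.finrank ℂ (Twist ψ (ModE (n - t) hE a b c)) = n - t + 1 :=
    (splitModelE (n - t) hE a b c).finrank
  have hOr : Module.finrank ℂ (Twist ψ' (ModO (t - 1) hO a' b' c')) = t - 1 + 1 :=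
    (splitModelO (t - 1) hO a' b' c').finrank
  have hEd : ((n - t : ℕ) : ℂ) = n - t := Nat.cast_sub htn
  have hOd : ((t - 1 : ℕ) : ℂ) = t - 1 := by
    have := ht.pos
    rw [Nat.cast_sub (by omega)]; simp
  have hfun : ∀ u v w : ℝ, ∃ A : Fin 3 → ℝ, A l = u ∧ A (l + 1) = v ∧ A (l + 2) = w := by
    intro u v w
    exact ⟨fun i => if i = l then u else if i = l + 1 then v else w, by simp,
      by simp [hl01.1.symm], by simp [hl01.2.1.symm, hl01.2.2.symm]⟩
  refine ⟨hEt, hOt, ?_, ?_⟩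
  · obtain ⟨A, A0, A1, A2⟩ := hfun (k (l + 1) + (n + 1) / 2) (k l + (n + 1) / 2)
      (k 0 + k 1 + k 2 + (n + 1) / 2)
    obtain ⟨hx, hy, hz⟩ := hx (fun i => (A i : ℂ)) (by rw [A0]; push_cast; ring)
      (by rw [A1]; push_cast; ring) (by rw [A2]; push_cast; ring)
    obtain ⟨s1, s2, s0⟩ := hasSpec_div hn ht htn hk hl hl1 hψ ha hb hc hE
    have hn0 : (0 : ℝ) ≤ n := Nat.cast_nonneg n
    refine isIsomorphic_twist_modE (V := Twist ψ (ModE (n - t) hE a b c)) (k := k) (n := n)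
      hEr hE ε (A := A) ?_
      (fun i => ?_) (fun i => smul_eq_zero_of_twoCopies h1 (anticommElement_smul_div hn i _))
      (fun i => ?_) hx hy hz
    -- Recognition needs the parameter of Y to be nonnegative, and the index 1 can be any of the
    -- three positions. For the position l + 2 this uses k_{l+2} = -t/2 and t ≤ n.
    · rcases hcase 1 with h | h | h <;> rw [h]
      · rw [A0]; positivity
      · rw [A1]; positivity
      · rw [A2, hKR]; linarith
    · rcases hcase i with rfl | rfl | rfl
      · rw [hε.1, A0]; simpa using s0
      · rw [hε.2.1, A1]; simpa using s1
      · rw [hε.2.2, A2]; simpa using s2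
    -- The three central values agree as polynomials in the multiplicities once k_{l+2} = -t/2 is
    -- substituted.
    · rcases hcase i with rfl | rfl | rfl
      · rw [hε.2.2, A0, A1, A2, hEd]
        push_cast; rw [hK, hk']; ring
      · rw [q1, q2, hε.1, A0, A1, A2, hEd]
        push_cast; rw [hK, hk']; ring
      · rw [q3, q4, hε.2.1, A0, A1, A2, hEd]
        push_cast; rw [hK, hk']; ring
  · obtain ⟨A, A0, A1, A2⟩ := hfun (k (l + 1)) (k l) (k 0 + k 1 + k 2 + n + 1)
    obtain ⟨hx, hy, hz⟩ := hx' (fun i => (A i : ℂ)) (by rw [A0])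
      (by rw [A1]) (by rw [A2]; push_cast; ring)
    obtain ⟨s1, s2, s0⟩ := hasSpec_quot hn ht htn hk hl hl1 hψ' ha' hb' hc' hO
    have hε' : ∀ i, BI.signs 1 i = 1 := by
      intro i; fin_cases i <;> simp [BI.signs]
    refine (isIsomorphic_twist_modO (V := Twist ψ' (ModO (t - 1) hO a' b' c')) (k := k) (n := n)
      hOr hO 1 (A := A) ?_
      (fun i => ?_) (fun i => smul_eq_zero_of_twoCopies h2 (anticommElement_smul_quot hn i _))
      (fun i => ?_) hx hy hz).of_twist_one
    · rcases hcase 1 with h | h | h <;> rw [h]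
      · rw [A0]; exact hr
      · rw [A1]; exact hq
      · rw [A2, hKR]; linarith
    · rw [hε']
      rcases hcase i with rfl | rfl | rfl
      · rw [A0]; simpa using s0
      · rw [A1]; simpa using s1
      · rw [A2]; simpa using s2
    · rw [hε']
      rcases hcase i with rfl | rfl | rfl
      · rw [A0, A1, A2, hOd]
        push_cast; rw [hK, hk']; ring
      · rw [q1, q2, A0, A1, A2, hOd]
        push_cast; rw [hK, hk']; ring
      · rw [q3, q4, A0, A1, A2, hOd]
        push_cast; rw [hK, hk']; ring

theorem exists_eq_of_tIndex_le {κ : ℝ} (h : tIndex κ ≤ n) :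
    2 * κ = -(((tIndex κ).toNat : ℕ) : ℝ) := by
  rcases tIndex_cases κ with ⟨m, -, h1, h2⟩ | ⟨-, h2⟩
  · rw [h2]; exact h1
  · rw [h2] at h; simp at h

end Main

end DunklBI

theorem theorem7p5 (k : Fin 3 → ℝ) (n : ℕ) (hn : Even n) :
    (∀ ht : tIndex (k 1) ≤ n, n < min (tIndex (k 0)) (tIndex (k 2)) →
      HasStructure k n 1 (0 ≤ k 0 ∧ 0 ≤ k 2)
        (Twist (BI.signAut (-1, 1))
          (ModE (n - (tIndex (k 1)).toNat) (odd_sub_tIndex hn ht)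
            (k 2 + (n + 1) / 2) (-k 0 - k 1 - k 2 - (n + 1) / 2) (-k 0 - (n + 1) / 2)))
        (Twist (BI.signAut (1, -1))
          (ModO ((tIndex (k 1)).toNat - 1) (even_tIndex_sub_one ht)
            (k 2) (-k 0 - k 1 - k 2 - n - 1) (-k 0)))
        (Twist (BI.signAut (-1, 1))
          (ModE (n - (tIndex (k 1)).toNat) (odd_sub_tIndex hn ht)
            (k 2 + (n + 1) / 2) (k 0 + k 1 + k 2 + (n + 1) / 2) (k 0 + (n + 1) / 2)))
        (ModO ((tIndex (k 1)).toNat - 1) (even_tIndex_sub_one ht)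
          (k 2) (k 0 + k 1 + k 2 + n + 1) (k 0))) ∧
    -- `(finRotate 3)⁻¹` is the cycle (1 3 2): it sends `X, Y, Z` to `Z, X, Y`
    (∀ ht : tIndex (k 2) ≤ n, n < min (tIndex (k 0)) (tIndex (k 1)) →
      HasStructure k n 2 (0 ≤ k 0 ∧ 0 ≤ k 1)
        (Twist (BI.aut (-1, 1) (finRotate 3)⁻¹)
          (ModE (n - (tIndex (k 2)).toNat) (odd_sub_tIndex hn ht)
            (k 0 + (n + 1) / 2) (-k 0 - k 1 - k 2 - (n + 1) / 2) (-k 1 - (n + 1) / 2)))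
        (Twist (BI.aut (1, -1) (finRotate 3)⁻¹)
          (ModO ((tIndex (k 2)).toNat - 1) (even_tIndex_sub_one ht)
            (k 0) (-k 0 - k 1 - k 2 - n - 1) (-k 1)))
        (Twist (BI.signAut (-1, -1))
          (ModE (n - (tIndex (k 2)).toNat) (odd_sub_tIndex hn ht)
            (k 1 + (n + 1) / 2) (k 0 + (n + 1) / 2) (k 0 + k 1 + k 2 + (n + 1) / 2)))
        (ModO ((tIndex (k 2)).toNat - 1) (even_tIndex_sub_one ht)
          (k 1) (k 0) (k 0 + k 1 + k 2 + n + 1))) ∧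
    -- `finRotate 3` is the cycle (1 2 3): it sends `X, Y, Z` to `Y, Z, X`
    (∀ ht : tIndex (k 0) ≤ n, n < min (tIndex (k 1)) (tIndex (k 2)) →
      HasStructure k n 0 (0 ≤ k 1 ∧ 0 ≤ k 2)
        (Twist (BI.aut (-1, 1) (finRotate 3))
          (ModE (n - (tIndex (k 0)).toNat) (odd_sub_tIndex hn ht)
            (k 1 + (n + 1) / 2) (-k 0 - k 1 - k 2 - (n + 1) / 2) (-k 2 - (n + 1) / 2)))
        (Twist (BI.aut (1, -1) (finRotate 3))
          (ModO ((tIndex (k 0)).toNat - 1) (even_tIndex_sub_one ht)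
            (k 1) (-k 0 - k 1 - k 2 - n - 1) (-k 2)))
        (Twist (BI.signAut (1, -1))
          (ModE (n - (tIndex (k 0)).toNat) (odd_sub_tIndex hn ht)
            (k 0 + k 1 + k 2 + (n + 1) / 2) (k 2 + (n + 1) / 2) (k 1 + (n + 1) / 2)))
        (ModO ((tIndex (k 0)).toNat - 1) (even_tIndex_sub_one ht)
          (k 0 + k 1 + k 2 + n + 1) (k 2) (k 1))) := by
  refine ⟨fun ht h => ?_, fun ht h => ?_, fun ht h => ?_⟩
  · obtain ⟨h0, h1⟩ := lt_min_iff.1 h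
    -- The index l is the cyclic successor of the distinguished coordinate: 2 + 2 = 1 in `Fin 3`.
    refine hasStructure_of_tIndex (l := 2) hn (odd_toNat_tIndex ht)
      (ENat.toNat_le_of_le_natCast ht) (exists_eq_of_tIndex_le ht) h1 h0 _ _
      ⟨?_, ?_, ?_⟩ ⟨?_, ?_, ?_⟩ (by decide) And.symm (by ring) (by ring) rfl rfl
      (by ring) rfl (fun A u v w => ⟨v.symm, w.symm, u.symm⟩) (fun A u v w => ⟨v.symm, w.symm, u.symm⟩)
    all_goals simp [BI.signAut_gen, BI.signs]
  · obtain ⟨h0, h1⟩ := lt_min_iff.1 h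
    refine hasStructure_of_tIndex (l := 0) hn (odd_toNat_tIndex ht)
      (ENat.toNat_le_of_le_natCast ht) (exists_eq_of_tIndex_le ht) h0 h1 _ _
      ⟨?_, ?_, ?_⟩ ⟨?_, ?_, ?_⟩ (by decide) id (by ring) (by ring) rfl rfl
      (by ring) rfl (fun A u v w => ⟨u.symm, v.symm, w.symm⟩) (fun A u v w => ⟨u.symm, v.symm, w.symm⟩)
    all_goals simp [BI.aut_gen, BI.signs]
    all_goals rfl
  · obtain ⟨h0, h1⟩ := lt_min_iff.1 h
    refine hasStructure_of_tIndex (l := 1) hn (odd_toNat_tIndex ht)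
      (ENat.toNat_le_of_le_natCast ht) (exists_eq_of_tIndex_le ht) h0 h1 _ _
      ⟨?_, ?_, ?_⟩ ⟨?_, ?_, ?_⟩ (by decide) id (by ring) (by ring) rfl rfl
      (by ring) rfl (fun A u v w => ⟨w.symm, u.symm, v.symm⟩) (fun A u v w => ⟨w.symm, u.symm, v.symm⟩)
    all_goals simp [BI.aut_gen, BI.signs]
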